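/- Let $X$ be a connected (Hausdorff, second countable) Hermitian manifold of complex dimension $n$, i.e. a complex manifold with a smooth Riemannian metric invariant under the complex structure. Let $dV_X$ be its volume measure, $\operatorname{dist}_X$ its distance (infimum of lengths of curves), and let $|\cdot|$ denote the norm of tangent vectors and the induced pointwise norm of complex-valued differential forms. Let $\varphi\in C^0(X)$ be real-valued and let $L^2_{p,q}(X,\varphi)$ be the Hilbert space of (classes of) measurable $(p,q)$-forms $f$ with $\|f\|^2=\int_X|f|^2e^{-\varphi}\,dV_X<\infty$; the same formula defines $\|g\|\in[0,\infty]$ for arbitrary measurable complex-valued $(p+q)$-forms $g$, and integration over $S\subset X$ defines $\|f\|_{L^2_{p,q}(S,\varphi)}$. The total space $TX$ carries the Hermitian metric induced by that of $X$: the Chern connection splits the tangent spaces of $TX$ into a horizontal and a vertical part, each identified with a tangent space of $X$, and the two parts are declared orthogonal; $\operatorname{dist}_{TX}$ is the resulting distance. For a smooth diffeomorphism $\Phi:X\to X$ put $$\operatorname{md}(\Phi)=\sup_{x\in X}\operatorname{dist}_X(x,\Phi(x)),\qquad \|\Phi_*-\mathrm{id}\|_\infty=\sup_{x\in X}\ \sup_{v\in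 T_xX,\ |v|=1}\operatorname{dist}_{TX}(\Phi_*v,v).$$ For $\Omega\subset X$ open and $\delta>0$, a $\delta$-variation of $\Omega$ in $X$ is a smooth diffeomorphism $\Phi:X\to X$ with $\Phi(\Omega)=\Omega$, $\Phi=\mathrm{id}$ on $X\setminus\Omega$, $\operatorname{md}(\Phi)<\delta$, $\|\Phi_*-\mathrm{id}\|_\infty<3\delta$ and $\|(\Phi^{-1})_*-\mathrm{id}\|_\infty<3\delta$. A $\delta$-deformation of $\Omega$ in $X$ is a $\delta$-variation $\Phi$ for which there is a smooth map $[0,1]\times X\to X$, $(t,x)\mapsto\Phi_t(x)$, such that every $\Phi_t$ is a $\delta$-variation of $\Omega$ in $X$, $\Phi_0=\mathrm{id}$, $\Phi_1=\Phi$, and $\left|\frac{\partial}{\partial t}\Phi_t(x)\right|\le3\delta$ for all $t\in[0,1]$, $x\in X$. Let $\operatorname{Def}_\delta(\Omega,X)$ be the set of all $\delta$-deformations of $\Omega$ in $X$. **Theorem.** Let $\mathcal A$ be a bounded subset of $L^2_{p,q}(X,\varphi)$. Then $\mathcal A$ is precompact (for every $\varepsilon>0$ it is covered by finitely many balls of radius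 $\varepsilon$) if and only if the following two conditions hold: (i) for all $\varepsilon>0$ and all open $\Omega\subset\subset X$ there exists $\delta>0$ such that $$\|\Phi^*f-f\|<\varepsilon\qquad\text{for all }\Phi\in\operatorname{Def}_\delta(\Omega,X)\text{ and all }f\in\mathcal A;$$ (ii) for all $\varepsilon>0$ there exists an open $\Omega_\varepsilon\subset\subset X$ such that $$\|f\|_{L^2_{p,q}(X\setminus\Omega_\varepsilon,\varphi)}<\varepsilon\qquad\text{for all }f\in\mathcal A.$$ -/

import Mathlib

open scoped Manifold ContDiff ENNReal Bundle Topology ComplexConjugate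
open MeasureTheory Bundle Set

noncomputable section

/- The complex manifolds of dimension `n` are modelled on `Fin n → ℂ`; the norm of the model space
plays no role beyond its topology and its smooth structure. -/

/-- A complex manifold is a smooth manifold. -/
instance isManifold_real_of_complex (n : ℕ) (X : Type*) [TopologicalSpace X]
    [ChartedSpace (Fin n → ℂ) X] [IsManifold 𝓘(ℂ, Fin n → ℂ) ω X] :
    IsManifold 𝓘(ℝ, Fin n → ℂ) ∞ X := by
  apply isManifold_of_contDiffOn
  intro e e' he he'
  have h := (contDiffGroupoid ω 𝓘(ℂ, Fin n → ℂ)).compatible (M := X) he he'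
  rw [contDiffGroupoid, mem_groupoid_of_pregroupoid] at h
  have h1 := h.1
  simp only [contDiffPregroupoid] at h1
  exact (ContDiffOn.restrict_scalars ℝ h1).of_le le_top

/-- The norm of an alternating form in terms of an arbitrary basis and its Gram matrix. -/
theorem sum_sq_orthonormalBasis_eq {V ι κ : Type*} [NormedAddCommGroup V] [InnerProductSpace ℝ V]
    [Fintype ι] [Fintype κ] [DecidableEq κ] [DecidableEq ι] {k : ℕ} (b : OrthonormalBasis ι ℝ V)
    (e : Module.Basis κ ℝ V)
    (α : V [⋀^Fin k]→ₗ[ℝ] ℂ) :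
    (∑ i : Fin k → ι, ‖α (fun j => b (i j))‖ ^ 2 : ℝ) =
      ∑ P : Fin k → κ, ∑ Q : Fin k → κ,
        (∏ s, (Matrix.of fun c d => inner ℝ (e c) (e d))⁻¹ (P s) (Q s)) *
          (α (fun j => e (P j)) * conj (α (fun j => e (Q j)))).re := by
  set T := e.toMatrix b with hT
  set S := b.toBasis.toMatrix e with hS
  have hTS : T * S = 1 := by
    have := e.toMatrix_mul_toMatrix_flip b.toBasis
    simpa [hT, hS] using this
  have hST : S * T = 1 := by
    have := b.toBasis.toMatrix_mul_toMatrix_flip e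
    simpa [hT, hS] using this
  have hG : (Matrix.of fun c d => inner ℝ (e c) (e d)) = S.transpose * S := by
    ext c d
    simp only [Matrix.of_apply, Matrix.mul_apply, Matrix.transpose_apply, hS,
      Module.Basis.toMatrix_apply, OrthonormalBasis.coe_toBasis_repr_apply,
      OrthonormalBasis.repr_apply_apply]
    rw [← b.sum_inner_mul_inner]
    simp [real_inner_comm]
  have hinv : (Matrix.of fun c d => inner ℝ (e c) (e d))⁻¹ = T * T.transpose := by
    apply Matrix.inv_eq_left_inv
    rw [hG]
    calc T * T.transpose * (S.transpose * S) = T * (S * T).transpose * S := by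
          rw [Matrix.transpose_mul]; simp only [Matrix.mul_assoc]
      _ = 1 := by rw [hST]; simp [hTS]
  have hb : ∀ i : Fin k → ι, α (fun j => b (i j)) =
      ∑ P : Fin k → κ, ((∏ s, T (P s) (i s) : ℝ) : ℂ) * α (fun j => e (P j)) := by
    intro i
    have : (fun j => b (i j)) = fun j => ∑ c, T c (i j) • e c := by
      funext j
      exact (e.sum_toMatrix_smul_self b (i j)).symm
    rw [this]
    have := α.toMultilinearMap.map_sum (fun j c => T c (i j) • e c)
    simp only [AlternatingMap.coe_multilinearMap] at this
    rw [this]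
    refine Finset.sum_congr rfl fun P _ => ?_
    have := α.toMultilinearMap.map_smul_univ (fun j => T (P j) (i j)) (fun j => e (P j))
    simp only [AlternatingMap.coe_multilinearMap] at this
    rw [this, Complex.real_smul]
  have key : ∀ P Q : Fin k → κ, (∏ s, (T * T.transpose) (P s) (Q s)) =
      ∑ i : Fin k → ι, (∏ s, T (P s) (i s)) * (∏ s, T (Q s) (i s)) := by
    intro P Q
    simp only [Matrix.mul_apply, Matrix.transpose_apply, ← Finset.prod_mul_distrib]
    rw [Finset.prod_univ_sum]
    simp
  rw [hinv]
  have hsq : ∀ z : ℂ, ‖z‖ ^ 2 = (z * conj z).re := by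
    intro z
    rw [Complex.mul_conj, Complex.ofReal_re, Complex.normSq_eq_norm_sq]
  simp_rw [hsq, hb, key, map_sum, Finset.sum_mul_sum, Complex.re_sum, Finset.sum_mul]
  rw [Finset.sum_comm]
  refine Finset.sum_congr rfl fun P _ => ?_
  rw [Finset.sum_comm]
  refine Finset.sum_congr rfl fun Q _ => ?_
  refine Finset.sum_congr rfl fun i _ => ?_
  simp only [map_mul, Complex.conj_ofReal]
  rw [mul_mul_mul_comm, ← Complex.ofReal_mul, Complex.re_ofReal_mul]


namespace HermitianManifold

section Metric

variable {n : ℕ} {X : Type*} [TopologicalSpace X] [ChartedSpace (Fin n → ℂ) X]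
  [IsManifold 𝓘(ℂ, Fin n → ℂ) ω X]
  [RiemannianBundle (fun x : X => TangentSpace 𝓘(ℝ, Fin n → ℂ) x)]

/-- Multiplication of a real tangent vector by a complex scalar. Since the coordinate changes are
holomorphic, it may be computed in the chart that defines `TangentSpace`. -/
def csmul {x : X} (c : ℂ) (v : TangentSpace 𝓘(ℝ, Fin n → ℂ) x) :
    TangentSpace 𝓘(ℝ, Fin n → ℂ) x :=
  let v' : Fin n → ℂ := v
  c • v'

/-- The norm of a tangent vector in the given Riemannian metric. -/
def tangentNorm (x : X) (v : TangentSpace 𝓘(ℝ, Fin n → ℂ) x) : ℝ := ‖v‖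

variable (n X) in
/-- The Riemannian metric is Hermitian: it is invariant under the complex structure. -/
def IsHermitianMetric : Prop :=
  ∀ (x : X) (v w : TangentSpace 𝓘(ℝ, Fin n → ℂ) x),
    inner ℝ (csmul Complex.I v) (csmul Complex.I w) = inner ℝ v w

/-- The Hermitian form `h` on the tangent spaces with real part the Riemannian metric,
conjugate-linear in the first and complex linear in the second variable. -/
def herm {x : X} (v w : TangentSpace 𝓘(ℝ, Fin n → ℂ) x) : ℂ :=
  ((inner ℝ v w : ℝ) : ℂ) - ((inner ℝ v (csmul Complex.I w) : ℝ) : ℂ) * Complex.I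

/-- The vector field on the domain of the chart at `x₀` with constant coordinates `u`. -/
def coordField (x₀ : X) (u : Fin n → ℂ) (x : X) : TangentSpace 𝓘(ℝ, Fin n → ℂ) x :=
  (trivializationAt (Fin n → ℂ) (TangentSpace 𝓘(ℝ, Fin n → ℂ)) x₀).symmL ℝ x u

/-- The Hermitian form read in the chart at `x₀`, at the point with coordinates `z`. -/
def hermCoord (x₀ : X) (z u w : Fin n → ℂ) : ℂ :=
  herm (coordField x₀ u ((extChartAt 𝓘(ℝ, Fin n → ℂ) x₀).symm z))
    (coordField x₀ w ((extChartAt 𝓘(ℝ, Fin n → ℂ) x₀).symm z))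

/-- The matrix `H j k = h (∂/∂z_j, ∂/∂z_k)` of the Hermitian form in the chart at `x₀`. -/
def hermMatrix (x₀ : X) (z : Fin n → ℂ) : Matrix (Fin n) (Fin n) ℂ :=
  Matrix.of fun j k => hermCoord x₀ z (Pi.single j 1) (Pi.single k 1)

/-- The Riemannian volume measure in the chart at `x₀`, transported to `X`: it has density `det H`
(the square root of the determinant of the real Gram matrix) with respect to Lebesgue measure. -/
def chartVolume [MeasurableSpace X] (x₀ : X) : Measure X :=
  ((volume.restrict (extChartAt 𝓘(ℝ, Fin n → ℂ) x₀).target).withDensity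
    (fun z => ENNReal.ofReal (hermMatrix x₀ z).det.re)).map
      (extChartAt 𝓘(ℝ, Fin n → ℂ) x₀).symm

variable (n X) in
/-- The volume measure `dV` of the Hermitian manifold: the chart volumes agree on overlaps, and
the volume measure is the least measure which is at least each of them. -/
def volumeMeasure [MeasurableSpace X] : Measure X :=
  ⨆ x₀ : X, chartVolume (n := n) x₀

/-- The distance on `X`: the infimum of the lengths of curves. -/
def riemDist (x y : X) : ℝ≥0∞ :=
  Manifold.riemannianEDist 𝓘(ℝ, Fin n → ℂ) x y

/-- The derivative at `x₀`, in the chart at `x₀`, of the function `h(u, w)` (with constant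
coordinates `u`, `w`) in the direction `ξ`. -/
def hermDeriv (x₀ : X) (ξ u w : Fin n → ℂ) : ℂ :=
  fderiv ℝ (fun z => hermCoord x₀ z u w) (extChartAt 𝓘(ℝ, Fin n → ℂ) x₀ x₀) ξ

/-- The `(1,0)`-part `∂h(u, w)(ξ)` of `dh(u, w)(ξ)` at `x₀`. -/
def hermDel (x₀ : X) (ξ u w : Fin n → ℂ) : ℂ :=
  (hermDeriv x₀ ξ u w - Complex.I * hermDeriv x₀ (Complex.I • ξ) u w) / 2

/-- The connection form `H⁻¹ ∂H` of the Chern connection of the tangent bundle, at `x₀` in the chart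
at `x₀`, applied to `ξ` and `v`: the vector `Γ` with `h(u, Γ) = ∂h(u, v)(ξ)` for all `u`. -/
def chernForm (x₀ : X) (ξ v : Fin n → ℂ) : Fin n → ℂ :=
  Matrix.mulVec (hermMatrix x₀ (extChartAt 𝓘(ℝ, Fin n → ℂ) x₀ x₀))⁻¹
    (fun j => hermDel x₀ ξ (Pi.single j 1) v)

/-- The norm of the Hermitian metric that the total space `TX` inherits from `X`: the Chern
connection splits the tangent spaces of `TX` into a horizontal and a vertical part, both copies of
tangent spaces of `X`, and the metric is the orthogonal sum of the two copies of the metric of `X`.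
A tangent vector of `TX` at `(x, v)` is, in the chart induced by the chart of `X` at `x`, a pair
`(ξ, η)`; its horizontal part is `ξ` and its vertical part is `η + Γ(ξ, v)`. -/
def tangentBundleNorm (P : TangentBundle 𝓘(ℝ, Fin n → ℂ) X)
    (ζ : TangentSpace 𝓘(ℝ, Fin n → ℂ).tangent P) : ℝ :=
  let ζ' : (Fin n → ℂ) × (Fin n → ℂ) := ζ
  √(tangentNorm P.proj ζ'.1 ^ 2 + tangentNorm P.proj (ζ'.2 + chernForm P.proj ζ'.1 P.snd) ^ 2)

/-- The distance on the Hermitian manifold `TX`. -/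
def riemDistTangent (P Q : TangentBundle 𝓘(ℝ, Fin n → ℂ) X) : ℝ≥0∞ :=
  @Manifold.riemannianEDist _ _ _ _ _ 𝓘(ℝ, Fin n → ℂ).tangent
    (TangentBundle 𝓘(ℝ, Fin n → ℂ) X) _ _
    (fun P => ⟨fun ζ => ENNReal.ofReal (tangentBundleNorm P ζ)⟩) P Q

/-- The mapping distance `md Φ = sup dist (x, Φ x)`. -/
def mapDist (Φ : X → X) : ℝ≥0∞ :=
  ⨆ x : X, riemDist (n := n) x (Φ x)

/-- `‖Φ_* - id‖_∞`, the supremum of `dist_TX (Φ_* v, v)` over all unit tangent vectors `v`. -/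
def derivDist (Φ : X → X) : ℝ≥0∞ :=
  ⨆ (x : X) (v : TangentSpace 𝓘(ℝ, Fin n → ℂ) x) (_ : tangentNorm x v = 1),
    riemDistTangent (n := n)
      ⟨Φ x, mfderiv 𝓘(ℝ, Fin n → ℂ) 𝓘(ℝ, Fin n → ℂ) Φ x v⟩ ⟨x, v⟩

/-- The `δ`-variations of `Ω` in `X`. -/
def Var (δ : ℝ) (Ω : Set X) :
    Set (X ≃ₘ^∞⟮𝓘(ℝ, Fin n → ℂ), 𝓘(ℝ, Fin n → ℂ)⟯ X) :=
  {Φ | Φ '' Ω = Ω ∧ (∀ x ∉ Ω, Φ x = x) ∧ mapDist (n := n) Φ < ENNReal.ofReal δ ∧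
    derivDist (n := n) Φ < ENNReal.ofReal (3 * δ) ∧
    derivDist (n := n) Φ.symm < ENNReal.ofReal (3 * δ)}

/-- The `δ`-deformations of `Ω` in `X`: the end points of smooth paths `[0,1] × X → X` in the set
of `δ`-variations that start at the identity and have speed at most `3 δ`. (The values of the
family `F` outside `[0,1]` are irrelevant.) -/
def Def (δ : ℝ) (Ω : Set X) :
    Set (X ≃ₘ^∞⟮𝓘(ℝ, Fin n → ℂ), 𝓘(ℝ, Fin n → ℂ)⟯ X) :=
  {Φ | ∃ F : ℝ → X ≃ₘ^∞⟮𝓘(ℝ, Fin n → ℂ), 𝓘(ℝ, Fin n → ℂ)⟯ X,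
    ContMDiffOn (𝓘(ℝ, ℝ).prod 𝓘(ℝ, Fin n → ℂ)) 𝓘(ℝ, Fin n → ℂ) ∞
      (fun tx : ℝ × X => F tx.1 tx.2) (Icc 0 1 ×ˢ univ) ∧
    (∀ t ∈ Icc (0 : ℝ) 1, F t ∈ Var δ Ω) ∧
    F 0 = Diffeomorph.refl _ X ∞ ∧ F 1 = Φ ∧
    ∀ t ∈ Icc (0 : ℝ) 1, ∀ x : X,
      tangentNorm (F t x)
        (mfderivWithin 𝓘(ℝ, ℝ) 𝓘(ℝ, Fin n → ℂ) (fun s : ℝ => F s x) (Icc 0 1) t (1 : ℝ)) ≤ 3 * δ}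

end Metric

section Forms

variable {n : ℕ} {X : Type*} [TopologicalSpace X] [ChartedSpace (Fin n → ℂ) X]
  [RiemannianBundle (fun x : X => TangentSpace 𝓘(ℝ, Fin n → ℂ) x)] {k : ℕ}

instance (x : X) : FiniteDimensional ℝ (TangentSpace 𝓘(ℝ, Fin n → ℂ) x) :=
  inferInstanceAs (FiniteDimensional ℝ (Fin n → ℂ))

variable (n X k) in
/-- Complex-valued differential forms of degree `k` (without any regularity). -/
abbrev Form : Type _ := ∀ x : X, (TangentSpace 𝓘(ℝ, Fin n → ℂ) x) [⋀^Fin k]→ₗ[ℝ] ℂ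

/-- The pull-back `Φ^* f`. -/
def Form.pullback (Φ : X → X) (f : Form n X k) : Form n X k := fun x =>
  (f (Φ x)).compLinearMap
    (mfderiv 𝓘(ℝ, Fin n → ℂ) 𝓘(ℝ, Fin n → ℂ) Φ x).toLinearMap

/-- A form of degree `p + q` at a point is of type `(p, q)` if complex scalars act on it by
`λ ^ p * conj λ ^ q`. -/
def IsType (p q : ℕ) {x : X}
    (α : (TangentSpace 𝓘(ℝ, Fin n → ℂ) x) [⋀^Fin (p + q)]→ₗ[ℝ] ℂ) : Prop :=
  ∀ (c : ℂ) (v : Fin (p + q) → TangentSpace 𝓘(ℝ, Fin n → ℂ) x),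
    α (fun j => csmul c (v j)) = c ^ p * conj c ^ q * α v

/-- The pointwise norm of a form, for the inner product induced by the metric on the exterior
power: `|α|² = ∑ |α(b_{i₁}, …, b_{i_k})|²` over `i₁ < ⋯ < i_k`, where `b` is an orthonormal basis. -/
def pointNorm {x : X} (α : (TangentSpace 𝓘(ℝ, Fin n → ℂ) x) [⋀^Fin k]→ₗ[ℝ] ℂ) : ℝ :=
  √((Nat.factorial k : ℝ)⁻¹ *
    ∑ i : Fin k → Fin (Module.finrank ℝ (TangentSpace 𝓘(ℝ, Fin n → ℂ) x)),
      ‖α (fun j => stdOrthonormalBasis ℝ (TangentSpace 𝓘(ℝ, Fin n → ℂ) x) (i j))‖ ^ 2)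

theorem pointNorm_eq {x : X} (α : (TangentSpace 𝓘(ℝ, Fin n → ℂ) x) [⋀^Fin k]→ₗ[ℝ] ℂ) :
    pointNorm α = √((Nat.factorial k : ℝ)⁻¹) * ‖WithLp.toLp 2
      (fun i : Fin k → Fin (Module.finrank ℝ (TangentSpace 𝓘(ℝ, Fin n → ℂ) x)) =>
        α (fun j => stdOrthonormalBasis ℝ (TangentSpace 𝓘(ℝ, Fin n → ℂ) x) (i j)))‖ := by
  rw [pointNorm, EuclideanSpace.norm_eq, Real.sqrt_mul (by positivity)]

theorem pointNorm_nonneg {x : X} (α : (TangentSpace 𝓘(ℝ, Fin n → ℂ) x) [⋀^Fin k]→ₗ[ℝ] ℂ) :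
    0 ≤ pointNorm α := Real.sqrt_nonneg _

theorem pointNorm_add_le {x : X}
    (α β : (TangentSpace 𝓘(ℝ, Fin n → ℂ) x) [⋀^Fin k]→ₗ[ℝ] ℂ) :
    pointNorm (α + β) ≤ pointNorm α + pointNorm β := by
  simp only [pointNorm_eq]
  rw [← mul_add]
  refine mul_le_mul_of_nonneg_left ?_ (Real.sqrt_nonneg _)
  exact norm_add_le (WithLp.toLp 2 _) (WithLp.toLp 2 _)

theorem pointNorm_smul {x : X} (c : ℂ)
    (α : (TangentSpace 𝓘(ℝ, Fin n → ℂ) x) [⋀^Fin k]→ₗ[ℝ] ℂ) :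
    pointNorm (c • α) = ‖c‖ * pointNorm α := by
  simp only [pointNorm_eq]
  rw [mul_left_comm, ← norm_smul]
  rfl

variable [IsManifold 𝓘(ℂ, Fin n → ℂ) ω X]

/-- A form is measurable if its coefficients in every chart are (Lebesgue) measurable. -/
def IsMeasurableForm [MeasurableSpace X] (f : Form n X k) : Prop :=
  ∀ (x₀ : X) (u : Fin k → Fin n → ℂ),
    AEMeasurable (fun x => f x (fun j => coordField x₀ (u j) x))
      ((volumeMeasure n X).restrict (chartAt (Fin n → ℂ) x₀).source)

variable (n) in
/-- The measure `e^{-φ} dV`. -/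
def weightedVolume [MeasurableSpace X] (φ : X → ℝ) : Measure X :=
  (volumeMeasure n X).withDensity fun x => ENNReal.ofReal (Real.exp (-φ x))

/-- The norm `(∫_S |f|² e^{-φ} dV)^{1/2}`, possibly infinite, of a form on a subset `S` of `X`. -/
def l2Norm [MeasurableSpace X] (φ : X → ℝ) (S : Set X) (f : Form n X k) : ℝ≥0∞ :=
  eLpNorm (fun x => pointNorm (f x)) 2 ((weightedVolume n φ).restrict S)

theorem l2Norm_smul [MeasurableSpace X] (c : ℂ) (f : Form n X k) (φ : X → ℝ) (S : Set X) :
    l2Norm φ S (c • f) = ‖c‖ₑ * l2Norm φ S f := by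
  have := eLpNorm_const_smul (‖c‖) (fun x => pointNorm (f x)) 2 ((weightedVolume n φ).restrict S)
  simp only [enorm_norm] at this
  rw [l2Norm, l2Norm, ← this]
  congr 1
  funext x
  simp [pointNorm_smul]

variable [IsContMDiffRiemannianBundle 𝓘(ℝ, Fin n → ℂ) ∞ (Fin n → ℂ)
    (fun x : X => TangentSpace 𝓘(ℝ, Fin n → ℂ) x)]

theorem isContinuousRiemannianBundle : IsContinuousRiemannianBundle (Fin n → ℂ)
    (fun x : X => TangentSpace 𝓘(ℝ, Fin n → ℂ) x) := by
  obtain ⟨g, hg, h⟩ := IsContMDiffRiemannianBundle.exists_contMDiff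
    (IB := 𝓘(ℝ, Fin n → ℂ)) (n := ∞) (F := Fin n → ℂ)
    (E := fun x : X => TangentSpace 𝓘(ℝ, Fin n → ℂ) x)
  exact ⟨g, hg.continuous, h⟩

theorem continuousOn_inner_coordField (x₀ : X) (u w : Fin n → ℂ) :
    ContinuousOn (fun x => (inner ℝ (coordField x₀ u x) (coordField x₀ w x) : ℝ))
      (chartAt (Fin n → ℂ) x₀).source := by
  have key : ∀ u : Fin n → ℂ, ContinuousOn
      (fun x => (TotalSpace.mk' (Fin n → ℂ) x (coordField x₀ u x) :
        TangentBundle 𝓘(ℝ, Fin n → ℂ) X)) (chartAt (Fin n → ℂ) x₀).source := by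
    intro u
    let e := trivializationAt (Fin n → ℂ) (TangentSpace 𝓘(ℝ, Fin n → ℂ) (M := X)) x₀
    have h1 := e.continuousOn_symm
    refine (h1.comp (f := fun x : X => (x, u)) (by fun_prop)
      (fun x hx => ⟨hx, mem_univ _⟩)).congr fun x hx => ?_
    simp only [coordField, Function.comp_apply]
    exact congrArg (TotalSpace.mk x) (e.symmL_apply (R := ℝ) hx u)
  have := isContinuousRiemannianBundle (n := n) (X := X)
  exact ContinuousOn.inner_bundle (key u) (key w)

theorem aemeasurable_pointNorm [MeasurableSpace X] [BorelSpace X] [SecondCountableTopology X]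
    {f : Form n X k} (hf : IsMeasurableForm f) :
    AEMeasurable (fun x => pointNorm (f x)) (volumeMeasure n X) := by
  classical
  have hloc : ∀ x₀ : X, AEMeasurable (fun x => pointNorm (f x))
      ((volumeMeasure n X).restrict (chartAt (Fin n → ℂ) x₀).source) := by
    intro x₀
    have hS : MeasurableSet (chartAt (Fin n → ℂ) x₀).source :=
      (chartAt (Fin n → ℂ) x₀).open_source.measurableSet
    let b := Module.finBasis ℝ (Fin n → ℂ)
    let G : X → Matrix _ _ ℝ := fun x => Matrix.of fun c d =>
      inner ℝ (coordField x₀ (b c) x) (coordField x₀ (b d) x)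
    have hG : ∀ c d, AEMeasurable (fun x => (G x)⁻¹ c d)
        ((volumeMeasure n X).restrict (chartAt (Fin n → ℂ) x₀).source) := by
      intro c d
      have hdet : ContinuousOn (fun x => (G x).det) (chartAt (Fin n → ℂ) x₀).source := by
        rw [continuousOn_iff_continuous_domRestrict]
        apply Continuous.matrix_det
        refine continuous_matrix fun i j => ?_
        exact continuousOn_iff_continuous_domRestrict.1 (continuousOn_inner_coordField x₀ _ _)
      have hadj : ContinuousOn (fun x => (G x).adjugate c d)
          (chartAt (Fin n → ℂ) x₀).source := by
        rw [continuousOn_iff_continuous_domRestrict]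
        apply Continuous.matrix_elem
        apply Continuous.matrix_adjugate
        refine continuous_matrix fun i j => ?_
        exact continuousOn_iff_continuous_domRestrict.1 (continuousOn_inner_coordField x₀ _ _)
      have := (hdet.aemeasurable hS (μ := volumeMeasure n X)).inv.mul
        (hadj.aemeasurable hS (μ := volumeMeasure n X))
      refine this.congr (Filter.Eventually.of_forall fun x => ?_)
      simp [Matrix.inv_def]
    have hmeas : AEMeasurable (fun x => √((Nat.factorial k : ℝ)⁻¹ *
        ∑ P : Fin k → _, ∑ Q : Fin k → _, (∏ s, (G x)⁻¹ (P s) (Q s)) *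
          (f x (fun j => coordField x₀ (b (P j)) x) *
            conj (f x (fun j => coordField x₀ (b (Q j)) x))).re))
        ((volumeMeasure n X).restrict (chartAt (Fin n → ℂ) x₀).source) := by
      apply AEMeasurable.sqrt
      apply AEMeasurable.const_mul
      refine Finset.aemeasurable_fun_sum _ fun P _ => Finset.aemeasurable_fun_sum _ fun Q _ => ?_
      refine (Finset.aemeasurable_fun_prod _ fun s _ => hG _ _).mul ?_
      refine Complex.measurable_re.comp_aemeasurable ?_
      refine (hf x₀ _).mul ?_
      exact Complex.continuous_conj.measurable.comp_aemeasurable (hf x₀ _)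
    refine hmeas.congr ((ae_restrict_iff' hS).2 (Filter.Eventually.of_forall fun x hx => ?_))
    let e := trivializationAt (Fin n → ℂ) (TangentSpace 𝓘(ℝ, Fin n → ℂ) (M := X)) x₀
    have hx' : x ∈ e.baseSet := hx
    let B : Module.Basis _ ℝ (TangentSpace 𝓘(ℝ, Fin n → ℂ) x) :=
      b.map (e.continuousLinearEquivAt ℝ x hx').symm.toLinearEquiv
    have hB : ∀ c, B c = coordField x₀ (b c) x := fun c =>
      (e.symmL_apply (R := ℝ) hx' (b c)).symm
    have := sum_sq_orthonormalBasis_eq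
      (stdOrthonormalBasis ℝ (TangentSpace 𝓘(ℝ, Fin n → ℂ) x)) B (f x)
    simp only [hB] at this
    simp only [pointNorm, this, G]
  obtain ⟨s, hs, hcov⟩ := TopologicalSpace.countable_cover_nhds
    (fun x : X => (chartAt (Fin n → ℂ) x).open_source.mem_nhds (mem_chart_source _ x))
  have := hs.to_subtype
  rw [← Measure.restrict_univ (μ := volumeMeasure n X), ← hcov, biUnion_eq_iUnion,
    aemeasurable_iUnion_iff]
  exact fun x => hloc x

theorem aestronglyMeasurable_pointNorm [MeasurableSpace X] [BorelSpace X]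
    [SecondCountableTopology X] {f : Form n X k} (hf : IsMeasurableForm f) (φ : X → ℝ)
    (S : Set X) :
    AEStronglyMeasurable (fun x => pointNorm (f x)) ((weightedVolume n φ).restrict S) :=
  ((aemeasurable_pointNorm hf).mono_ac
    (Measure.restrict_le_self.absolutelyContinuous.trans
      (withDensity_absolutelyContinuous _ _))).aestronglyMeasurable

theorem l2Norm_add_le [MeasurableSpace X] [BorelSpace X] [SecondCountableTopology X]
    {f g : Form n X k} (hf : IsMeasurableForm f) (hg : IsMeasurableForm g) (φ : X → ℝ)
    (S : Set X) : l2Norm φ S (f + g) ≤ l2Norm φ S f + l2Norm φ S g := by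
  refine le_trans (eLpNorm_mono_real fun x => ?_) (eLpNorm_add_le
    (aestronglyMeasurable_pointNorm hf φ S) (aestronglyMeasurable_pointNorm hg φ S) (by norm_num))
  rw [Real.norm_of_nonneg (pointNorm_nonneg _)]
  exact pointNorm_add_le _ _

variable (n X) in
/-- The square-integrable measurable `(p, q)`-forms, as a space of functions. -/
def squareIntegrable [MeasurableSpace X] [BorelSpace X] [SecondCountableTopology X] (φ : X → ℝ) (p q : ℕ) :
    Submodule ℂ (Form n X (p + q)) where
  carrier := {f | IsMeasurableForm f ∧ (∀ x, IsType p q (f x)) ∧ l2Norm φ univ f < ⊤}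
  add_mem' := by
    rintro f g ⟨hf, hf', hf''⟩ ⟨hg, hg', hg''⟩
    refine ⟨fun x₀ u => (hf x₀ u).add (hg x₀ u), fun x c v => ?_,
      (l2Norm_add_le hf hg φ univ).trans_lt (ENNReal.add_lt_top.2 ⟨hf'', hg''⟩)⟩
    simp only [Pi.add_apply, AlternatingMap.add_apply, hf' x c v, hg' x c v]
    ring
  zero_mem' := by
    refine ⟨fun x₀ u => aemeasurable_const, fun x c v => by simp, ?_⟩
    simp [l2Norm, pointNorm]
  smul_mem' := by
    rintro c f ⟨hf, hf', hf''⟩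
    refine ⟨fun x₀ u => (hf x₀ u).const_smul c, fun x a v => ?_, ?_⟩
    · simp only [Pi.smul_apply, AlternatingMap.smul_apply, hf' x a v, smul_eq_mul]
      ring
    · rw [l2Norm_smul]
      exact ENNReal.mul_lt_top enorm_lt_top hf''

instance {p q : ℕ} {φ : X → ℝ} [MeasurableSpace X] [BorelSpace X] [SecondCountableTopology X] :
    SeminormedAddCommGroup (squareIntegrable n X φ p q) :=
  AddGroupSeminorm.toSeminormedAddCommGroup
    { toFun := fun f => (l2Norm φ univ f.1).toReal
      map_zero' := by simp [l2Norm, pointNorm]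
      add_le' := fun f g => by
        rw [← ENNReal.toReal_add f.2.2.2.ne g.2.2.2.ne]
        exact ENNReal.toReal_mono (ENNReal.add_lt_top.2 ⟨f.2.2.2, g.2.2.2⟩).ne
          (l2Norm_add_le f.2.1 g.2.1 φ univ)
      neg' := fun f => by
        have : l2Norm φ univ (-f.1) = l2Norm φ univ f.1 := by
          simpa using l2Norm_smul (-1) f.1 φ univ
        rw [← this]
        rfl }

variable (n X) in
/-- The space `L²_{p,q}(X, φ)`: square-integrable `(p, q)`-forms up to equality almost everywhere,
with the norm `‖f‖² = ∫ |f|² e^{-φ} dV`. -/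
abbrev L2 [MeasurableSpace X] [BorelSpace X] [SecondCountableTopology X] (φ : X → ℝ) (p q : ℕ) :
    Type _ := SeparationQuotient (squareIntegrable n X φ p q)

end Forms
end HermitianManifold

end

/-!
Everything is reduced to finitely many charts. Around each point there is a ball in a chart on
which the metric, its first derivatives, its volume density and the weight are bounded above and,
where it makes sense, below (`GoodChart`, `exists_goodChart`). In such a ball the weighted `L²` norm
of a form is comparable to the Euclidean `L²` norm of the vector of its coefficients
(`GoodChart.exists_l2Norm_bounds`): the volume measure has density `det h` with respect to Lebesgue
measure in every chart, because the real Jacobian of a holomorphic map is the squared modulus of its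
complex Jacobian. Likewise, the metric on the tangent bundle is comparable to the Euclidean one over
bounded parts of the fibres (`GoodChart.exists_velocity_bounds`); this rests on the transformation
law of the connection form (`hermDelAt_trans`), which allows the horizontal and vertical parts of a
tangent vector, defined with the preferred chart at each point, to be computed in one fixed chart.

Let the family be precompact. A single square-integrable form has little mass outside of a large
compact set, and a finite net gives (ii) for the family (`TotallyBounded.exists_l2Norm_compl_lt`).
For (i), a curve in the tangent bundle that starts over a good ball and is short cannot leave the
region where the metrics are comparable (`GoodChart.norm_tcoords_sub_lt`), so a `δ`-variation with
small `δ` is close to the identity in `C¹` in the chart (`GoodChart.exists_coordMap_close`).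
Composition with an injective map that is `C¹`-close to the identity changes a given function little
in `L²`: this is clear for continuous functions with compact support, and the Jacobian bound
(`exists_map_restrict_le`) extends it to all functions (`exists_eLpNorm_comp_sub_le`). The
derivative of the map acts on the coefficients as a small perturbation of the identity, so
`Φ^* f - f` is small for each fixed `f`, and a finite net and a finite cover of the closure of `Ω`
give (i) uniformly (`TotallyBounded.exists_l2Norm_pullback_sub_lt`).

Conversely, in a good chart a small translation, multiplied by a cut-off function and extended by
the identity, is a deformation (`GoodChart.exists_deformation`), and where the cut-off function is
`1` the pull-back translates the coefficients. Hence (i) says that the coefficients of the forms of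
the family are uniformly close in `L²` to their small translates
(`GoodChart.exists_eLpNorm_translate_sub_le`). By the argument of Kolmogorov and Riesz, they are
then uniformly approximated by their averages over small balls, and these averages are
equicontinuous, so that finitely many of their values determine a form up to a small error in `L²`
of the ball (`exists_finite_localAverages`). As those values are bounded, they range up to a small
error over a finite set. By (ii), a finite cover of one relatively compact set by good balls
suffices for the total boundedness of the family (`totallyBounded_of_deformations`).
-/


set_option linter.unusedSectionVars false

noncomputable section


/-! ### The Hermitian form -/

namespace HermitianManifold

section Algebra

variable {n : ℕ} {X : Type*} [TopologicalSpace X] [ChartedSpace (Fin n → ℂ) X]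
  [RiemannianBundle (fun x : X => TangentSpace 𝓘(ℝ, Fin n → ℂ) x)]

local notation "T" => TangentSpace 𝓘(ℝ, Fin n → ℂ) (M := X)

omit [RiemannianBundle (fun x : X => TangentSpace 𝓘(ℝ, Fin n → ℂ) x)] in
theorem csmul_eq {x : X} (c : ℂ) (v : T x) :
    csmul c v = c.re • v + c.im • csmul Complex.I v := by
  funext i
  change c * v i = c.re • v i + c.im • (Complex.I * v i)
  simp only [Complex.real_smul]
  conv_lhs => rw [← Complex.re_add_im c]
  ring

omit [RiemannianBundle (fun x : X => TangentSpace 𝓘(ℝ, Fin n → ℂ) x)] in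
theorem csmul_csmul {x : X} (c d : ℂ) (v : T x) : csmul c (csmul d v) = csmul (c * d) v := by
  funext i
  exact (mul_assoc c d (v i)).symm

omit [RiemannianBundle (fun x : X => TangentSpace 𝓘(ℝ, Fin n → ℂ) x)] in
theorem csmul_add {x : X} (c : ℂ) (v w : T x) : csmul c (v + w) = csmul c v + csmul c w := by
  funext i
  exact mul_add c (v i) (w i)

omit [RiemannianBundle (fun x : X => TangentSpace 𝓘(ℝ, Fin n → ℂ) x)] in
theorem csmul_I_I {x : X} (v : T x) : csmul Complex.I (csmul Complex.I v) = -v := by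
  rw [csmul_csmul, Complex.I_mul_I]
  funext i
  exact neg_one_mul (v i)

theorem herm_add_right {x : X} (u v w : T x) : herm u (v + w) = herm u v + herm u w := by
  simp only [herm, csmul_add, inner_add_right]
  push_cast
  ring

theorem herm_add_left {x : X} (u v w : T x) : herm (u + v) w = herm u w + herm v w := by
  simp only [herm, inner_add_left]
  push_cast
  ring

theorem herm_real_smul_right {x : X} (r : ℝ) (u v : T x) : herm u (r • v) = r * herm u v := by
  have h : csmul Complex.I (r • v) = r • csmul Complex.I v := by
    funext i
    exact mul_smul_comm r Complex.I (v i)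
  simp only [herm, h, real_inner_smul_right]
  push_cast
  ring

theorem inner_csmul_I_left (hX : IsHermitianMetric n X) {x : X} (v w : T x) :
    inner ℝ (csmul Complex.I v) w = -inner ℝ v (csmul Complex.I w) := by
  rw [← hX x v (csmul Complex.I w), csmul_I_I, inner_neg_right, neg_neg]

theorem herm_csmul_I_right {x : X} (v w : T x) :
    herm v (csmul Complex.I w) = Complex.I * herm v w := by
  simp only [herm, csmul_I_I, inner_neg_right]
  push_cast
  linear_combination (inner ℝ v (csmul Complex.I w) : ℂ) * Complex.I_mul_I

theorem herm_csmul_right {x : X} (c : ℂ) (v w : T x) :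
    herm v (csmul c w) = c * herm v w := by
  rw [csmul_eq, herm_add_right, herm_real_smul_right, herm_real_smul_right, herm_csmul_I_right]
  conv_rhs => rw [← Complex.re_add_im c]
  ring

theorem conj_herm (hX : IsHermitianMetric n X) {x : X} (v w : T x) :
    conj (herm v w) = herm w v := by
  simp only [herm, map_sub, map_mul, Complex.conj_ofReal, Complex.conj_I]
  rw [real_inner_comm w v, ← neg_eq_iff_eq_neg.2 (inner_csmul_I_left hX v w), real_inner_comm w]
  push_cast
  ring

theorem herm_self (hX : IsHermitianMetric n X) {x : X} (v : T x) :
    herm v v = ((tangentNorm x v ^ 2 : ℝ) : ℂ) := by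
  have h : (inner ℝ v (csmul Complex.I v) : ℝ) = 0 := by
    have := inner_csmul_I_left hX v v
    rw [real_inner_comm] at this
    linarith
  rw [herm, h, tangentNorm, real_inner_self_eq_norm_sq]
  simp

end Algebra

end HermitianManifold


/-! ### Coordinates of tangent vectors and of the metric -/

namespace HermitianManifold

section Charts

variable {n : ℕ} {X : Type*} [TopologicalSpace X] [ChartedSpace (Fin n → ℂ) X]

/-- The coordinate change from the chart at `y` to the chart at `x₀`. -/
def trans (y x₀ : X) : (Fin n → ℂ) → (Fin n → ℂ) :=
  chartAt (Fin n → ℂ) x₀ ∘ (chartAt (Fin n → ℂ) y).symm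

/-- The domain of the coordinate change `trans y x₀`. -/
def transSource (y x₀ : X) : Set (Fin n → ℂ) :=
  (chartAt (Fin n → ℂ) y).target ∩
    (chartAt (Fin n → ℂ) y).symm ⁻¹' (chartAt (Fin n → ℂ) x₀).source

theorem isOpen_transSource (y x₀ : X) : IsOpen (transSource (n := n) y x₀) :=
  (chartAt (Fin n → ℂ) y).isOpen_inter_preimage_symm (chartAt (Fin n → ℂ) x₀).open_source

theorem chart_mem_transSource {y x₀ p : X} (hy : p ∈ (chartAt (Fin n → ℂ) y).source)
    (hx : p ∈ (chartAt (Fin n → ℂ) x₀).source) :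
    chartAt (Fin n → ℂ) y p ∈ transSource (n := n) y x₀ :=
  ⟨(chartAt (Fin n → ℂ) y).map_source hy, by
    simpa [(chartAt (Fin n → ℂ) y).left_inv hy] using hx⟩

theorem trans_chart {y p : X} (x₀ : X) (hy : p ∈ (chartAt (Fin n → ℂ) y).source) :
    trans (n := n) y x₀ (chartAt (Fin n → ℂ) y p) = chartAt (Fin n → ℂ) x₀ p := by
  simp [trans, (chartAt (Fin n → ℂ) y).left_inv hy]

variable [IsManifold 𝓘(ℂ, Fin n → ℂ) ω X]

theorem contDiffOn_trans (y x₀ : X) :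
    ContDiffOn ℂ ω (trans (n := n) y x₀) (transSource y x₀) := by
  have h := (contDiffGroupoid ω 𝓘(ℂ, Fin n → ℂ)).compatible (M := X)
    (chart_mem_atlas (Fin n → ℂ) y) (chart_mem_atlas (Fin n → ℂ) x₀)
  rw [contDiffGroupoid, mem_groupoid_of_pregroupoid] at h
  have h1 := h.1
  simp only [contDiffPregroupoid] at h1
  have h2 : ContDiffOn ℂ ω (trans (n := n) y x₀)
    (𝓘(ℂ, Fin n → ℂ).symm ⁻¹' (((chartAt (Fin n → ℂ) y).symm ≫ₕ
      (chartAt (Fin n → ℂ) x₀)).source) ∩ Set.range 𝓘(ℂ, Fin n → ℂ)) := h1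
  refine h2.mono fun z hz => ?_
  simpa [transSource] using hz

theorem differentiableAt_trans {y x₀ : X} {z : Fin n → ℂ} (hz : z ∈ transSource y x₀) :
    DifferentiableAt ℂ (trans (n := n) y x₀) z :=
  ((contDiffOn_trans y x₀).contDiffAt ((isOpen_transSource y x₀).mem_nhds hz)).differentiableAt
    (by simp)

theorem tangentCoordChange_eq {y x₀ p : X} (hy : p ∈ (chartAt (Fin n → ℂ) y).source)
    (hx : p ∈ (chartAt (Fin n → ℂ) x₀).source) (u : Fin n → ℂ) :
    tangentCoordChange 𝓘(ℝ, Fin n → ℂ) y x₀ p u =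
      fderiv ℂ (trans (n := n) y x₀) (chartAt (Fin n → ℂ) y p) u := by
  have h := (differentiableAt_trans (n := n) (chart_mem_transSource hy hx)).hasFDerivAt
  have h2 := h.restrictScalars ℝ
  rw [tangentCoordChange_def]
  have : range 𝓘(ℝ, Fin n → ℂ) = univ := by simp
  rw [this, fderivWithin_univ]
  exact congrArg (fun L : (Fin n → ℂ) →L[ℝ] (Fin n → ℂ) => L u) h2.fderiv

theorem coordField_eq {x₀ p : X} (hp : p ∈ (chartAt (Fin n → ℂ) x₀).source) (u : Fin n → ℂ) :
    coordField x₀ u p = tangentCoordChange 𝓘(ℝ, Fin n → ℂ) x₀ p p u := by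
  have := TangentBundle.symmL_trivializationAt_eq_core (𝕜 := ℝ) (I := 𝓘(ℝ, Fin n → ℂ)) hp
  exact congrArg (fun L : (Fin n → ℂ) →L[ℝ] (Fin n → ℂ) => L u) this

theorem coordField_self (x : X) (v : TangentSpace 𝓘(ℝ, Fin n → ℂ) x) :
    coordField x v x = v :=
  (coordField_eq (mem_chart_source _ x) v).trans
    (tangentCoordChange_self (E := Fin n → ℂ) (I := 𝓘(ℝ, Fin n → ℂ)) (by simp))

theorem coordField_trans {y x₀ p : X} (hy : p ∈ (chartAt (Fin n → ℂ) y).source)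
    (hx : p ∈ (chartAt (Fin n → ℂ) x₀).source) (u : Fin n → ℂ) :
    coordField y u p =
      coordField x₀ (fderiv ℂ (trans (n := n) y x₀) (chartAt (Fin n → ℂ) y p) u) p := by
  rw [coordField_eq hy, coordField_eq hx, ← tangentCoordChange_eq hy hx]
  exact (tangentCoordChange_comp (I := 𝓘(ℝ, Fin n → ℂ)) (by simp [hy, hx])).symm

theorem coordField_add {x₀ p : X} (u v : Fin n → ℂ) :
    coordField x₀ (u + v) p = coordField x₀ u p + coordField x₀ v p :=
  map_add _ u v

theorem coordField_real_smul {x₀ p : X} (r : ℝ) (u : Fin n → ℂ) :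
    coordField x₀ (r • u) p = r • coordField x₀ u p :=
  map_smul _ r u

theorem csmul_coordField {x₀ p : X} (hp : p ∈ (chartAt (Fin n → ℂ) x₀).source) (c : ℂ)
    (u : Fin n → ℂ) : csmul c (coordField x₀ u p) = coordField x₀ (c • u) p := by
  have h (u : Fin n → ℂ) := (coordField_eq hp u).trans
    (tangentCoordChange_eq hp (mem_chart_source _ p) u)
  exact (congrArg (fun w : Fin n → ℂ => c • w) (h u)).trans
    ((map_smul _ c u).symm.trans (h (c • u)).symm)

/-- The coordinates of a tangent vector in the chart at `x₀`. -/
def coords (x₀ p : X) (v : TangentSpace 𝓘(ℝ, Fin n → ℂ) p) : Fin n → ℂ :=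
  tangentCoordChange 𝓘(ℝ, Fin n → ℂ) p x₀ p v

theorem coordField_coords {x₀ p : X} (hp : p ∈ (chartAt (Fin n → ℂ) x₀).source)
    (v : TangentSpace 𝓘(ℝ, Fin n → ℂ) p) : coordField x₀ (coords x₀ p v) p = v :=
  (coordField_eq hp _).trans ((tangentCoordChange_comp (I := 𝓘(ℝ, Fin n → ℂ)) (by simp [hp])).trans
    (tangentCoordChange_self (by simp)))

theorem coords_coordField {x₀ p : X} (hp : p ∈ (chartAt (Fin n → ℂ) x₀).source)
    (u : Fin n → ℂ) : coords x₀ p (coordField x₀ u p) = u :=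
  (congrArg (tangentCoordChange 𝓘(ℝ, Fin n → ℂ) p x₀ p) (coordField_eq hp u)).trans
    ((tangentCoordChange_comp (I := 𝓘(ℝ, Fin n → ℂ)) (by simp [hp])).trans
      (tangentCoordChange_self (by simp [hp])))

theorem coords_self (p : X) (v : TangentSpace 𝓘(ℝ, Fin n → ℂ) p) : coords p p v = v :=
  tangentCoordChange_self (by simp)

theorem coords_trans {y x₀ p : X} (hy : p ∈ (chartAt (Fin n → ℂ) y).source)
    (hx : p ∈ (chartAt (Fin n → ℂ) x₀).source) (v : TangentSpace 𝓘(ℝ, Fin n → ℂ) p) :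
    coords x₀ p v = fderiv ℂ (trans (n := n) y x₀) (chartAt (Fin n → ℂ) y p) (coords y p v) := by
  rw [← tangentCoordChange_eq hy hx]
  exact (tangentCoordChange_comp (I := 𝓘(ℝ, Fin n → ℂ)) (by simp [hy, hx])).symm

end Charts

section HermCoord

variable {n : ℕ} {X : Type*} [TopologicalSpace X] [ChartedSpace (Fin n → ℂ) X]
  [IsManifold 𝓘(ℂ, Fin n → ℂ) ω X]
  [RiemannianBundle (fun x : X => TangentSpace 𝓘(ℝ, Fin n → ℂ) x)]

theorem hermCoord_chart {x₀ p : X} (hp : p ∈ (chartAt (Fin n → ℂ) x₀).source)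
    (u w : Fin n → ℂ) : hermCoord x₀ (chartAt (Fin n → ℂ) x₀ p) u w =
      herm (coordField x₀ u p) (coordField x₀ w p) := by
  have : (extChartAt 𝓘(ℝ, Fin n → ℂ) x₀).symm (chartAt (Fin n → ℂ) x₀ p) = p := by
    simp [hp]
  rw [hermCoord, this]

theorem hermCoord_add_right (x₀ : X) (z u v w : Fin n → ℂ) :
    hermCoord x₀ z u (v + w) = hermCoord x₀ z u v + hermCoord x₀ z u w := by
  simp only [hermCoord, coordField_add, herm_add_right]

theorem hermCoord_add_left (x₀ : X) (z u v w : Fin n → ℂ) :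
    hermCoord x₀ z (u + v) w = hermCoord x₀ z u w + hermCoord x₀ z v w := by
  simp only [hermCoord, coordField_add, herm_add_left]

theorem symm_mem_source {x₀ : X} {z : Fin n → ℂ} (hz : z ∈ (chartAt (Fin n → ℂ) x₀).target) :
    (extChartAt 𝓘(ℝ, Fin n → ℂ) x₀).symm z ∈ (chartAt (Fin n → ℂ) x₀).source := by
  simpa using (chartAt (Fin n → ℂ) x₀).map_target hz

theorem hermCoord_smul_right {x₀ : X} {z : Fin n → ℂ}
    (hz : z ∈ (chartAt (Fin n → ℂ) x₀).target) (c : ℂ) (u w : Fin n → ℂ) :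
    hermCoord x₀ z u (c • w) = c * hermCoord x₀ z u w := by
  rw [hermCoord, ← csmul_coordField (symm_mem_source hz), herm_csmul_right, hermCoord]

theorem conj_hermCoord (hX : IsHermitianMetric n X) (x₀ : X) (z u w : Fin n → ℂ) :
    conj (hermCoord x₀ z u w) = hermCoord x₀ z w u := conj_herm hX _ _

theorem hermCoord_smul_left (hX : IsHermitianMetric n X) {x₀ : X} {z : Fin n → ℂ}
    (hz : z ∈ (chartAt (Fin n → ℂ) x₀).target) (c : ℂ) (u w : Fin n → ℂ) :
    hermCoord x₀ z (c • u) w = conj c * hermCoord x₀ z u w := by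
  rw [← conj_hermCoord hX, hermCoord_smul_right hz, map_mul, conj_hermCoord hX]

theorem hermCoord_self (hX : IsHermitianMetric n X) (x₀ : X) (z u : Fin n → ℂ) :
    hermCoord x₀ z u u = ((tangentNorm _
      (coordField x₀ u ((extChartAt 𝓘(ℝ, Fin n → ℂ) x₀).symm z)) ^ 2 : ℝ) : ℂ) :=
  herm_self hX _

theorem hermCoord_trans {y x₀ : X} {z : Fin n → ℂ} (hz : z ∈ transSource y x₀)
    (u w : Fin n → ℂ) :
    hermCoord y z u w = hermCoord x₀ (trans y x₀ z) (fderiv ℂ (trans y x₀) z u)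
      (fderiv ℂ (trans y x₀) z w) := by
  set p := (chartAt (Fin n → ℂ) y).symm z with hp
  have hpy : p ∈ (chartAt (Fin n → ℂ) y).source := (chartAt (Fin n → ℂ) y).map_target hz.1
  have hpx : p ∈ (chartAt (Fin n → ℂ) x₀).source := hz.2
  have hzp : z = chartAt (Fin n → ℂ) y p := ((chartAt (Fin n → ℂ) y).right_inv hz.1).symm
  rw [hzp, trans_chart x₀ hpy, hermCoord_chart hpy, hermCoord_chart hpx,
    coordField_trans hpy hpx, coordField_trans hpy hpx]

theorem hermCoord_eq_sum_left (hX : IsHermitianMetric n X) {x₀ : X} {z : Fin n → ℂ}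
    (hz : z ∈ (chartAt (Fin n → ℂ) x₀).target) (u w : Fin n → ℂ) :
    hermCoord x₀ z u w = ∑ j, conj (u j) * hermCoord x₀ z (Pi.single j 1) w := by
  let F : (Fin n → ℂ) →ₗ⋆[ℂ] ℂ :=
    { toFun := fun u => hermCoord x₀ z u w
      map_add' := fun u v => hermCoord_add_left x₀ z u v w
      map_smul' := fun c u => hermCoord_smul_left hX hz c u w }
  change F u = ∑ j, conj (u j) * F (Pi.single j 1)
  conv_lhs => rw [← Finset.univ_sum_single u]
  rw [map_sum]
  refine Finset.sum_congr rfl fun j _ => ?_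
  rw [← smul_eq_mul, ← LinearMap.map_smulₛₗ, ← Pi.single_smul, smul_eq_mul, mul_one]

theorem hermCoord_eq_sum_right {x₀ : X} {z : Fin n → ℂ}
    (hz : z ∈ (chartAt (Fin n → ℂ) x₀).target) (u w : Fin n → ℂ) :
    hermCoord x₀ z u w = ∑ k, hermCoord x₀ z u (Pi.single k 1) * w k := by
  let F : (Fin n → ℂ) →ₗ[ℂ] ℂ :=
    { toFun := fun w => hermCoord x₀ z u w
      map_add' := fun v w => hermCoord_add_right x₀ z u v w
      map_smul' := fun c w => hermCoord_smul_right hz c u w }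
  change F w = ∑ j, F (Pi.single j 1) * w j
  conv_lhs => rw [← Finset.univ_sum_single w]
  rw [map_sum]
  refine Finset.sum_congr rfl fun j _ => ?_
  rw [mul_comm, ← smul_eq_mul, ← LinearMap.map_smul, ← Pi.single_smul, smul_eq_mul, mul_one]

theorem hermCoord_eq_dotProduct (hX : IsHermitianMetric n X) {x₀ : X} {z : Fin n → ℂ}
    (hz : z ∈ (chartAt (Fin n → ℂ) x₀).target) (u w : Fin n → ℂ) :
    hermCoord x₀ z u w = dotProduct (star u) (Matrix.mulVec (hermMatrix x₀ z) w) := by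
  rw [hermCoord_eq_sum_left hX hz]
  simp only [dotProduct, Matrix.mulVec, hermMatrix, Matrix.of_apply, Pi.star_apply]
  refine Finset.sum_congr rfl fun j _ => ?_
  rw [hermCoord_eq_sum_right hz]
  rfl

theorem tangentNorm_coordField_pos {x₀ p : X} (hp : p ∈ (chartAt (Fin n → ℂ) x₀).source)
    {u : Fin n → ℂ} (hu : u ≠ 0) : 0 < tangentNorm p (coordField x₀ u p) := by
  refine lt_of_le_of_ne (norm_nonneg _) fun h => hu ?_
  have h0 : coordField x₀ u p = 0 := norm_eq_zero.1 h.symm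
  rw [← coords_coordField hp u, h0]
  exact map_zero _

open scoped ComplexOrder in
theorem hermMatrix_posDef (hX : IsHermitianMetric n X) {x₀ : X} {z : Fin n → ℂ}
    (hz : z ∈ (chartAt (Fin n → ℂ) x₀).target) : (hermMatrix x₀ z).PosDef := by
  refine Matrix.PosDef.of_dotProduct_mulVec_pos ?_ fun u hu => ?_
  · ext j k
    exact conj_hermCoord hX _ _ _ _
  · rw [← hermCoord_eq_dotProduct hX hz, hermCoord_self hX]
    have := tangentNorm_coordField_pos (symm_mem_source hz) hu
    exact_mod_cast pow_pos this 2

end HermCoord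

end HermitianManifold


/-! ### The connection form and its transformation law -/

namespace HermitianManifold

section Smooth

variable {n : ℕ} {X : Type*} [TopologicalSpace X] [ChartedSpace (Fin n → ℂ) X]
  [IsManifold 𝓘(ℂ, Fin n → ℂ) ω X]
  [RiemannianBundle (fun x : X => TangentSpace 𝓘(ℝ, Fin n → ℂ) x)]
  [IsContMDiffRiemannianBundle 𝓘(ℝ, Fin n → ℂ) ∞ (Fin n → ℂ)
    (fun x : X => TangentSpace 𝓘(ℝ, Fin n → ℂ) x)]

omit [RiemannianBundle (fun x : X => TangentSpace 𝓘(ℝ, Fin n → ℂ) x)]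
  [IsContMDiffRiemannianBundle 𝓘(ℝ, Fin n → ℂ) ∞ (Fin n → ℂ)
    (fun x : X => TangentSpace 𝓘(ℝ, Fin n → ℂ) x)] in
theorem contMDiffOn_coordField (x₀ : X) (u : Fin n → ℂ) :
    ContMDiffOn 𝓘(ℝ, Fin n → ℂ) (𝓘(ℝ, Fin n → ℂ).prod 𝓘(ℝ, Fin n → ℂ)) ∞
      (fun x => (TotalSpace.mk' (Fin n → ℂ) x (coordField x₀ u x) :
        TangentBundle 𝓘(ℝ, Fin n → ℂ) X)) (chartAt (Fin n → ℂ) x₀).source := by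
  let e := trivializationAt (Fin n → ℂ) (TangentSpace 𝓘(ℝ, Fin n → ℂ) (M := X)) x₀
  have h1 := e.contMDiffOn_symm (IB := 𝓘(ℝ, Fin n → ℂ)) (n := ∞)
  refine (h1.comp (f := fun x : X => (x, u)) (contMDiffOn_id.prodMk contMDiffOn_const)
    (fun x hx => e.mem_target.2 hx)).congr fun x hx => ?_
  simp only [coordField, Function.comp_apply]
  exact (congrArg (TotalSpace.mk x) (e.symmL_apply (R := ℝ) hx u)).trans (e.mk_symm hx u)

theorem contDiffOn_hermCoord (x₀ : X) (u w : Fin n → ℂ) :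
    ContDiffOn ℝ ∞ (fun z => hermCoord x₀ z u w) (chartAt (Fin n → ℂ) x₀).target := by
  have key (u w : Fin n → ℂ) : ContDiffOn ℝ ∞ (fun z => (inner ℝ
      (coordField x₀ u ((extChartAt 𝓘(ℝ, Fin n → ℂ) x₀).symm z))
      (coordField x₀ w ((extChartAt 𝓘(ℝ, Fin n → ℂ) x₀).symm z)) : ℝ))
      (chartAt (Fin n → ℂ) x₀).target := by
    rw [← contMDiffOn_iff_contDiffOn]
    have h1 := ContMDiffOn.inner_bundle (contMDiffOn_coordField x₀ u) (contMDiffOn_coordField x₀ w)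
    have h2 := contMDiffOn_extChartAt_symm (I := 𝓘(ℝ, Fin n → ℂ)) (n := ∞) x₀
    have h3 : (extChartAt 𝓘(ℝ, Fin n → ℂ) x₀).target = (chartAt (Fin n → ℂ) x₀).target := by simp
    rw [h3] at h2
    exact h1.comp h2 fun z hz => symm_mem_source hz
  have h : ∀ z ∈ (chartAt (Fin n → ℂ) x₀).target, hermCoord x₀ z u w =
      ((inner ℝ (coordField x₀ u ((extChartAt 𝓘(ℝ, Fin n → ℂ) x₀).symm z))
        (coordField x₀ w ((extChartAt 𝓘(ℝ, Fin n → ℂ) x₀).symm z)) : ℝ) : ℂ) -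
      ((inner ℝ (coordField x₀ u ((extChartAt 𝓘(ℝ, Fin n → ℂ) x₀).symm z))
        (coordField x₀ (Complex.I • w) ((extChartAt 𝓘(ℝ, Fin n → ℂ) x₀).symm z)) : ℝ) : ℂ) *
        Complex.I := fun z hz => by
    rw [hermCoord, herm, csmul_coordField (symm_mem_source hz)]
  refine ContDiffOn.congr ?_ h
  exact (Complex.ofRealCLM.contDiff.comp_contDiffOn (key u w)).sub
    ((Complex.ofRealCLM.contDiff.comp_contDiffOn (key u _)).mul contDiffOn_const)

theorem differentiableAt_hermCoord {x₀ : X} {z : Fin n → ℂ}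
    (hz : z ∈ (chartAt (Fin n → ℂ) x₀).target) (u w : Fin n → ℂ) :
    DifferentiableAt ℝ (fun z => hermCoord x₀ z u w) z :=
  ((contDiffOn_hermCoord x₀ u w).contDiffAt
    ((chartAt (Fin n → ℂ) x₀).open_target.mem_nhds hz)).differentiableAt (by simp)

/-- The `(1,0)`-part `∂h(u, w)(ξ)` of `dh(u, w)(ξ)` at the point with coordinates `z` in the chart
at `x₀`. -/
def hermDelAt (x₀ : X) (z ξ u w : Fin n → ℂ) : ℂ :=
  (fderiv ℝ (fun z => hermCoord x₀ z u w) z ξ -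
    Complex.I * fderiv ℝ (fun z => hermCoord x₀ z u w) z (Complex.I • ξ)) / 2

theorem fderiv_hermCoord_eq_sum (hX : IsHermitianMetric n X) {x₀ : X} {z : Fin n → ℂ}
    (hz : z ∈ (chartAt (Fin n → ℂ) x₀).target) (ξ u w : Fin n → ℂ) :
    fderiv ℝ (fun z => hermCoord x₀ z u w) z ξ = ∑ j, ∑ k, conj (u j) * w k *
      fderiv ℝ (fun z => hermCoord x₀ z (Pi.single j 1) (Pi.single k 1)) z ξ := by
  have h : (fun z => hermCoord x₀ z u w) =ᶠ[𝓝 z] fun z => ∑ j, ∑ k, (conj (u j) * w k) •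
      hermCoord x₀ z (Pi.single j 1) (Pi.single k 1) := by
    filter_upwards [(chartAt (Fin n → ℂ) x₀).open_target.mem_nhds hz] with z hz
    rw [hermCoord_eq_sum_left hX hz]
    refine Finset.sum_congr rfl fun j _ => ?_
    rw [hermCoord_eq_sum_right hz, Finset.mul_sum]
    refine Finset.sum_congr rfl fun k _ => ?_
    rw [smul_eq_mul]
    ring
  have h2 : HasFDerivAt (fun z => ∑ j, ∑ k, (conj (u j) * w k) •
      hermCoord x₀ z (Pi.single j 1) (Pi.single k 1)) (∑ j, ∑ k, (conj (u j) * w k) •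
      fderiv ℝ (fun z => hermCoord x₀ z (Pi.single j 1) (Pi.single k 1)) z) z :=
    HasFDerivAt.fun_sum fun j _ => HasFDerivAt.fun_sum fun k _ =>
      (differentiableAt_hermCoord hz _ _).hasFDerivAt.fun_const_smul _
  rw [h.fderiv_eq, h2.fderiv]
  simp

theorem hermDelAt_eq_sum (hX : IsHermitianMetric n X) {x₀ : X} {z : Fin n → ℂ}
    (hz : z ∈ (chartAt (Fin n → ℂ) x₀).target) (ξ u w : Fin n → ℂ) :
    hermDelAt x₀ z ξ u w = ∑ j, ∑ k, conj (u j) * w k *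
      hermDelAt x₀ z ξ (Pi.single j 1) (Pi.single k 1) := by
  simp only [hermDelAt]
  rw [fderiv_hermCoord_eq_sum hX hz, fderiv_hermCoord_eq_sum hX hz, Finset.mul_sum,
    ← Finset.sum_sub_distrib, Finset.sum_div]
  refine Finset.sum_congr rfl fun j _ => ?_
  rw [Finset.mul_sum, ← Finset.sum_sub_distrib, Finset.sum_div]
  refine Finset.sum_congr rfl fun k _ => ?_
  ring

open scoped ComplexOrder in
/-- The defining property of the connection form. -/
theorem herm_chernForm (hX : IsHermitianMetric n X) (x : X) (ξ u v : Fin n → ℂ) :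
    hermCoord x (chartAt (Fin n → ℂ) x x) u (chernForm x ξ v) =
      hermDelAt x (chartAt (Fin n → ℂ) x x) ξ u v := by
  have hz : chartAt (Fin n → ℂ) x x ∈ (chartAt (Fin n → ℂ) x).target := by simp
  have hdet : IsUnit (hermMatrix x (chartAt (Fin n → ℂ) x x)).det :=
    ((Matrix.isUnit_iff_isUnit_det _).1 (hermMatrix_posDef hX hz).isUnit)
  rw [hermCoord_eq_dotProduct hX hz]
  have h1 : chernForm x ξ v = Matrix.mulVec (hermMatrix x (chartAt (Fin n → ℂ) x x))⁻¹
    (fun j => hermDelAt x (chartAt (Fin n → ℂ) x x) ξ (Pi.single j 1) v) := rfl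
  rw [h1, Matrix.mulVec_mulVec, Matrix.mul_nonsing_inv _ hdet, Matrix.one_mulVec,
    hermDelAt_eq_sum hX hz ξ u v]
  simp only [dotProduct, Pi.star_apply]
  refine Finset.sum_congr rfl fun j _ => ?_
  rw [hermDelAt_eq_sum hX hz ξ (Pi.single j 1) v, Finset.sum_eq_single j]
  · rw [Finset.mul_sum]
    refine Finset.sum_congr rfl fun k _ => ?_
    simp [mul_assoc]
  · intro i _ hij
    simp [hij]
  · simp

/-- The product rule for `h(A, B)` along a curve. Since `h` is only known to be smooth on constant
vectors, both arguments are expanded in the standard basis. -/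
theorem hasDerivAt_hermCoord_comp (hX : IsHermitianMetric n X) {x₀ : X}
    {g A B : ℝ → (Fin n → ℂ)} {g' A' B' : Fin n → ℂ} {t : ℝ}
    (hz : g t ∈ (chartAt (Fin n → ℂ) x₀).target)
    (hg : HasDerivAt g g' t) (hA : HasDerivAt A A' t) (hB : HasDerivAt B B' t) :
    HasDerivAt (fun s => hermCoord x₀ (g s) (A s) (B s))
      (fderiv ℝ (fun z => hermCoord x₀ z (A t) (B t)) (g t) g' +
        hermCoord x₀ (g t) A' (B t) + hermCoord x₀ (g t) (A t) B') t := by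
  have exp {z : Fin n → ℂ} (hz : z ∈ (chartAt (Fin n → ℂ) x₀).target) (u w : Fin n → ℂ) :
      hermCoord x₀ z u w = ∑ j, ∑ k, conj (u j) * w k *
      hermCoord x₀ z (Pi.single j 1) (Pi.single k 1) := by
    rw [hermCoord_eq_sum_left hX hz]
    refine Finset.sum_congr rfl fun j _ => ?_
    rw [hermCoord_eq_sum_right hz, Finset.mul_sum]
    refine Finset.sum_congr rfl fun k _ => ?_
    ring
  have h : (fun s => hermCoord x₀ (g s) (A s) (B s)) =ᶠ[𝓝 t] fun s => ∑ j, ∑ k,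
      conj (A s j) * B s k * hermCoord x₀ (g s) (Pi.single j 1) (Pi.single k 1) := by
    filter_upwards [hg.continuousAt.preimage_mem_nhds
      ((chartAt (Fin n → ℂ) x₀).open_target.mem_nhds hz)] with s hs using exp hs _ _
  refine HasDerivAt.congr_of_eventuallyEq ?_ h
  rw [fderiv_hermCoord_eq_sum hX hz, exp hz A', exp hz _ B', ← Finset.sum_add_distrib,
    ← Finset.sum_add_distrib]
  refine HasDerivAt.fun_sum fun j _ => ?_
  rw [← Finset.sum_add_distrib, ← Finset.sum_add_distrib]
  refine HasDerivAt.fun_sum fun k _ => ?_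
  have hAj : HasDerivAt (fun s => conj (A s j)) (conj (A' j)) t := by
    have := (Complex.conjCLE : ℂ →L[ℝ] ℂ).hasFDerivAt.comp_hasDerivAt t (hasDerivAt_pi.1 hA j)
    exact this
  have hH : HasDerivAt (fun s => hermCoord x₀ (g s) (Pi.single j 1) (Pi.single k 1))
      (fderiv ℝ (fun z => hermCoord x₀ z (Pi.single j 1) (Pi.single k 1)) (g t) g') t :=
    (differentiableAt_hermCoord hz _ _).hasFDerivAt.comp_hasDerivAt t hg
  refine ((hAj.mul (hasDerivAt_pi.1 hB k)).mul hH).congr_deriv ?_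
  simp only [Pi.mul_apply]
  ring

/-- The transformation law of the Chern connection form under a holomorphic change of coordinates,
in terms of `∂h`. The term with the second derivative paired on the left drops out since `h` is
conjugate-linear in its first argument. -/
theorem hermDelAt_trans (hX : IsHermitianMetric n X) {y x₀ : X} {z : Fin n → ℂ}
    (hz : z ∈ transSource y x₀) (ξ a b : Fin n → ℂ) :
    hermDelAt y z ξ a b =
      hermDelAt x₀ (trans y x₀ z) (fderiv ℂ (trans y x₀) z ξ) (fderiv ℂ (trans y x₀) z a)
        (fderiv ℂ (trans y x₀) z b) +
      hermCoord x₀ (trans y x₀ z) (fderiv ℂ (trans y x₀) z a)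
        (fderiv ℂ (fderiv ℂ (trans y x₀)) z ξ b) := by
  set θ := trans (n := n) y x₀ with hθ
  have hzt : θ z ∈ (chartAt (Fin n → ℂ) x₀).target := (chartAt (Fin n → ℂ) x₀).map_source hz.2
  have hθ1 : DifferentiableAt ℂ θ z := differentiableAt_trans hz
  have hθ2 : DifferentiableAt ℂ (fderiv ℂ θ) z :=
    (((contDiffOn_trans y x₀).contDiffAt
      ((isOpen_transSource y x₀).mem_nhds hz)).fderiv_right (m := 1) (by simp)).differentiableAt
      (by simp)
  have key (ξ : Fin n → ℂ) : fderiv ℝ (fun z => hermCoord y z a b) z ξ =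
      fderiv ℝ (fun z' => hermCoord x₀ z' (fderiv ℂ θ z a) (fderiv ℂ θ z b)) (θ z)
        (fderiv ℂ θ z ξ) +
      hermCoord x₀ (θ z) (fderiv ℂ (fderiv ℂ θ) z ξ a) (fderiv ℂ θ z b) +
      hermCoord x₀ (θ z) (fderiv ℂ θ z a) (fderiv ℂ (fderiv ℂ θ) z ξ b) := by
    have hline : HasDerivAt (fun s : ℝ => z + s • ξ) ξ 0 := by
      simpa using ((hasDerivAt_id (0 : ℝ)).smul_const ξ).const_add z
    have h0 : z + (0 : ℝ) • ξ = z := by simp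
    have hg : HasDerivAt (fun s : ℝ => θ (z + s • ξ)) (fderiv ℂ θ z ξ) 0 :=
      ((hθ1.hasFDerivAt.restrictScalars ℝ).comp_hasDerivAt_of_eq (0 : ℝ) hline h0.symm)
    have hD (c : Fin n → ℂ) : HasDerivAt (fun s : ℝ => fderiv ℂ θ (z + s • ξ) c)
        (fderiv ℂ (fderiv ℂ θ) z ξ c) 0 := by
      have := ((hθ2.hasFDerivAt.restrictScalars ℝ).comp_hasDerivAt_of_eq (0 : ℝ) hline h0.symm)
      exact ((ContinuousLinearMap.apply ℂ (Fin n → ℂ) c).restrictScalars ℝ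
        ).hasFDerivAt.comp_hasDerivAt (0 : ℝ) this
    have h1 := hasDerivAt_hermCoord_comp hX (x₀ := x₀) (by simpa using hzt) hg (hD a) (hD b)
    have h2 : HasDerivAt (fun s : ℝ => hermCoord y (z + s • ξ) a b)
        (fderiv ℝ (fun z => hermCoord y z a b) z ξ) 0 :=
      (differentiableAt_hermCoord hz.1 a b).hasFDerivAt.comp_hasDerivAt_of_eq (0 : ℝ) hline h0.symm
    have h3 : (fun s : ℝ => hermCoord y (z + s • ξ) a b) =ᶠ[𝓝 0] fun s =>
        hermCoord x₀ (θ (z + s • ξ)) (fderiv ℂ θ (z + s • ξ) a) (fderiv ℂ θ (z + s • ξ) b) := by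
      filter_upwards [hline.continuousAt.preimage_mem_nhds
        ((isOpen_transSource y x₀).mem_nhds (by simpa using hz))] with s hs
      exact hermCoord_trans hs a b
    have h4 := h2.unique (h1.congr_of_eventuallyEq h3)
    simpa using h4
  rw [hermDelAt, hermDelAt, key, key]
  simp only [map_smul, smul_apply]
  rw [hermCoord_smul_left hX hzt, hermCoord_smul_right hzt, Complex.conj_I]
  linear_combination (-(hermCoord x₀ (θ z) (fderiv ℂ θ z a) (fderiv ℂ (fderiv ℂ θ) z ξ b) -
    hermCoord x₀ (θ z) (fderiv ℂ (fderiv ℂ θ) z ξ a) (fderiv ℂ θ z b)) / 2) * Complex.I_mul_I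

end Smooth
end HermitianManifold


/-! ### Coordinates on the tangent bundle -/

namespace HermitianManifold

section TangentCurves

variable {n : ℕ} {X : Type*} [TopologicalSpace X] [ChartedSpace (Fin n → ℂ) X]
  [IsManifold 𝓘(ℂ, Fin n → ℂ) ω X]

/-- The coordinates on the tangent bundle that are induced by the chart at `x₀`. -/
def tcoords (x₀ : X) (P : TangentBundle 𝓘(ℝ, Fin n → ℂ) X) : (Fin n → ℂ) × (Fin n → ℂ) :=
  (chartAt (Fin n → ℂ) x₀ P.proj, coords x₀ P.proj P.snd)

theorem tcoords_eq_extChartAt (Q : TangentBundle 𝓘(ℝ, Fin n → ℂ) X) :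
    tcoords Q.proj = extChartAt 𝓘(ℝ, Fin n → ℂ).tangent Q := rfl

/-- The part of the tangent bundle over the domain of the chart at `x₀`. -/
def tsource (x₀ : X) : Set (TangentBundle 𝓘(ℝ, Fin n → ℂ) X) :=
  {P | P.proj ∈ (chartAt (Fin n → ℂ) x₀).source}

theorem tsource_eq_extChartAt (Q : TangentBundle 𝓘(ℝ, Fin n → ℂ) X) :
    tsource Q.proj = (extChartAt 𝓘(ℝ, Fin n → ℂ).tangent Q).source := by
  ext P
  simp only [tsource, extChartAt_source, TangentBundle.mem_chart_source_iff, Set.mem_ofPred_eq]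

theorem isOpen_tsource (x₀ : X) : IsOpen (tsource (n := n) x₀) := by
  rw [tsource_eq_extChartAt (n := n) ⟨x₀, 0⟩]
  exact isOpen_extChartAt_source _

theorem continuousOn_tcoords (x₀ : X) : ContinuousOn (tcoords (n := n) x₀) (tsource x₀) := by
  rw [tsource_eq_extChartAt (n := n) ⟨x₀, 0⟩, tcoords_eq_extChartAt (n := n) ⟨x₀, 0⟩]
  exact continuousOn_extChartAt _

theorem contMDiffOn_tcoords (x₀ : X) : ContMDiffOn 𝓘(ℝ, Fin n → ℂ).tangent
    𝓘(ℝ, (Fin n → ℂ) × (Fin n → ℂ)) 1 (tcoords (n := n) x₀) (tsource x₀) := by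
  rw [tsource_eq_extChartAt (n := n) ⟨x₀, 0⟩, tcoords_eq_extChartAt (n := n) ⟨x₀, 0⟩]
  have := contMDiffOn_extChartAt (I := 𝓘(ℝ, Fin n → ℂ).tangent) (n := 1)
    (x := (⟨x₀, 0⟩ : TangentBundle 𝓘(ℝ, Fin n → ℂ) X))
  rwa [← extChartAt_source 𝓘(ℝ, Fin n → ℂ).tangent] at this

/-- The inverse of `tcoords`. -/
def ofTcoords (x₀ : X) (ζ : (Fin n → ℂ) × (Fin n → ℂ)) : TangentBundle 𝓘(ℝ, Fin n → ℂ) X :=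
  ⟨(chartAt (Fin n → ℂ) x₀).symm ζ.1, coordField x₀ ζ.2 ((chartAt (Fin n → ℂ) x₀).symm ζ.1)⟩

theorem tcoords_ofTcoords {x₀ : X} {ζ : (Fin n → ℂ) × (Fin n → ℂ)}
    (hζ : ζ.1 ∈ (chartAt (Fin n → ℂ) x₀).target) : tcoords x₀ (ofTcoords x₀ ζ) = ζ := by
  refine Prod.ext ((chartAt (Fin n → ℂ) x₀).right_inv hζ) ?_
  exact coords_coordField ((chartAt (Fin n → ℂ) x₀).map_target hζ) ζ.2

theorem ofTcoords_tcoords {x₀ : X} {P : TangentBundle 𝓘(ℝ, Fin n → ℂ) X}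
    (hP : P ∈ tsource x₀) : ofTcoords x₀ (tcoords x₀ P) = P := by
  have h : (chartAt (Fin n → ℂ) x₀).symm (tcoords x₀ P).1 = P.proj :=
    (chartAt (Fin n → ℂ) x₀).left_inv hP
  rw [ofTcoords, h, tcoords, coordField_coords hP]

/-- Only the differentiability class `C¹` is used, which is what lengths of curves require. -/
theorem contMDiffOn_ofTcoords (x₀ : X) : ContMDiffOn 𝓘(ℝ, (Fin n → ℂ) × (Fin n → ℂ))
    𝓘(ℝ, Fin n → ℂ).tangent 1 (ofTcoords (n := n) x₀)
      {ζ | ζ.1 ∈ (chartAt (Fin n → ℂ) x₀).target} := by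
  have h := contMDiffOn_extChartAt_symm (I := 𝓘(ℝ, Fin n → ℂ).tangent) (n := 1)
    (⟨x₀, 0⟩ : TangentBundle 𝓘(ℝ, Fin n → ℂ) X)
  have ht : (extChartAt 𝓘(ℝ, Fin n → ℂ).tangent
      (⟨x₀, 0⟩ : TangentBundle 𝓘(ℝ, Fin n → ℂ) X)).target =
      {ζ | ζ.1 ∈ (chartAt (Fin n → ℂ) x₀).target} := by
    ext ζ
    rw [extChartAt, OpenPartialHomeomorph.extend_target]
    simp only [modelWithCorners_prod_coe_symm, mfld_simps]
    rw [Prod.map_id, Set.range_id, and_iff_left (mem_univ _)]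
    exact TangentBundle.mem_chart_target_iff (I := 𝓘(ℝ, Fin n → ℂ)) ζ ⟨x₀, 0⟩
  rw [ht] at h
  refine h.congr fun ζ hζ => ?_
  have h1 : (extChartAt 𝓘(ℝ, Fin n → ℂ).tangent
      (⟨x₀, 0⟩ : TangentBundle 𝓘(ℝ, Fin n → ℂ) X)).symm ζ ∈ tsource x₀ := by
    rw [tsource_eq_extChartAt (n := n) ⟨x₀, 0⟩]
    exact (extChartAt _ _).map_target (by rw [ht]; exact hζ)
  rw [← ofTcoords_tcoords h1, tcoords_eq_extChartAt (n := n) ⟨x₀, 0⟩,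
    (extChartAt _ _).right_inv (by rw [ht]; exact hζ)]

variable [RiemannianBundle (fun x : X => TangentSpace 𝓘(ℝ, Fin n → ℂ) x)]
  [IsContMDiffRiemannianBundle 𝓘(ℝ, Fin n → ℂ) ∞ (Fin n → ℂ)
    (fun x : X => TangentSpace 𝓘(ℝ, Fin n → ℂ) x)]

/-- The norm of the velocity of a curve in the tangent bundle, in terms of its coordinates in the
chart at an arbitrary point `x₀`: the horizontal part is `ξ` and the vertical part is `η + G`, where
`G` is the value of the Chern connection form of that chart. -/
theorem exists_tangentBundleNorm_eq (hX : IsHermitianMetric n X) (x₀ : X)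
    {γ : ℝ → TangentBundle 𝓘(ℝ, Fin n → ℂ) X} {t : ℝ}
    (hγ : MDifferentiableAt 𝓘(ℝ, ℝ) 𝓘(ℝ, Fin n → ℂ).tangent γ t) (ht : γ t ∈ tsource x₀) :
    ∃ ξ η G : Fin n → ℂ, HasDerivAt (fun s => tcoords x₀ (γ s)) (ξ, η) t ∧
      (∀ u, hermCoord x₀ (tcoords x₀ (γ t)).1 u G =
        hermDelAt x₀ (tcoords x₀ (γ t)).1 ξ u (tcoords x₀ (γ t)).2) ∧
      tangentBundleNorm (γ t) (mfderiv 𝓘(ℝ, ℝ) 𝓘(ℝ, Fin n → ℂ).tangent γ t (1 : ℝ)) =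
        √(tangentNorm (γ t).proj (coordField x₀ ξ (γ t).proj) ^ 2 +
          tangentNorm (γ t).proj (coordField x₀ (η + G) (γ t).proj) ^ 2) := by
  set y := (γ t).proj with hy
  set ζ : (Fin n → ℂ) × (Fin n → ℂ) :=
    mfderiv 𝓘(ℝ, ℝ) 𝓘(ℝ, Fin n → ℂ).tangent γ t (1 : ℝ) with hζ
  have h1 : HasDerivAt (fun s => tcoords y (γ s)) ζ t := by
    let L : ℝ →L[ℝ] (Fin n → ℂ) × (Fin n → ℂ) :=
      mfderiv 𝓘(ℝ, ℝ) 𝓘(ℝ, Fin n → ℂ).tangent γ t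
    have h2 : HasFDerivWithinAt (fun s => tcoords y (γ s)) L (range 𝓘(ℝ, ℝ)) t :=
      hγ.hasMFDerivAt.2
    rw [ModelWithCorners.range_eq_univ, hasFDerivWithinAt_univ] at h2
    exact h2.hasDerivAt
  have hys : y ∈ (chartAt (Fin n → ℂ) y).source := mem_chart_source _ y
  set θ := trans (n := n) y x₀ with hθ
  set z := chartAt (Fin n → ℂ) y y with hz
  have hzs : z ∈ transSource y x₀ := chart_mem_transSource hys ht
  have hev : (fun s => tcoords x₀ (γ s)) =ᶠ[𝓝 t] fun s =>
      (θ (tcoords y (γ s)).1, fderiv ℂ θ (tcoords y (γ s)).1 (tcoords y (γ s)).2) := by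
    have hty : γ t ∈ tsource y := hys
    filter_upwards [hγ.continuousAt.preimage_mem_nhds ((isOpen_tsource y).mem_nhds hty),
      hγ.continuousAt.preimage_mem_nhds ((isOpen_tsource x₀).mem_nhds ht)] with s hs1 hs2
    refine Prod.ext (trans_chart x₀ hs1).symm ?_
    exact coords_trans hs1 hs2 _
  have hθ1 : DifferentiableAt ℂ θ z := differentiableAt_trans hzs
  have hθ2 : DifferentiableAt ℂ (fderiv ℂ θ) z :=
    (((contDiffOn_trans y x₀).contDiffAt
      ((isOpen_transSource y x₀).mem_nhds hzs)).fderiv_right (m := 1) (by simp)).differentiableAt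
      (by simp)
  have hc1 : HasDerivAt (fun s => (tcoords y (γ s)).1) ζ.1 t :=
    (ContinuousLinearMap.fst ℝ (Fin n → ℂ) (Fin n → ℂ)).hasFDerivAt.comp_hasDerivAt t h1
  have hc2 : HasDerivAt (fun s => (tcoords y (γ s)).2) ζ.2 t :=
    (ContinuousLinearMap.snd ℝ (Fin n → ℂ) (Fin n → ℂ)).hasFDerivAt.comp_hasDerivAt t h1
  set v : Fin n → ℂ := (γ t).snd with hv
  have hv2 : (tcoords y (γ t)).2 = v := coords_self y (γ t).snd
  have hd1 : HasDerivAt (fun s => θ (tcoords y (γ s)).1) (fderiv ℂ θ z ζ.1) t :=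
    (hθ1.hasFDerivAt.restrictScalars ℝ).comp_hasDerivAt_of_eq t hc1 rfl
  have hd2 : HasDerivAt (fun s => fderiv ℂ θ (tcoords y (γ s)).1 (tcoords y (γ s)).2)
      (fderiv ℂ (fderiv ℂ θ) z ζ.1 v + fderiv ℂ θ z ζ.2) t := by
    have hL : HasDerivAt (fun s =>
        ContinuousLinearMap.restrictScalarsL ℂ (Fin n → ℂ) (Fin n → ℂ) ℝ ℝ
        (fderiv ℂ θ (tcoords y (γ s)).1)) ((fderiv ℂ (fderiv ℂ θ) z ζ.1).restrictScalars ℝ) t :=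
      (ContinuousLinearMap.restrictScalarsL ℂ (Fin n → ℂ) (Fin n → ℂ) ℝ
        ℝ).hasFDerivAt.comp_hasDerivAt t
        ((hθ2.hasFDerivAt.restrictScalars ℝ).comp_hasDerivAt_of_eq t hc1 rfl)
    have := hL.clm_apply hc2
    rw [hv2] at this
    exact this
  set Γ : Fin n → ℂ := chernForm y ζ.1 v with hΓ
  refine ⟨fderiv ℂ θ z ζ.1, fderiv ℂ (fderiv ℂ θ) z ζ.1 v + fderiv ℂ θ z ζ.2,
    fderiv ℂ θ z Γ - fderiv ℂ (fderiv ℂ θ) z ζ.1 v, (hd1.prodMk hd2).congr_of_eventuallyEq hev,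
    fun u => ?_, ?_⟩
  · have e1 : (tcoords x₀ (γ t)).1 = θ z := (trans_chart x₀ hys).symm
    have e2 : (tcoords x₀ (γ t)).2 = fderiv ℂ θ z v := by
      have := coords_trans hys ht (γ t).snd
      rw [coords_self] at this
      exact this
    have e3 : u = fderiv ℂ θ z (coords y y (coordField x₀ u y)) := by
      rw [← coords_trans hys ht, coords_coordField ht]
    set a : Fin n → ℂ := coords y y (coordField x₀ u y)
    rw [e1, e2, e3, ← sub_eq_zero]
    have hT := hermDelAt_trans hX hzs ζ.1 a v
    rw [← herm_chernForm hX, ← hz, ← hΓ, hermCoord_trans hzs] at hT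
    have hzt : θ z ∈ (chartAt (Fin n → ℂ) x₀).target := (chartAt (Fin n → ℂ) x₀).map_source hzs.2
    rw [sub_eq_add_neg (fderiv ℂ θ z Γ), ← neg_one_smul ℂ (fderiv ℂ (fderiv ℂ θ) z ζ.1 v),
      hermCoord_add_right, hermCoord_smul_right hzt]
    linear_combination hT
  · have e4 (w : Fin n → ℂ) : coordField x₀ (fderiv ℂ θ z w) y = w :=
      (coordField_trans hys ht w).symm.trans (coordField_self y w)
    have e5 : fderiv ℂ (fderiv ℂ θ) z ζ.1 v + fderiv ℂ θ z ζ.2 +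
        (fderiv ℂ θ z Γ - fderiv ℂ (fderiv ℂ θ) z ζ.1 v) = fderiv ℂ θ z (ζ.2 + Γ) := by
      rw [map_add]; abel
    rw [e5, e4, e4]
    rfl

end TangentCurves
end HermitianManifold


/-! ### Good charts -/

namespace HermitianManifold

section GoodCharts

variable {n : ℕ} {X : Type*} [TopologicalSpace X] [ChartedSpace (Fin n → ℂ) X]
  [IsManifold 𝓘(ℂ, Fin n → ℂ) ω X]
  [RiemannianBundle (fun x : X => TangentSpace 𝓘(ℝ, Fin n → ℂ) x)]

/-- On the closed ball of radius `3 * R` in the chart at `x₀`, the metric, its first derivatives,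
its volume density and the weight are controlled by the constant `C`. Forms are estimated on the
ball of radius `R`; maps that are close to the identity send it into the ball of radius `2 * R`, and
diffeomorphisms that are translations there are cut off inside the ball of radius `3 * R`. -/
structure GoodChart (φ : X → ℝ) (x₀ : X) (R C : ℝ) : Prop where
  pos : 0 < R
  one_le : 1 ≤ C
  subset : Metric.closedBall (chartAt (Fin n → ℂ) x₀ x₀) (3 * R) ⊆ (chartAt (Fin n → ℂ) x₀).target
  norm_le : ∀ z ∈ Metric.closedBall (chartAt (Fin n → ℂ) x₀ x₀) (3 * R), ∀ u : Fin n → ℂ,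
    tangentNorm _ (coordField x₀ u ((chartAt (Fin n → ℂ) x₀).symm z)) ≤ C * ‖u‖
  le_norm : ∀ z ∈ Metric.closedBall (chartAt (Fin n → ℂ) x₀ x₀) (3 * R), ∀ u : Fin n → ℂ,
    ‖u‖ ≤ C * tangentNorm _ (coordField x₀ u ((chartAt (Fin n → ℂ) x₀).symm z))
  del_le : ∀ z ∈ Metric.closedBall (chartAt (Fin n → ℂ) x₀ x₀) (3 * R), ∀ ξ u w : Fin n → ℂ,
    ‖hermDelAt x₀ z ξ u w‖ ≤ C * ‖ξ‖ * ‖u‖ * ‖w‖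
  det_mem : ∀ z ∈ Metric.closedBall (chartAt (Fin n → ℂ) x₀ x₀) (3 * R),
    (hermMatrix x₀ z).det.re ∈ Icc C⁻¹ C
  weight_mem : ∀ z ∈ Metric.closedBall (chartAt (Fin n → ℂ) x₀ x₀) (3 * R),
    Real.exp (-φ ((chartAt (Fin n → ℂ) x₀).symm z)) ∈ Icc C⁻¹ C

theorem _root_.ContinuousAt.exists_eventually_mem_Icc {Y : Type*} [TopologicalSpace Y] {f : Y → ℝ}
    {y : Y} (hf : ContinuousAt f y) (h0 : 0 < f y) :
    ∃ C : ℝ, 1 ≤ C ∧ ∀ᶠ z in 𝓝 y, f z ∈ Icc C⁻¹ C := by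
  refine ⟨max 1 (max (f y + 1) (f y / 2)⁻¹), le_max_left _ _, ?_⟩
  filter_upwards [hf.eventually (lt_mem_nhds (half_lt_self h0)),
    hf.eventually (gt_mem_nhds (lt_add_one (f y)))] with z h1 h2
  refine ⟨?_, h2.le.trans ((le_max_left _ _).trans (le_max_right _ _))⟩
  refine le_trans ?_ h1.le
  rw [inv_le_comm₀ (lt_of_lt_of_le one_pos (le_max_left _ _)) (half_pos h0)]
  exact (le_max_right _ _).trans (le_max_right _ _)

variable [IsContMDiffRiemannianBundle 𝓘(ℝ, Fin n → ℂ) ∞ (Fin n → ℂ)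
    (fun x : X => TangentSpace 𝓘(ℝ, Fin n → ℂ) x)]

theorem exists_tangentNorm_coordField_le (x₀ : X) : ∃ C : ℝ, 0 < C ∧ ∀ᶠ p in 𝓝 x₀,
    ∀ u : Fin n → ℂ, tangentNorm p (coordField x₀ u p) ≤ C * ‖u‖ := by
  have := isContinuousRiemannianBundle (n := n) (X := X)
  obtain ⟨C, hC, h⟩ := eventually_norm_symmL_trivializationAt_lt (Fin n → ℂ)
    (fun x : X => TangentSpace 𝓘(ℝ, Fin n → ℂ) x) x₀
  refine ⟨C, hC, ?_⟩
  filter_upwards [h] with p hp u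
  exact (ContinuousLinearMap.le_opNorm _ u).trans (by gcongr)

theorem exists_le_tangentNorm_coordField (x₀ : X) : ∃ C : ℝ, 0 < C ∧ ∀ᶠ p in 𝓝 x₀,
    ∀ u : Fin n → ℂ, ‖u‖ ≤ C * tangentNorm p (coordField x₀ u p) := by
  have := isContinuousRiemannianBundle (n := n) (X := X)
  obtain ⟨C, hC, h⟩ := eventually_norm_trivializationAt_lt (Fin n → ℂ)
    (fun x : X => TangentSpace 𝓘(ℝ, Fin n → ℂ) x) x₀
  refine ⟨C, hC, ?_⟩
  filter_upwards [h, (chartAt (Fin n → ℂ) x₀).open_source.mem_nhds (mem_chart_source _ x₀)]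
    with p hp hps u
  have h1 := ContinuousLinearMap.le_opNorm
    ((trivializationAt (Fin n → ℂ) (TangentSpace 𝓘(ℝ, Fin n → ℂ)) x₀).continuousLinearMapAt ℝ p)
    (coordField x₀ u p)
  have h2 : (trivializationAt (Fin n → ℂ) (TangentSpace 𝓘(ℝ, Fin n → ℂ)) x₀).continuousLinearMapAt
      ℝ p (coordField x₀ u p) = u :=
    Bundle.Trivialization.continuousLinearMapAt_symmL _ hps u
  rw [h2] at h1
  refine h1.trans ?_
  simp only [tangentNorm]
  gcongr

/-- The first derivatives of the metric are locally bounded, uniformly in the vectors on which the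
metric is evaluated. -/
theorem exists_norm_hermDelAt_le (hX : IsHermitianMetric n X) (x₀ : X) :
    ∃ C : ℝ, 0 < C ∧ ∀ᶠ z in 𝓝 (chartAt (Fin n → ℂ) x₀ x₀),
    ∀ ξ u w : Fin n → ℂ, ‖hermDelAt x₀ z ξ u w‖ ≤ C * ‖ξ‖ * ‖u‖ * ‖w‖ := by
  set z₀ := chartAt (Fin n → ℂ) x₀ x₀
  have hz₀ : z₀ ∈ (chartAt (Fin n → ℂ) x₀).target := mem_chart_target _ x₀
  let D : Fin n → Fin n → (Fin n → ℂ) → ((Fin n → ℂ) →L[ℝ] ℂ) := fun j k z =>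
    fderiv ℝ (fun z => hermCoord x₀ z (Pi.single j 1) (Pi.single k 1)) z
  have hD (j k) : ContinuousAt (D j k) z₀ :=
    (((contDiffOn_hermCoord x₀ (Pi.single j 1) (Pi.single k 1)).contDiffAt
      ((chartAt (Fin n → ℂ) x₀).open_target.mem_nhds hz₀)).fderiv_right (m := 0)
        (by simp)).continuousAt
  have hS : ContinuousAt (fun z => ∑ j, ∑ k, ‖D j k z‖) z₀ :=
    tendsto_finsetSum _ fun j _ => tendsto_finsetSum _ fun k _ => (hD j k).norm
  have hpos : 0 ≤ ∑ j, ∑ k, ‖D j k z₀‖ := by positivity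
  refine ⟨∑ j, ∑ k, ‖D j k z₀‖ + 1, by positivity, ?_⟩
  filter_upwards [hS.eventually (gt_mem_nhds (lt_add_one _)),
    (chartAt (Fin n → ℂ) x₀).open_target.mem_nhds hz₀] with z hz hzt ξ u w
  rw [hermDelAt_eq_sum hX hzt]
  have h1 (j k) : ‖hermDelAt x₀ z ξ (Pi.single j 1) (Pi.single k 1)‖ ≤ ‖D j k z‖ * ‖ξ‖ := by
    have ha : ‖D j k z ξ‖ ≤ ‖D j k z‖ * ‖ξ‖ := ContinuousLinearMap.le_opNorm _ _
    have hb : ‖D j k z (Complex.I • ξ)‖ ≤ ‖D j k z‖ * ‖ξ‖ := by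
      have := ContinuousLinearMap.le_opNorm (D j k z) (Complex.I • ξ)
      rwa [norm_smul, Complex.norm_I, one_mul] at this
    change ‖(D j k z ξ - Complex.I * D j k z (Complex.I • ξ)) / 2‖ ≤ _
    rw [norm_div, Complex.norm_ofNat]
    have := norm_sub_le (D j k z ξ) (Complex.I * D j k z (Complex.I • ξ))
    rw [norm_mul, Complex.norm_I, one_mul] at this
    linarith
  calc ‖∑ j, ∑ k, conj (u j) * w k * hermDelAt x₀ z ξ (Pi.single j 1) (Pi.single k 1)‖
      ≤ ∑ j, ∑ k, ‖D j k z‖ * (‖ξ‖ * ‖u‖ * ‖w‖) := by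
        refine (norm_sum_le _ _).trans (Finset.sum_le_sum fun j _ => ?_)
        refine (norm_sum_le _ _).trans (Finset.sum_le_sum fun k _ => ?_)
        rw [norm_mul, norm_mul, RCLike.norm_conj]
        calc ‖u j‖ * ‖w k‖ * _ ≤ ‖u‖ * ‖w‖ * (‖D j k z‖ * ‖ξ‖) := by
              gcongr
              · exact norm_le_pi_norm u j
              · exact norm_le_pi_norm w k
              · exact h1 j k
          _ = _ := by ring
    _ = (∑ j, ∑ k, ‖D j k z‖) * (‖ξ‖ * ‖u‖ * ‖w‖) := by simp only [Finset.sum_mul]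
    _ ≤ (∑ j, ∑ k, ‖D j k z₀‖ + 1) * (‖ξ‖ * ‖u‖ * ‖w‖) := by gcongr
    _ = _ := by ring

open scoped ComplexOrder in
/-- All the quantities in the definition are continuous at `x₀`, and the determinant of the metric
and the weight are positive there. -/
theorem exists_goodChart (hX : IsHermitianMetric n X) {φ : X → ℝ} (hφ : Continuous φ) (x₀ : X) :
    ∃ R C : ℝ, GoodChart (n := n) φ x₀ R C := by
  set z₀ := chartAt (Fin n → ℂ) x₀ x₀ with hz₀
  have hz₀t : z₀ ∈ (chartAt (Fin n → ℂ) x₀).target := mem_chart_target _ x₀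
  have hs : (chartAt (Fin n → ℂ) x₀).symm z₀ = x₀ := (chartAt (Fin n → ℂ) x₀).left_inv (by simp)
  have hcont : Filter.Tendsto (chartAt (Fin n → ℂ) x₀).symm (𝓝 z₀) (𝓝 x₀) := by
    have := (chartAt (Fin n → ℂ) x₀).symm.continuousAt (x := z₀) hz₀t
    rwa [ContinuousAt, hs] at this
  obtain ⟨C₁, hC₁, h₁⟩ := exists_tangentNorm_coordField_le (n := n) x₀
  obtain ⟨C₂, hC₂, h₂⟩ := exists_le_tangentNorm_coordField (n := n) x₀
  obtain ⟨C₃, hC₃, h₃⟩ := exists_norm_hermDelAt_le hX x₀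
  have hdet : ContinuousAt (fun z => (hermMatrix x₀ z).det.re) z₀ := by
    have hM : ContinuousAt (fun z => hermMatrix x₀ z) z₀ :=
      tendsto_pi_nhds.2 fun j => tendsto_pi_nhds.2 fun k =>
        (differentiableAt_hermCoord hz₀t _ _).continuousAt
    exact (Complex.continuous_re.comp (continuous_id.matrix_det)).continuousAt.comp hM
  have hdet0 : 0 < (hermMatrix x₀ z₀).det.re :=
    (Complex.pos_iff.1 (hermMatrix_posDef hX hz₀t).det_pos).1
  obtain ⟨C₄, hC₄, h₄⟩ := hdet.exists_eventually_mem_Icc hdet0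
  obtain ⟨C₅, hC₅, h₅⟩ := (Real.continuous_exp.comp hφ.neg).continuousAt (x := x₀)
    |>.exists_eventually_mem_Icc (Real.exp_pos _)
  obtain ⟨r, hr, hball⟩ := Metric.mem_nhds_iff.1
    (((chartAt (Fin n → ℂ) x₀).open_target.eventually_mem hz₀t).and ((hcont.eventually h₁).and
      ((hcont.eventually h₂).and (h₃.and (h₄.and (hcont.eventually h₅))))))
  have hsub : Metric.closedBall z₀ (3 * (r / 6)) ⊆ Metric.ball z₀ r :=
    Metric.closedBall_subset_ball (by linarith)
  set C := C₁ + C₂ + C₃ + C₄ + C₅ with hC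
  have hCi {c : ℝ} (h1 : 1 ≤ c) (h2 : c ≤ C) {y : ℝ} (hy : y ∈ Icc c⁻¹ c) : y ∈ Icc C⁻¹ C :=
    ⟨le_trans (inv_anti₀ (by linarith) h2) hy.1, hy.2.trans h2⟩
  -- with `R = r / 6`, the closed ball of radius `3 * R` lies in the open ball of radius `r`
  refine ⟨r / 6, C, ⟨by linarith, by linarith, fun z hz => (hball (hsub hz)).1,
    fun z hz u => ((hball (hsub hz)).2.1 u).trans ?_,
    fun z hz u => ((hball (hsub hz)).2.2.1 u).trans ?_,
    fun z hz ξ u w => ((hball (hsub hz)).2.2.2.1 ξ u w).trans ?_,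
    fun z hz => hCi hC₄ (by linarith) (hball (hsub hz)).2.2.2.2.1,
    fun z hz => hCi hC₅ (by linarith) (hball (hsub hz)).2.2.2.2.2⟩⟩
  · gcongr; linarith
  · refine mul_le_mul_of_nonneg_right (by linarith) (norm_nonneg _)
  · gcongr; linarith

end GoodCharts
end HermitianManifold


/-! ### Velocities and distances in the tangent bundle -/

namespace HermitianManifold

section TangentBundleMetric

variable {n : ℕ} {X : Type*} [TopologicalSpace X] [ChartedSpace (Fin n → ℂ) X]
  [IsManifold 𝓘(ℂ, Fin n → ℂ) ω X]
  [RiemannianBundle (fun x : X => TangentSpace 𝓘(ℝ, Fin n → ℂ) x)]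

/-- The extended norm on the tangent spaces of the tangent bundle that defines `riemDistTangent`. -/
@[reducible] def tangentBundleENorm (P : TangentBundle 𝓘(ℝ, Fin n → ℂ) X) :
    ENorm (TangentSpace 𝓘(ℝ, Fin n → ℂ).tangent P) :=
  ⟨fun ζ => ENNReal.ofReal (tangentBundleNorm P ζ)⟩

attribute [local instance] tangentBundleENorm

theorem chernForm_real_smul (x : X) (r : ℝ) (ξ v : Fin n → ℂ) :
    chernForm x (r • ξ) v = r • chernForm x ξ v := by
  have h (u w : Fin n → ℂ) : hermDel x (r • ξ) u w = r • hermDel x ξ u w := by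
    simp only [hermDel, hermDeriv]
    rw [smul_comm Complex.I r ξ, map_smul, map_smul]
    simp only [Complex.real_smul]
    ring
  simp only [chernForm, h]
  exact Matrix.mulVec_smul _ r _

theorem tangentBundleNorm_smul (P : TangentBundle 𝓘(ℝ, Fin n → ℂ) X) (r : ℝ)
    (ζ : TangentSpace 𝓘(ℝ, Fin n → ℂ).tangent P) :
    tangentBundleNorm P (r • ζ) = |r| * tangentBundleNorm P ζ := by
  have hN (v : TangentSpace 𝓘(ℝ, Fin n → ℂ) P.proj) :
      tangentNorm P.proj (r • v) = |r| * tangentNorm P.proj v := by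
    simp only [tangentNorm, norm_smul, Real.norm_eq_abs]
  let ζ' : (Fin n → ℂ) × (Fin n → ℂ) := ζ
  let v : Fin n → ℂ := P.snd
  have h2 : r • ζ'.2 + chernForm P.proj (r • ζ'.1) v =
      r • (ζ'.2 + chernForm P.proj ζ'.1 v) := by
    rw [chernForm_real_smul, smul_add]
  have h3 (a b : ℝ) : √((|r| * a) ^ 2 + (|r| * b) ^ 2) = |r| * √(a ^ 2 + b ^ 2) := by
    rw [mul_pow, mul_pow, ← mul_add, Real.sqrt_mul (by positivity), Real.sqrt_sq (abs_nonneg r)]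
  exact (congrArg Real.sqrt (congrArg₂ (fun a b : ℝ => a ^ 2 + b ^ 2) (hN ζ'.1)
    ((congrArg (tangentNorm P.proj) h2).trans (hN _)))).trans (h3 _ _)

instance tangentBundleENormSMulClass (P : TangentBundle 𝓘(ℝ, Fin n → ℂ) X) :
    ENormSMulClass ℝ (TangentSpace 𝓘(ℝ, Fin n → ℂ).tangent P) where
  enorm_smul r ζ := by
    change ENNReal.ofReal (tangentBundleNorm P (r • ζ)) =
      ‖r‖ₑ * ENNReal.ofReal (tangentBundleNorm P ζ)
    rw [tangentBundleNorm_smul, ENNReal.ofReal_mul (abs_nonneg r), Real.enorm_eq_ofReal_abs]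

variable [IsContMDiffRiemannianBundle 𝓘(ℝ, Fin n → ℂ) ∞ (Fin n → ℂ)
    (fun x : X => TangentSpace 𝓘(ℝ, Fin n → ℂ) x)]

namespace GoodChart

variable {φ : X → ℝ} {x₀ : X} {R C : ℝ}

/-- In a good chart, the norm of the velocity of a curve in the tangent bundle is comparable to
the norm of its coordinate expression, over bounded parts of the fibres. -/
theorem exists_velocity_bounds (hX : IsHermitianMetric n X) (h : GoodChart (n := n) φ x₀ R C)
    {M : ℝ} (hM : 0 ≤ M)
    {γ : ℝ → TangentBundle 𝓘(ℝ, Fin n → ℂ) X} {t : ℝ}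
    (hγ : MDifferentiableAt 𝓘(ℝ, ℝ) 𝓘(ℝ, Fin n → ℂ).tangent γ t) (ht : γ t ∈ tsource x₀)
    (hz : (tcoords x₀ (γ t)).1 ∈ Metric.closedBall (chartAt (Fin n → ℂ) x₀ x₀) (3 * R))
    (hv : ‖(tcoords x₀ (γ t)).2‖ ≤ M) :
    ∃ d, HasDerivAt (fun s => tcoords x₀ (γ s)) d t ∧
      ‖d‖ ≤ (C + C ^ 4 * M) *
        tangentBundleNorm (γ t) (mfderiv 𝓘(ℝ, ℝ) 𝓘(ℝ, Fin n → ℂ).tangent γ t (1 : ℝ)) ∧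
      tangentBundleNorm (γ t) (mfderiv 𝓘(ℝ, ℝ) 𝓘(ℝ, Fin n → ℂ).tangent γ t (1 : ℝ)) ≤
        (2 * C + C ^ 2 * M) * ‖d‖ := by
  obtain ⟨ξ, η, G, hd, hG, hN⟩ := exists_tangentBundleNorm_eq hX x₀ hγ ht
  have hC0 : 0 < C := lt_of_lt_of_le one_pos h.one_le
  set z := (tcoords x₀ (γ t)).1 with hzdef
  set v := (tcoords x₀ (γ t)).2
  have hp : (chartAt (Fin n → ℂ) x₀).symm z = (γ t).proj := (chartAt (Fin n → ℂ) x₀).left_inv ht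
  have hle := h.norm_le z hz
  have hge := h.le_norm z hz
  rw [hp] at hle hge
  set N : (Fin n → ℂ) → ℝ := fun u => tangentNorm (γ t).proj (coordField x₀ u (γ t).proj) with hNdef
  have hN0 (u) : 0 ≤ N u := norm_nonneg _
  have hNadd (u w) : N (u + w) ≤ N u + N w := by
    simp only [hNdef, coordField_add, tangentNorm]
    exact norm_add_le _ _
  -- pairing `G` with itself turns the bound on the derivatives of the metric into a bound on `G`
  have hNG : N G ≤ C ^ 2 * M * ‖ξ‖ := by
    have h1 := hG G
    have h2 : hermCoord x₀ z G G = ((N G ^ 2 : ℝ) : ℂ) := by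
      rw [hzdef, show (tcoords x₀ (γ t)).1 = chartAt (Fin n → ℂ) x₀ (γ t).proj from rfl,
        hermCoord_chart ht, herm_self hX]
    have h3 := h.del_le z hz ξ G v
    rw [← h1, h2, Complex.norm_real, Real.norm_of_nonneg (by positivity)] at h3
    have h4 : N G ^ 2 ≤ (C ^ 2 * M * ‖ξ‖) * N G := by
      calc N G ^ 2 ≤ C * ‖ξ‖ * ‖G‖ * ‖v‖ := h3
        _ ≤ C * ‖ξ‖ * (C * N G) * M := by
          have := hge G
          have := hN0 G
          gcongr
        _ = _ := by ring
    rcases (hN0 G).eq_or_lt with h5 | h5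
    · rw [← h5]; positivity
    · rw [pow_two] at h4
      exact le_of_mul_le_mul_right h4 h5
  rw [hN]
  set τ := √(N ξ ^ 2 + N (η + G) ^ 2) with hτ
  have hτ0 : 0 ≤ τ := Real.sqrt_nonneg _
  have h1 : N ξ ≤ τ := Real.le_sqrt_of_sq_le (by nlinarith [sq_nonneg (N (η + G))])
  have h2 : N (η + G) ≤ τ := Real.le_sqrt_of_sq_le (by nlinarith [sq_nonneg (N ξ)])
  have hτle : τ ≤ N ξ + N (η + G) := by
    rw [hτ, Real.sqrt_le_left (add_nonneg (hN0 _) (hN0 _))]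
    nlinarith [hN0 ξ, hN0 (η + G), mul_nonneg (hN0 ξ) (hN0 (η + G))]
  refine ⟨(ξ, η), hd, ?_, ?_⟩
  · have h3 : ‖ξ‖ ≤ C * τ := (hge ξ).trans (by gcongr)
    have h4 : ‖η‖ ≤ (C + C ^ 4 * M) * τ := by
      calc ‖η‖ = ‖(η + G) - G‖ := by rw [add_sub_cancel_right]
        _ ≤ ‖η + G‖ + ‖G‖ := norm_sub_le _ _
        _ ≤ C * τ + C * (C ^ 2 * M * (C * τ)) := by
          gcongr
          · exact (hge _).trans (by gcongr)
          · exact (hge _).trans (by gcongr; exact hNG.trans (by gcongr))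
        _ = _ := by ring
    rw [Prod.norm_def]
    refine max_le (h3.trans ?_) h4
    gcongr
    have : 0 ≤ C ^ 4 * M := by positivity
    linarith
  · have h3 : ‖ξ‖ ≤ ‖(ξ, η)‖ := norm_fst_le (ξ, η)
    have h4 : ‖η‖ ≤ ‖(ξ, η)‖ := norm_snd_le (ξ, η)
    calc τ ≤ N ξ + (N η + N G) := hτle.trans (by gcongr; exact hNadd _ _)
      _ ≤ C * ‖(ξ, η)‖ + (C * ‖(ξ, η)‖ + C ^ 2 * M * ‖(ξ, η)‖) := by
        gcongr
        · exact (hle ξ).trans (by gcongr)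
        · exact (hle η).trans (by gcongr)
        · exact hNG.trans (by gcongr)
      _ = _ := by ring

/-- The projection of this set lies in a compact subset of the domain of the chart, which is closed
in `X` since `X` is Hausdorff; without this, curves could escape through the boundary of the chart.
-/
theorem isClosed_bounded_part [T2Space X] (h : GoodChart (n := n) φ x₀ R C) (M : ℝ) :
    IsClosed {P : TangentBundle 𝓘(ℝ, Fin n → ℂ) X | P ∈ tsource x₀ ∧
      (tcoords x₀ P).1 ∈ Metric.closedBall (chartAt (Fin n → ℂ) x₀ x₀) (3 * R) ∧
      ‖(tcoords x₀ P).2‖ ≤ M} := by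
  set B := Metric.closedBall (chartAt (Fin n → ℂ) x₀ x₀) (3 * R)
  have hK : IsCompact ((chartAt (Fin n → ℂ) x₀).symm '' B) :=
    (isCompact_closedBall _ _).image_of_continuousOn
      ((chartAt (Fin n → ℂ) x₀).continuousOn_symm.mono h.subset)
  have hA : IsClosed ((TotalSpace.proj : TangentBundle 𝓘(ℝ, Fin n → ℂ) X → X) ⁻¹'
      ((chartAt (Fin n → ℂ) x₀).symm '' B)) :=
    hK.isClosed.preimage (FiberBundle.continuous_proj (Fin n → ℂ) _)
  have hAs : (TotalSpace.proj : TangentBundle 𝓘(ℝ, Fin n → ℂ) X → X) ⁻¹'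
      ((chartAt (Fin n → ℂ) x₀).symm '' B) ⊆ tsource x₀ := by
    rintro P ⟨z, hz, hzP⟩
    change P.proj ∈ (chartAt (Fin n → ℂ) x₀).source
    rw [← hzP]
    exact (chartAt (Fin n → ℂ) x₀).map_target (h.subset hz)
  have := ((continuousOn_tcoords x₀).mono hAs).preimage_isClosed_of_isClosed hA
    (t := {ζ : (Fin n → ℂ) × (Fin n → ℂ) | ζ.1 ∈ B ∧ ‖ζ.2‖ ≤ M})
    ((Metric.isClosed_closedBall.preimage continuous_fst).inter
      (isClosed_le (continuous_snd.norm) continuous_const))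
  convert this using 1
  ext P
  constructor
  · rintro ⟨h1, h2, h3⟩
    exact ⟨⟨_, h2, (chartAt (Fin n → ℂ) x₀).left_inv h1⟩, h2, h3⟩
  · rintro ⟨h1, h2, h3⟩
    exact ⟨hAs h1, h2, h3⟩

/-- Points of the tangent bundle at a small distance have close coordinates: a short curve cannot
leave the part of the tangent bundle where the metric is comparable to the Euclidean one. -/
theorem norm_tcoords_sub_lt [T2Space X] (hX : IsHermitianMetric n X)
    (h : GoodChart (n := n) φ x₀ R C)
    {M r : ℝ} (hr : 0 < r) (hr1 : r ≤ 1) (hrR : r ≤ R) (hM : 0 ≤ M)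
    {P Q : TangentBundle 𝓘(ℝ, Fin n → ℂ) X} (hQ : Q ∈ tsource x₀)
    (hQz : (tcoords x₀ Q).1 ∈ Metric.closedBall (chartAt (Fin n → ℂ) x₀ x₀) (2 * R))
    (hQv : ‖(tcoords x₀ Q).2‖ ≤ M)
    (hPQ : riemDistTangent P Q < ENNReal.ofReal (r / (C + C ^ 4 * (M + 1)))) :
    P ∈ tsource x₀ ∧ ‖tcoords x₀ P - tcoords x₀ Q‖ < r := by
  have hC0 : 0 < C := lt_of_lt_of_le one_pos h.one_le
  set K := C + C ^ 4 * (M + 1) with hK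
  have hK0 : 0 < K := by positivity
  have hPQ' : Manifold.riemannianEDist 𝓘(ℝ, Fin n → ℂ).tangent Q P <
      ENNReal.ofReal (r / K) := by
    rw [Manifold.riemannianEDist_comm]
    exact hPQ
  obtain ⟨γ, hγ0, hγ1, hγs, hγl, -⟩ :=
    Manifold.exists_lt_locally_constant_of_riemannianEDist_lt hPQ' zero_lt_one
  set W := {P : TangentBundle 𝓘(ℝ, Fin n → ℂ) X | P ∈ tsource x₀ ∧
      (tcoords x₀ P).1 ∈ Metric.closedBall (chartAt (Fin n → ℂ) x₀ x₀) (3 * R) ∧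
      ‖(tcoords x₀ P).2‖ ≤ M + 1} with hW
  have hWc : IsClosed W := h.isClosed_bounded_part _
  set V := tsource x₀ ∩ tcoords x₀ ⁻¹' Metric.ball (tcoords x₀ Q) r with hV
  have hVo : IsOpen V := (continuousOn_tcoords x₀).isOpen_inter_preimage (isOpen_tsource x₀)
    Metric.isOpen_ball
  have hVW : V ⊆ W := by
    rintro S ⟨h1, h2⟩
    rw [mem_preimage, Metric.mem_ball, dist_eq_norm, Prod.norm_def, max_lt_iff] at h2
    refine ⟨h1, ?_, ?_⟩
    · rw [Metric.mem_closedBall] at hQz ⊢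
      have h3 := dist_triangle (tcoords x₀ S).1 (tcoords x₀ Q).1 (chartAt (Fin n → ℂ) x₀ x₀)
      have h4 : dist (tcoords x₀ S).1 (tcoords x₀ Q).1 < r := by
        rw [dist_eq_norm]; exact h2.1
      linarith
    · have h3 : ‖(tcoords x₀ S).2‖ ≤
          ‖(tcoords x₀ S).2 - (tcoords x₀ Q).2‖ + ‖(tcoords x₀ Q).2‖ := by
        simpa using norm_add_le ((tcoords x₀ S).2 - (tcoords x₀ Q).2) (tcoords x₀ Q).2
      have h4 : ‖(tcoords x₀ S).2 - (tcoords x₀ Q).2‖ < r := h2.2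
      linarith
  have hQV : Q ∈ V := ⟨hQ, Metric.mem_ball_self hr⟩
  -- as long as the curve has stayed in the controlled region, it is still close to its start
  have key (t : ℝ) (ht : t ∈ Icc (0 : ℝ) 1) (htW : Icc 0 t ⊆ γ ⁻¹' W) : γ t ∈ V := by
    refine ⟨(htW (right_mem_Icc.2 ht.1)).1, ?_⟩
    have hcd : ContDiffOn ℝ 1 (fun s => tcoords x₀ (γ s)) (Icc 0 t) := by
      rw [← contMDiffOn_iff_contDiffOn]
      exact (contMDiffOn_tcoords x₀).comp hγs.contMDiffOn fun s hs => (htW hs).1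
    have hbound := enorm_sub_le_lintegral_derivWithin_Icc_of_contDiffOn_Icc hcd ht.1
    rw [mem_preimage, ← hγ0, Metric.mem_ball, dist_eq_norm]
    have hlt : ‖tcoords x₀ (γ t) - tcoords x₀ (γ 0)‖ₑ < ENNReal.ofReal r := by
      calc ‖tcoords x₀ (γ t) - tcoords x₀ (γ 0)‖ₑ
          ≤ ∫⁻ s in Icc 0 t, ‖derivWithin (fun s => tcoords x₀ (γ s)) (Icc 0 t) s‖ₑ := hbound
        _ = ∫⁻ s in Ioo 0 t, ‖derivWithin (fun s => tcoords x₀ (γ s)) (Icc 0 t) s‖ₑ := by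
          rw [Measure.restrict_congr_set Ioo_ae_eq_Icc]
        _ ≤ ∫⁻ s in Ioo 0 t, ENNReal.ofReal K *
            ‖mfderiv 𝓘(ℝ, ℝ) 𝓘(ℝ, Fin n → ℂ).tangent γ s (1 : ℝ)‖ₑ := by
          refine setLIntegral_mono' measurableSet_Ioo fun s hs => ?_
          have hsW := htW (Ioo_subset_Icc_self hs)
          obtain ⟨d, hd, hd1, -⟩ := h.exists_velocity_bounds hX (M := M + 1) (by positivity)
            (hγs.mdifferentiable one_ne_zero s) hsW.1 hsW.2.1 hsW.2.2
          rw [derivWithin_of_mem_nhds (Icc_mem_nhds hs.1 hs.2), hd.deriv]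
          change ‖d‖ₑ ≤ ENNReal.ofReal K * ENNReal.ofReal _
          rw [← ENNReal.ofReal_mul hK0.le, ← ofReal_norm]
          exact ENNReal.ofReal_le_ofReal hd1
        _ = ENNReal.ofReal K * Manifold.pathELength 𝓘(ℝ, Fin n → ℂ).tangent γ 0 t := by
          rw [lintegral_const_mul' _ _ ENNReal.ofReal_ne_top,
            Manifold.pathELength_eq_lintegral_mfderiv_Ioo]
          rfl
        _ ≤ ENNReal.ofReal K * Manifold.pathELength 𝓘(ℝ, Fin n → ℂ).tangent γ 0 1 := by
          gcongr
          exact ht.2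
        _ < ENNReal.ofReal K * ENNReal.ofReal (r / K) := by
          gcongr
          simp
        _ = ENNReal.ofReal r := by
          rw [← ENNReal.ofReal_mul hK0.le, mul_div_cancel₀ _ hK0.ne']
    rwa [← ofReal_norm, ENNReal.ofReal_lt_ofReal_iff hr] at hlt
  have hsub : Icc (0 : ℝ) 1 ⊆ γ ⁻¹' W := by
    have hcl : IsClosed (γ ⁻¹' W ∩ Icc 0 1) := (hWc.preimage hγs.continuous).inter isClosed_Icc
    refine hcl.Icc_subset_of_forall_mem_nhdsGT_of_Icc_subset ?_ fun t ht htW => ?_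
    · rw [mem_preimage, hγ0]; exact hVW hQV
    · exact hγs.continuous.continuousWithinAt <| Filter.mem_of_superset
        (hVo.mem_nhds (key t ⟨ht.1, ht.2.le⟩ htW)) hVW
  have h1 := key 1 ⟨zero_le_one, le_rfl⟩ hsub
  rw [hγ1] at h1
  refine ⟨h1.1, ?_⟩
  have := h1.2
  rwa [mem_preimage, Metric.mem_ball, dist_eq_norm] at this

end GoodChart
end TangentBundleMetric
end HermitianManifold


/-! ### Variations are close to the identity in charts -/

namespace HermitianManifold

section CoordMap

variable {n : ℕ} {X : Type*} [TopologicalSpace X] [ChartedSpace (Fin n → ℂ) X]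

/-- A self-map of `X`, read in the chart at `x₀`. -/
def coordMap (x₀ : X) (Φ : X → X) : (Fin n → ℂ) → (Fin n → ℂ) :=
  chartAt (Fin n → ℂ) x₀ ∘ Φ ∘ (chartAt (Fin n → ℂ) x₀).symm

variable [IsManifold 𝓘(ℂ, Fin n → ℂ) ω X]

/-- The derivative of a self-map in the coordinates of a fixed chart. The manifold derivative is
defined with the preferred charts at `p` and `Φ p`, so two transition maps enter. -/
theorem mfderiv_coordField {x₀ p : X} {Φ : X → X}
    (hΦ : MDifferentiableAt 𝓘(ℝ, Fin n → ℂ) 𝓘(ℝ, Fin n → ℂ) Φ p)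
    (hp : p ∈ (chartAt (Fin n → ℂ) x₀).source) (hΦp : Φ p ∈ (chartAt (Fin n → ℂ) x₀).source) :
    DifferentiableAt ℝ (coordMap (n := n) x₀ Φ) (chartAt (Fin n → ℂ) x₀ p) ∧
    ∀ u : Fin n → ℂ, mfderiv 𝓘(ℝ, Fin n → ℂ) 𝓘(ℝ, Fin n → ℂ) Φ p (coordField x₀ u p) =
      coordField x₀ (fderiv ℝ (coordMap x₀ Φ) (chartAt (Fin n → ℂ) x₀ p) u) (Φ p) := by
  set z := chartAt (Fin n → ℂ) x₀ p with hz
  have hzp : (chartAt (Fin n → ℂ) x₀).symm z = p := (chartAt (Fin n → ℂ) x₀).left_inv hp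
  let L : (Fin n → ℂ) →L[ℝ] (Fin n → ℂ) := mfderiv 𝓘(ℝ, Fin n → ℂ) 𝓘(ℝ, Fin n → ℂ) Φ p
  have h2 : HasFDerivWithinAt (chartAt (Fin n → ℂ) (Φ p) ∘ Φ ∘ (chartAt (Fin n → ℂ) p).symm) L
      (range 𝓘(ℝ, Fin n → ℂ)) (chartAt (Fin n → ℂ) p p) := hΦ.hasMFDerivAt.2
  rw [ModelWithCorners.range_eq_univ, hasFDerivWithinAt_univ] at h2
  have hps := mem_chart_source (Fin n → ℂ) p
  have hΦs := mem_chart_source (Fin n → ℂ) (Φ p)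
  have hz1 : z ∈ transSource x₀ p := chart_mem_transSource hp hps
  have hz2 := chart_mem_transSource (n := n) hΦs hΦp
  have hθ1 := (differentiableAt_trans hz1).hasFDerivAt.restrictScalars ℝ
  have hθ2 := (differentiableAt_trans hz2).hasFDerivAt.restrictScalars ℝ
  have e1 : trans x₀ p z = chartAt (Fin n → ℂ) p p := trans_chart p hp
  rw [← e1] at h2
  have h3 := h2.comp z hθ1
  have e2 : ((chartAt (Fin n → ℂ) (Φ p) ∘ Φ ∘ (chartAt (Fin n → ℂ) p).symm) ∘ trans x₀ p) z =
      chartAt (Fin n → ℂ) (Φ p) (Φ p) := by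
    simp only [Function.comp_apply, e1]
    rw [(chartAt (Fin n → ℂ) p).left_inv hps]
  rw [← e2] at hθ2
  have h4 := hθ2.comp z h3
  have hev : coordMap x₀ Φ =ᶠ[𝓝 z] trans (Φ p) x₀ ∘
      ((chartAt (Fin n → ℂ) (Φ p) ∘ Φ ∘ (chartAt (Fin n → ℂ) p).symm) ∘ trans x₀ p) := by
    have hc : ContinuousAt (fun w => Φ ((chartAt (Fin n → ℂ) x₀).symm w)) z := by
      refine ContinuousAt.comp (g := Φ) ?_
        ((chartAt (Fin n → ℂ) x₀).symm.continuousAt (x := z) hz1.1)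
      rw [hzp]; exact hΦ.continuousAt
    have hm : (chartAt (Fin n → ℂ) (Φ p)).source ∈ 𝓝 (Φ ((chartAt (Fin n → ℂ) x₀).symm z)) := by
      rw [hzp]; exact (chartAt (Fin n → ℂ) (Φ p)).open_source.mem_nhds hΦs
    filter_upwards [(isOpen_transSource x₀ p).mem_nhds hz1, hc.preimage_mem_nhds hm] with w hw1 hw2
    simp only [coordMap, trans, Function.comp_apply]
    rw [(chartAt (Fin n → ℂ) p).left_inv hw1.2, (chartAt (Fin n → ℂ) (Φ p)).left_inv hw2]
  have h5 := h4.congr_of_eventuallyEq hev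
  refine ⟨h5.differentiableAt, fun u => ?_⟩
  rw [h5.fderiv]
  have e3 : coordField x₀ u p = fderiv ℂ (trans x₀ p) z u :=
    (coordField_eq hp u).trans (tangentCoordChange_eq hp hps u)
  have e4 : L (fderiv ℂ (trans x₀ p) z u) = coordField x₀
      (fderiv ℂ (trans (Φ p) x₀) (chartAt (Fin n → ℂ) (Φ p) (Φ p))
        (L (fderiv ℂ (trans x₀ p) z u))) (Φ p) :=
    (coordField_self (Φ p) _).symm.trans (coordField_trans hΦs hΦp _)
  rw [← e2] at e4
  exact (congrArg L e3).trans e4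

theorem fderiv_coordMap_apply {x₀ p : X} {Φ : X → X}
    (hΦ : MDifferentiableAt 𝓘(ℝ, Fin n → ℂ) 𝓘(ℝ, Fin n → ℂ) Φ p)
    (hp : p ∈ (chartAt (Fin n → ℂ) x₀).source) (hΦp : Φ p ∈ (chartAt (Fin n → ℂ) x₀).source)
    (u : Fin n → ℂ) :
    coords x₀ (Φ p) (mfderiv 𝓘(ℝ, Fin n → ℂ) 𝓘(ℝ, Fin n → ℂ) Φ p (coordField x₀ u p)) =
      fderiv ℝ (coordMap x₀ Φ) (chartAt (Fin n → ℂ) x₀ p) u := by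
  rw [(mfderiv_coordField hΦ hp hΦp).2, coords_coordField hΦp]

variable [RiemannianBundle (fun x : X => TangentSpace 𝓘(ℝ, Fin n → ℂ) x)]
  [IsContMDiffRiemannianBundle 𝓘(ℝ, Fin n → ℂ) ∞ (Fin n → ℂ)
    (fun x : X => TangentSpace 𝓘(ℝ, Fin n → ℂ) x)]

/-- In a good chart, `δ`-variations with small `δ` are close to the identity in `C¹`: the distance
in the tangent bundle between a unit vector `v` and `Φ_* v` controls the displacement of the base
point and the change of the vector at the same time. -/
theorem GoodChart.exists_coordMap_close [T2Space X] [ConnectedSpace X]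
    (hX : IsHermitianMetric n X) {φ : X → ℝ} {x₀ : X} {R C : ℝ}
    (h : GoodChart (n := n) φ x₀ R C) {η : ℝ} (hη : 0 < η) :
    ∃ δ : ℝ, 0 < δ ∧ ∀ δ' ≤ δ, ∀ Ω : Set X, ∀ Φ ∈ Var (n := n) δ' Ω,
      ∀ z ∈ Metric.closedBall (chartAt (Fin n → ℂ) x₀ x₀) (2 * R),
        Φ ((chartAt (Fin n → ℂ) x₀).symm z) ∈ (chartAt (Fin n → ℂ) x₀).source ∧
        ‖coordMap x₀ Φ z - z‖ ≤ η ∧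
        ‖fderiv ℝ (coordMap x₀ Φ) z - ContinuousLinearMap.id ℝ (Fin n → ℂ)‖ ≤ η := by
  -- in dimension `0` there are no unit vectors, but then the connected space `X` is a point
  rcases Nat.eq_zero_or_pos n with rfl | hn
  · refine ⟨1, one_pos, fun δ' _ Ω Φ _ z _ => ⟨?_, ?_, ?_⟩⟩
    · have h1 : (chartAt (Fin 0 → ℂ) x₀).source = {x₀} := by
        refine Set.eq_singleton_iff_unique_mem.2 ⟨mem_chart_source _ x₀, fun y hy => ?_⟩
        exact (chartAt (Fin 0 → ℂ) x₀).injOn hy (mem_chart_source _ x₀) (Subsingleton.elim _ _)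
      have h2 : IsClopen (chartAt (Fin 0 → ℂ) x₀).source :=
        ⟨by rw [h1]; exact isClosed_singleton, (chartAt (Fin 0 → ℂ) x₀).open_source⟩
      rw [h2.eq_univ ⟨x₀, mem_chart_source _ x₀⟩]
      trivial
    · rw [Subsingleton.elim (coordMap x₀ Φ z - z) 0, norm_zero]
      exact hη.le
    · rw [Subsingleton.elim (fderiv ℝ (coordMap x₀ Φ) z - ContinuousLinearMap.id ℝ (Fin 0 → ℂ)) 0,
        norm_zero]
      exact hη.le
  have hC0 : 0 < C := lt_of_lt_of_le one_pos h.one_le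
  set r := min (min 1 R) (min η (η / C)) with hr
  have hr0 : 0 < r := lt_min (lt_min one_pos h.pos) (lt_min hη (by positivity))
  set K := C + C ^ 4 * (C + 1)
  have hK : 0 < K := by positivity
  refine ⟨r / K / 3, by positivity, fun δ' hδ Ω Φ hΦ z hz => ?_⟩
  set p := (chartAt (Fin n → ℂ) x₀).symm z with hp
  have hz3 : z ∈ Metric.closedBall (chartAt (Fin n → ℂ) x₀ x₀) (3 * R) :=
    Metric.closedBall_subset_closedBall (by linarith [h.pos]) hz
  have hzt := h.subset hz3
  have hps : p ∈ (chartAt (Fin n → ℂ) x₀).source := (chartAt (Fin n → ℂ) x₀).map_target hzt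
  have hpz : chartAt (Fin n → ℂ) x₀ p = z := (chartAt (Fin n → ℂ) x₀).right_inv hzt
  have hΦd : MDifferentiableAt 𝓘(ℝ, Fin n → ℂ) 𝓘(ℝ, Fin n → ℂ) Φ p :=
    (Φ.contMDiff p).mdifferentiableAt (by simp)
  -- the estimate for coordinates of unit vectors
  have key (u : Fin n → ℂ) (hu : tangentNorm p (coordField x₀ u p) = 1) :
      Φ p ∈ (chartAt (Fin n → ℂ) x₀).source ∧ ‖coordMap x₀ Φ z - z‖ < r ∧
        ‖fderiv ℝ (coordMap x₀ Φ) z u - u‖ < r := by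
    have h1 : riemDistTangent (n := n) ⟨Φ p, mfderiv 𝓘(ℝ, Fin n → ℂ) 𝓘(ℝ, Fin n → ℂ) Φ p
        (coordField x₀ u p)⟩ ⟨p, coordField x₀ u p⟩ < ENNReal.ofReal (r / K) := by
      refine lt_of_le_of_lt ?_ (hΦ.2.2.2.1.trans_le (ENNReal.ofReal_le_ofReal (by linarith)))
      exact le_iSup_of_le p (le_iSup_of_le (coordField x₀ u p) (le_iSup_of_le hu le_rfl))
    have hQ : tcoords x₀ (⟨p, coordField x₀ u p⟩ : TangentBundle 𝓘(ℝ, Fin n → ℂ) X) = (z, u) :=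
      tcoords_ofTcoords (ζ := (z, u)) hzt
    obtain ⟨h2, h3⟩ := h.norm_tcoords_sub_lt hX hr0 ((min_le_left _ _).trans (min_le_left _ _))
      ((min_le_left _ _).trans (min_le_right _ _)) hC0.le
      (Q := ⟨p, coordField x₀ u p⟩) hps (by rw [hQ]; exact hz)
      (by
        rw [hQ]
        have := h.le_norm z hz3 u
        rwa [← hp, hu, mul_one] at this) h1
    rw [hQ] at h3
    have h2' : Φ p ∈ (chartAt (Fin n → ℂ) x₀).source := h2
    have h4 : tcoords x₀ (⟨Φ p, mfderiv 𝓘(ℝ, Fin n → ℂ) 𝓘(ℝ, Fin n → ℂ) Φ p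
        (coordField x₀ u p)⟩ : TangentBundle 𝓘(ℝ, Fin n → ℂ) X) =
        (coordMap x₀ Φ z, fderiv ℝ (coordMap x₀ Φ) z u) := by
      refine Prod.ext rfl ?_
      rw [← hpz]
      exact fderiv_coordMap_apply hΦd hps h2' u
    rw [h4, Prod.norm_def, max_lt_iff] at h3
    exact ⟨h2', h3⟩
  -- the derivative on arbitrary vectors, by homogeneity
  have key2 (u : Fin n → ℂ) (hu : u ≠ 0) :
      Φ p ∈ (chartAt (Fin n → ℂ) x₀).source ∧ ‖coordMap x₀ Φ z - z‖ < r ∧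
        ‖fderiv ℝ (coordMap x₀ Φ) z u - u‖ ≤ r * C * ‖u‖ := by
    set s := tangentNorm p (coordField x₀ u p) with hs
    have hs0 : 0 < s := tangentNorm_coordField_pos hps hu
    obtain ⟨h1, h2, h3⟩ := key (s⁻¹ • u) (by
      rw [coordField_real_smul, tangentNorm, norm_smul, Real.norm_of_nonneg (by positivity)]
      exact inv_mul_cancel₀ hs0.ne')
    refine ⟨h1, h2, ?_⟩
    rw [map_smul, ← smul_sub, norm_smul, Real.norm_of_nonneg (by positivity),
      inv_mul_lt_iff₀ hs0] at h3
    calc _ ≤ s * r := h3.le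
      _ ≤ (C * ‖u‖) * r := by gcongr; exact h.norm_le z hz3 u
      _ = _ := by ring
  obtain ⟨h1, h2, -⟩ := key2 (Pi.single ⟨0, hn⟩ 1) (by simp)
  refine ⟨h1, h2.le.trans ((min_le_right _ _).trans (min_le_left _ _)), ?_⟩
  refine ContinuousLinearMap.opNorm_le_bound _ hη.le fun u => ?_
  rcases eq_or_ne u 0 with rfl | hu
  · simp
  · refine ((key2 u hu).2.2).trans ?_
    gcongr
    calc r * C ≤ η / C * C := by gcongr; exact (min_le_right _ _).trans (min_le_right _ _)
      _ = η := div_mul_cancel₀ _ hC0.ne'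

end CoordMap
end HermitianManifold


/-! ### The volume measure in a chart -/

namespace HermitianManifold

section Volume

variable {n : ℕ} {X : Type*} [TopologicalSpace X] [ChartedSpace (Fin n → ℂ) X]
  [IsManifold 𝓘(ℂ, Fin n → ℂ) ω X]
  [RiemannianBundle (fun x : X => TangentSpace 𝓘(ℝ, Fin n → ℂ) x)]

theorem _root_.ContinuousOn.measurableSet_inter_preimage {Y Z : Type*} [TopologicalSpace Y]
    [MeasurableSpace Y] [BorelSpace Y] [TopologicalSpace Z] [MeasurableSpace Z] [BorelSpace Z]
    {f : Y → Z} {S : Set Y} (hf : ContinuousOn f S) (hS : MeasurableSet S) {T : Set Z}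
    (hT : MeasurableSet T) : MeasurableSet (S ∩ f ⁻¹' T) := by
  have h := hS.subtype_image ((continuousOn_iff_continuous_domRestrict.1 hf).measurable hT)
  convert h using 1
  ext y
  simp [and_comm]

/-- The real Jacobian of a holomorphic map is the squared modulus of its complex Jacobian; this is
why the densities `det h` in different charts define the same measure. -/
theorem _root_.ContinuousLinearMap.abs_det_restrictScalars_complex
    (L : (Fin n → ℂ) →L[ℂ] (Fin n → ℂ)) :
    |(L.restrictScalars ℝ).det| = ‖L.det‖ ^ 2 := by
  have h : (L.restrictScalars ℝ).det = Complex.normSq L.det := by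
    rw [← Algebra.norm_complex_apply]
    exact LinearMap.det_restrictScalars (R := ℝ) (S := ℂ) (f := (L : (Fin n → ℂ) →ₗ[ℂ] (Fin n → ℂ)))
  rw [h, Complex.normSq_eq_norm_sq, abs_of_nonneg (by positivity)]

theorem hermMatrix_trans (hX : IsHermitianMetric n X) {y x₀ : X} {z : Fin n → ℂ}
    (hz : z ∈ transSource y x₀) :
    (hermMatrix y z).det.re =
      ‖(fderiv ℂ (trans y x₀) z).det‖ ^ 2 * (hermMatrix x₀ (trans y x₀ z)).det.re := by
  set A := fderiv ℂ (trans (n := n) y x₀) z with hA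
  have hzt : trans y x₀ z ∈ (chartAt (Fin n → ℂ) x₀).target :=
    (chartAt (Fin n → ℂ) x₀).map_source hz.2
  set M := LinearMap.toMatrix' (A : (Fin n → ℂ) →ₗ[ℂ] (Fin n → ℂ)) with hM
  have h1 : hermMatrix y z = M.conjTranspose * (hermMatrix x₀ (trans y x₀ z) * M) := by
    ext j k
    change hermCoord y z (Pi.single j 1) (Pi.single k 1) = _
    rw [hermCoord_trans hz, hermCoord_eq_dotProduct hX hzt]
    simp only [dotProduct, Matrix.mulVec, Matrix.mul_apply, Matrix.conjTranspose_apply, hM,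
      LinearMap.toMatrix'_apply, Pi.star_apply]
    rfl
  have h2 : M.det = A.det := LinearMap.det_toMatrix' (f := (A : (Fin n → ℂ) →ₗ[ℂ] (Fin n → ℂ)))
  rw [h1, Matrix.det_mul, Matrix.det_mul, Matrix.det_conjTranspose, h2]
  have h3 : star A.det * ((hermMatrix x₀ (trans y x₀ z)).det * A.det) =
      ((‖A.det‖ ^ 2 : ℝ) : ℂ) * (hermMatrix x₀ (trans y x₀ z)).det := by
    rw [← Complex.normSq_eq_norm_sq, Complex.normSq_eq_conj_mul_self]
    simp only [RCLike.star_def]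
    ring
  rw [h3, Complex.re_ofReal_mul]

variable [MeasurableSpace X] [BorelSpace X]

omit [RiemannianBundle (fun x : X => TangentSpace 𝓘(ℝ, Fin n → ℂ) x)] in
theorem aemeasurable_chart_symm (x₀ : X) {μ : Measure (Fin n → ℂ)} {S : Set (Fin n → ℂ)}
    (hS : S ⊆ (chartAt (Fin n → ℂ) x₀).target) (hm : MeasurableSet S) :
    AEMeasurable (chartAt (Fin n → ℂ) x₀).symm (μ.restrict S) :=
  ((chartAt (Fin n → ℂ) x₀).continuousOn_symm.mono hS).aemeasurable hm

theorem chartVolume_apply (x₀ : X) {E : Set X} (hE : MeasurableSet E)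
    (hEs : E ⊆ (chartAt (Fin n → ℂ) x₀).source) :
    chartVolume (n := n) x₀ E =
      ∫⁻ z in chartAt (Fin n → ℂ) x₀ '' E, ENNReal.ofReal (hermMatrix x₀ z).det.re := by
  classical
  set e := chartAt (Fin n → ℂ) x₀ with he
  have htm : MeasurableSet e.target := e.open_target.measurableSet
  set g : (Fin n → ℂ) → X := e.target.piecewise e.symm (fun _ => x₀) with hg
  have hgm : Measurable g := e.continuousOn_symm.measurable_piecewise continuousOn_const htm
  have h1 : chartVolume (n := n) x₀ = ((volume.restrict e.target).withDensity
      (fun z => ENNReal.ofReal (hermMatrix x₀ z).det.re)).map g := by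
    have ht : (extChartAt 𝓘(ℝ, Fin n → ℂ) x₀).target = e.target := by simp [he]
    rw [chartVolume, ht]
    refine Measure.map_congr ((withDensity_absolutelyContinuous _ _).ae_le ?_)
    filter_upwards [ae_restrict_mem htm] with z hz
    rw [hg, piecewise_eq_of_mem _ _ _ hz]
    simp [he, mfld_simps]
  rw [h1, Measure.map_apply hgm hE, withDensity_apply _ (hgm hE),
    Measure.restrict_restrict (hgm hE)]
  congr 2
  ext z
  constructor
  · rintro ⟨h2, h3⟩
    rw [mem_preimage, hg, piecewise_eq_of_mem _ _ _ h3] at h2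
    exact ⟨_, h2, e.right_inv h3⟩
  · rintro ⟨x, hx, rfl⟩
    have := e.map_source (hEs hx)
    refine ⟨?_, this⟩
    rw [mem_preimage, hg, piecewise_eq_of_mem _ _ _ this, e.left_inv (hEs hx)]
    exact hx

/-- The measure given by a chart lives on the domain of the chart. -/
theorem chartVolume_compl_source (x₀ : X) :
    chartVolume (n := n) x₀ (chartAt (Fin n → ℂ) x₀).sourceᶜ = 0 := by
  have hm : MeasurableSet (chartAt (Fin n → ℂ) x₀).source :=
    (chartAt (Fin n → ℂ) x₀).open_source.measurableSet
  have ht : (extChartAt 𝓘(ℝ, Fin n → ℂ) x₀).target = (chartAt (Fin n → ℂ) x₀).target := by simp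
  have htm := (chartAt (Fin n → ℂ) x₀).open_target.measurableSet
  have hs : ((extChartAt 𝓘(ℝ, Fin n → ℂ) x₀).symm : (Fin n → ℂ) → X) =
      (chartAt (Fin n → ℂ) x₀).symm := by simp [mfld_simps]
  rw [chartVolume, ht, hs, Measure.map_apply_of_aemeasurable
    ((aemeasurable_chart_symm x₀ subset_rfl htm).mono_ac (withDensity_absolutelyContinuous _ _))
    hm.compl]
  refine withDensity_absolutelyContinuous _ _ (measure_mono_null
    (t := (chartAt (Fin n → ℂ) x₀).targetᶜ)
    (fun z hz h => hz ((chartAt (Fin n → ℂ) x₀).map_target h)) ?_)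
  rw [Measure.restrict_apply htm.compl]
  simp

/-- Inside the domain of the chart at `x₀`, the measure given by another chart is dominated by the
one of `x₀`: by the change of variables formula, the two agree on the overlap of the domains, and
the measure given by the other chart vanishes outside of its own domain. -/
theorem chartVolume_le_of_subset (hX : IsHermitianMetric n X) (y x₀ : X) {E : Set X}
    (hE : MeasurableSet E) (hEs : E ⊆ (chartAt (Fin n → ℂ) x₀).source) :
    chartVolume (n := n) y E ≤ chartVolume (n := n) x₀ E := by
  set s := (chartAt (Fin n → ℂ) y).source with hs
  have hsm : MeasurableSet s := (chartAt (Fin n → ℂ) y).open_source.measurableSet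
  rw [← measure_inter_add_sdiff E hsm]
  have h0 : chartVolume (n := n) y (E \ s) = 0 :=
    measure_mono_null (fun x hx => hx.2) (chartVolume_compl_source (n := n) y)
  rw [h0, add_zero]
  refine le_trans ?_ (measure_mono (inter_subset_left (s := E) (t := s)))
  rw [chartVolume_apply y (hE.inter hsm) inter_subset_right,
    chartVolume_apply x₀ (hE.inter hsm) (inter_subset_left.trans hEs)]
  set Z := chartAt (Fin n → ℂ) y '' (E ∩ s) with hZ
  have hZs : Z ⊆ transSource y x₀ := by
    rintro _ ⟨x, hx, rfl⟩
    exact chart_mem_transSource hx.2 (hEs hx.1)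
  have hZm : MeasurableSet Z := by
    have : Z = (chartAt (Fin n → ℂ) y).target ∩ (chartAt (Fin n → ℂ) y).symm ⁻¹' (E ∩ s) :=
      (chartAt (Fin n → ℂ) y).image_eq_target_inter_inv_preimage inter_subset_right
    rw [this]
    exact ((chartAt (Fin n → ℂ) y).continuousOn_symm).measurableSet_inter_preimage
      (chartAt (Fin n → ℂ) y).open_target.measurableSet (hE.inter hsm)
  have himage : chartAt (Fin n → ℂ) x₀ '' (E ∩ s) = trans y x₀ '' Z := by
    rw [hZ, image_image]
    exact image_congr fun x hx => (trans_chart x₀ hx.2).symm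
  have hinj : InjOn (trans (n := n) y x₀) Z := by
    rintro _ ⟨x, hx, rfl⟩ _ ⟨x', hx', rfl⟩ hxx
    rw [trans_chart x₀ hx.2, trans_chart x₀ hx'.2] at hxx
    rw [(chartAt (Fin n → ℂ) x₀).injOn (hEs hx.1) (hEs hx'.1) hxx]
  rw [himage, lintegral_image_eq_lintegral_abs_det_fderiv_mul volume hZm
    (f' := fun z => (fderiv ℂ (trans (n := n) y x₀) z).restrictScalars ℝ)
    (fun z hz => ((differentiableAt_trans (hZs hz)).hasFDerivAt.restrictScalars
      ℝ).hasFDerivWithinAt) hinj]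
  refine (setLIntegral_congr_fun hZm fun z hz => ?_).le
  rw [ContinuousLinearMap.abs_det_restrictScalars_complex, ← ENNReal.ofReal_mul (by positivity),
    hermMatrix_trans hX (hZs hz)]

/-- The volume measure, which is the supremum of the measures given by the charts, is in each chart
given by the density `det h`. -/
theorem volumeMeasure_restrict_source_le (hX : IsHermitianMetric n X) (x₀ : X) :
    (volumeMeasure n X).restrict (chartAt (Fin n → ℂ) x₀).source ≤ chartVolume (n := n) x₀ := by
  set s := (chartAt (Fin n → ℂ) x₀).source with hs
  have hsm : MeasurableSet s := (chartAt (Fin n → ℂ) x₀).open_source.measurableSet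
  have hle : volumeMeasure n X ≤ chartVolume (n := n) x₀ + (volumeMeasure n X).restrict sᶜ := by
    refine iSup_le fun y => Measure.le_iff.2 fun E hE => ?_
    rw [← measure_inter_add_sdiff E hsm, Measure.add_apply, Measure.restrict_apply hE]
    exact add_le_add ((chartVolume_le_of_subset hX y x₀ (hE.inter hsm) inter_subset_right).trans
        (measure_mono inter_subset_left))
      ((le_iSup (fun y : X => chartVolume (n := n) y) y) (E \ s))
  refine Measure.le_iff.2 fun E hE => ?_
  rw [Measure.restrict_apply hE]
  refine (hle (E ∩ s)).trans ?_
  rw [Measure.add_apply, Measure.restrict_apply (hE.inter hsm)]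
  have : E ∩ s ∩ sᶜ = ∅ := by ext; simp
  rw [this, measure_empty, add_zero]
  exact measure_mono inter_subset_left

namespace GoodChart

variable {φ : X → ℝ} {x₀ : X} {R C : ℝ}

omit [MeasurableSpace X] [BorelSpace X] in
theorem const_pos (h : GoodChart (n := n) φ x₀ R C) : 0 < C := lt_of_lt_of_le one_pos h.one_le

omit [MeasurableSpace X] [BorelSpace X] in
theorem symm_image_subset (h : GoodChart (n := n) φ x₀ R C) {S : Set (Fin n → ℂ)}
    (hS : S ⊆ Metric.closedBall (chartAt (Fin n → ℂ) x₀ x₀) (3 * R)) :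
    (chartAt (Fin n → ℂ) x₀).symm '' S ⊆ (chartAt (Fin n → ℂ) x₀).source := by
  rintro _ ⟨z, hz, rfl⟩
  exact (chartAt (Fin n → ℂ) x₀).map_target (h.subset (hS hz))

omit [MeasurableSpace X] [BorelSpace X] in
theorem image_symm_image (h : GoodChart (n := n) φ x₀ R C) {S : Set (Fin n → ℂ)}
    (hS : S ⊆ Metric.closedBall (chartAt (Fin n → ℂ) x₀ x₀) (3 * R)) :
    chartAt (Fin n → ℂ) x₀ '' ((chartAt (Fin n → ℂ) x₀).symm '' S) = S := by
  rw [image_image]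
  have : EqOn (fun z => chartAt (Fin n → ℂ) x₀ ((chartAt (Fin n → ℂ) x₀).symm z)) id S :=
    fun z hz => (chartAt (Fin n → ℂ) x₀).right_inv (h.subset (hS hz))
  rw [this.image_eq, image_id]

theorem measurableSet_symm_image (h : GoodChart (n := n) φ x₀ R C) {S : Set (Fin n → ℂ)}
    (hS : S ⊆ Metric.closedBall (chartAt (Fin n → ℂ) x₀ x₀) (3 * R)) (hm : MeasurableSet S) :
    MeasurableSet ((chartAt (Fin n → ℂ) x₀).symm '' S) := by
  have : (chartAt (Fin n → ℂ) x₀).symm '' S =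
      (chartAt (Fin n → ℂ) x₀).source ∩ chartAt (Fin n → ℂ) x₀ ⁻¹' S :=
    (chartAt (Fin n → ℂ) x₀).symm.image_eq_target_inter_inv_preimage (hS.trans h.subset)
  rw [this]
  exact ((chartAt (Fin n → ℂ) x₀).continuousOn).measurableSet_inter_preimage
    (chartAt (Fin n → ℂ) x₀).open_source.measurableSet hm

theorem chartVolume_symm_image (h : GoodChart (n := n) φ x₀ R C) {S : Set (Fin n → ℂ)}
    (hS : S ⊆ Metric.closedBall (chartAt (Fin n → ℂ) x₀ x₀) (3 * R)) (hm : MeasurableSet S) :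
    chartVolume (n := n) x₀ ((chartAt (Fin n → ℂ) x₀).symm '' S) =
      ∫⁻ z in S, ENNReal.ofReal (hermMatrix x₀ z).det.re := by
  rw [chartVolume_apply x₀ (h.measurableSet_symm_image hS hm) (h.symm_image_subset hS),
    h.image_symm_image hS]

theorem weightedVolume_symm_image_le (hX : IsHermitianMetric n X)
    (h : GoodChart (n := n) φ x₀ R C) {S : Set (Fin n → ℂ)}
    (hS : S ⊆ Metric.closedBall (chartAt (Fin n → ℂ) x₀ x₀) (3 * R)) (hm : MeasurableSet S) :
    weightedVolume n φ ((chartAt (Fin n → ℂ) x₀).symm '' S) ≤ ENNReal.ofReal C ^ 2 * volume S := by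
  have hU := h.measurableSet_symm_image hS hm
  calc weightedVolume n φ ((chartAt (Fin n → ℂ) x₀).symm '' S)
      = ∫⁻ x in (chartAt (Fin n → ℂ) x₀).symm '' S, ENNReal.ofReal (Real.exp (-φ x))
        ∂volumeMeasure n X := withDensity_apply _ hU
    _ ≤ ∫⁻ x in (chartAt (Fin n → ℂ) x₀).symm '' S, ENNReal.ofReal C ∂volumeMeasure n X := by
      refine setLIntegral_mono' hU ?_
      rintro _ ⟨z, hz, rfl⟩
      exact ENNReal.ofReal_le_ofReal (h.weight_mem z (hS hz)).2
    _ = ENNReal.ofReal C * (volumeMeasure n X).restrict (chartAt (Fin n → ℂ) x₀).source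
        ((chartAt (Fin n → ℂ) x₀).symm '' S) := by
      rw [setLIntegral_const, Measure.restrict_apply hU,
        inter_eq_self_of_subset_left (h.symm_image_subset hS)]
    _ ≤ ENNReal.ofReal C * chartVolume (n := n) x₀ ((chartAt (Fin n → ℂ) x₀).symm '' S) := by
      gcongr ENNReal.ofReal C * ?_
      exact volumeMeasure_restrict_source_le hX x₀ _
    _ ≤ ENNReal.ofReal C * ∫⁻ z in S, ENNReal.ofReal C := by
      rw [h.chartVolume_symm_image hS hm]
      gcongr ENNReal.ofReal C * ?_
      exact setLIntegral_mono' hm fun z hz => ENNReal.ofReal_le_ofReal (h.det_mem z (hS hz)).2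
    _ = _ := by rw [setLIntegral_const]; ring

theorem volume_le_weightedVolume_symm_image (h : GoodChart (n := n) φ x₀ R C)
    {S : Set (Fin n → ℂ)} (hS : S ⊆ Metric.closedBall (chartAt (Fin n → ℂ) x₀ x₀) (3 * R))
    (hm : MeasurableSet S) :
    volume S ≤ ENNReal.ofReal C ^ 2 * weightedVolume n φ ((chartAt (Fin n → ℂ) x₀).symm '' S) := by
  have hU := h.measurableSet_symm_image hS hm
  have hC := h.const_pos
  have one_le {y : ℝ} (hy : y ∈ Icc C⁻¹ C) : 1 ≤ ENNReal.ofReal C * ENNReal.ofReal y := by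
    rw [← ENNReal.ofReal_mul hC.le, ENNReal.one_le_ofReal]
    calc (1 : ℝ) = C * C⁻¹ := (mul_inv_cancel₀ hC.ne').symm
      _ ≤ C * y := by gcongr; exact hy.1
  calc volume S = ∫⁻ z in S, 1 := by rw [setLIntegral_const, one_mul]
    _ ≤ ∫⁻ z in S, ENNReal.ofReal C * ENNReal.ofReal (hermMatrix x₀ z).det.re :=
      setLIntegral_mono' hm fun z hz => one_le (h.det_mem z (hS hz))
    _ = ENNReal.ofReal C * chartVolume (n := n) x₀ ((chartAt (Fin n → ℂ) x₀).symm '' S) := by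
      rw [lintegral_const_mul' _ _ ENNReal.ofReal_ne_top, h.chartVolume_symm_image hS hm]
    _ ≤ ENNReal.ofReal C * volumeMeasure n X ((chartAt (Fin n → ℂ) x₀).symm '' S) := by
      gcongr ENNReal.ofReal C * ?_
      exact (le_iSup (fun y : X => chartVolume (n := n) y) x₀) _
    _ = ENNReal.ofReal C * ∫⁻ x in (chartAt (Fin n → ℂ) x₀).symm '' S, 1 ∂volumeMeasure n X := by
      rw [setLIntegral_const, one_mul]
    _ ≤ ENNReal.ofReal C * ∫⁻ x in (chartAt (Fin n → ℂ) x₀).symm '' S,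
        ENNReal.ofReal C * ENNReal.ofReal (Real.exp (-φ x)) ∂volumeMeasure n X := by
      gcongr ENNReal.ofReal C * ?_
      refine setLIntegral_mono' hU ?_
      rintro _ ⟨z, hz, rfl⟩
      exact one_le (h.weight_mem z (hS hz))
    _ = _ := by
      rw [lintegral_const_mul' _ _ ENNReal.ofReal_ne_top, weightedVolume, withDensity_apply _ hU]
      ring

theorem weightedVolume_restrict_le (hX : IsHermitianMetric n X)
    (h : GoodChart (n := n) φ x₀ R C) {S : Set (Fin n → ℂ)}
    (hS : S ⊆ Metric.closedBall (chartAt (Fin n → ℂ) x₀ x₀) (3 * R)) (hm : MeasurableSet S) :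
    (weightedVolume n φ).restrict ((chartAt (Fin n → ℂ) x₀).symm '' S) ≤
      (ENNReal.ofReal C ^ 2) • (volume.restrict S).map (chartAt (Fin n → ℂ) x₀).symm := by
  refine Measure.le_iff.2 fun E hE => ?_
  have hae : AEMeasurable (chartAt (Fin n → ℂ) x₀).symm (volume.restrict S) :=
    aemeasurable_chart_symm x₀ (hS.trans h.subset) hm
  have hSE : MeasurableSet (S ∩ (chartAt (Fin n → ℂ) x₀).symm ⁻¹' E) :=
    ((chartAt (Fin n → ℂ) x₀).continuousOn_symm.mono
      (hS.trans h.subset)).measurableSet_inter_preimage hm hE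
  rw [Measure.restrict_apply hE, Measure.smul_apply, Measure.map_apply_of_aemeasurable hae hE,
    Measure.restrict_apply' hm, inter_comm _ S, inter_comm E, ← image_inter_preimage]
  exact h.weightedVolume_symm_image_le hX (inter_subset_left.trans hS) hSE

theorem volume_restrict_le (h : GoodChart (n := n) φ x₀ R C) {S : Set (Fin n → ℂ)}
    (hS : S ⊆ Metric.closedBall (chartAt (Fin n → ℂ) x₀ x₀) (3 * R)) (hm : MeasurableSet S) :
    volume.restrict S ≤ (ENNReal.ofReal C ^ 2) •
      ((weightedVolume n φ).restrict ((chartAt (Fin n → ℂ) x₀).symm '' S)).map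
        (chartAt (Fin n → ℂ) x₀) := by
  refine Measure.le_iff.2 fun E hE => ?_
  have hU := h.measurableSet_symm_image hS hm
  have hae : AEMeasurable (chartAt (Fin n → ℂ) x₀)
      ((weightedVolume n φ).restrict ((chartAt (Fin n → ℂ) x₀).symm '' S)) :=
    ((chartAt (Fin n → ℂ) x₀).continuousOn.mono (h.symm_image_subset hS)).aemeasurable hU
  rw [Measure.smul_apply, Measure.map_apply_of_aemeasurable hae hE, Measure.restrict_apply hE,
    Measure.restrict_apply' hU]
  refine (h.volume_le_weightedVolume_symm_image (inter_subset_right.trans hS)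
    (hE.inter hm)).trans ?_
  rw [smul_eq_mul]
  gcongr ENNReal.ofReal C ^ 2 * ?_
  refine measure_mono ?_
  rintro _ ⟨z, hz, rfl⟩
  refine ⟨?_, z, hz.2, rfl⟩
  rw [mem_preimage, (chartAt (Fin n → ℂ) x₀).right_inv (h.subset (hS hz.2))]
  exact hz.1

end GoodChart

end Volume
end HermitianManifold


/-! ### Coefficients of forms and the pointwise norm -/

theorem AlternatingMap.apply_eq_sum_basis {V κ : Type*} [AddCommGroup V] [Module ℝ V] [Fintype κ]
    {k : ℕ} (e : Module.Basis κ ℝ V) (α : V [⋀^Fin k]→ₗ[ℝ] ℂ) (v : Fin k → V) :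
    α v = ∑ Q : Fin k → κ, (∏ j, e.repr (v j) (Q j)) • α (fun j => e (Q j)) := by
  classical
  have h1 : v = fun j => ∑ c, e.repr (v j) c • e c := by
    funext j
    exact (e.sum_repr (v j)).symm
  conv_lhs => rw [h1]
  have h2 := α.toMultilinearMap.map_sum (fun j c => e.repr (v j) c • e c)
  simp only [AlternatingMap.coe_multilinearMap] at h2
  rw [h2]
  refine Finset.sum_congr rfl fun Q _ => ?_
  exact α.toMultilinearMap.map_smul_univ (fun j => e.repr (v j) (Q j)) (fun j => e (Q j))

namespace HermitianManifold

section Coefficients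

variable {n : ℕ} {X : Type*} [TopologicalSpace X] [ChartedSpace (Fin n → ℂ) X]
  [IsManifold 𝓘(ℂ, Fin n → ℂ) ω X] {k : ℕ}

variable (n) in
/-- The index set of a real basis of `ℂⁿ`. -/
abbrev RealIndex : Type := Fin (Module.finrank ℝ (Fin n → ℂ))

variable (n) in
/-- A real basis of `ℂⁿ`. -/
def realBasis : Module.Basis (RealIndex n) ℝ (Fin n → ℂ) := Module.finBasis ℝ (Fin n → ℂ)

variable (n k) in
/-- The space of coefficient vectors of forms of degree `k`, with the supremum norm. -/
abbrev Coef : Type := (Fin k → RealIndex n) → ℂ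

/-- The coefficients of an alternating form at `p`, with respect to the coordinate fields of the
chart at `x₀` with values in the real basis. -/
def coefAt (x₀ : X) {p : X} (α : (TangentSpace 𝓘(ℝ, Fin n → ℂ) p) [⋀^Fin k]→ₗ[ℝ] ℂ) : Coef n k :=
  fun P => α (fun j => coordField x₀ (realBasis n (P j)) p)

/-- The coefficients of a form in the chart at `x₀`, as a function of the coordinates. -/
def coef (x₀ : X) (f : Form n X k) (z : Fin n → ℂ) : Coef n k :=
  coefAt x₀ (f ((chartAt (Fin n → ℂ) x₀).symm z))

/-- The value on the vectors `u` of the multilinear form with coefficients `c`. -/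
def evalCoef (c : Coef n k) (u : Fin k → Fin n → ℂ) : ℂ :=
  ∑ Q : Fin k → RealIndex n, (∏ j, (realBasis n).repr (u j) (Q j)) • c Q

theorem apply_coordField (x₀ : X) {p : X}
    (α : (TangentSpace 𝓘(ℝ, Fin n → ℂ) p) [⋀^Fin k]→ₗ[ℝ] ℂ) (u : Fin k → Fin n → ℂ) :
    α (fun j => coordField x₀ (u j) p) = evalCoef (coefAt x₀ α) u := by
  let D : (Fin n → ℂ) →ₗ[ℝ] TangentSpace 𝓘(ℝ, Fin n → ℂ) p :=
    { toFun := fun u => coordField x₀ u p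
      map_add' := fun u v => coordField_add u v
      map_smul' := fun r u => coordField_real_smul r u }
  exact (α.compLinearMap D).apply_eq_sum_basis (realBasis n) u

theorem evalCoef_realBasis (c : Coef n k) (P : Fin k → RealIndex n) :
    evalCoef c (fun j => realBasis n (P j)) = c P := by
  classical
  rw [evalCoef, Finset.sum_eq_single P]
  · simp
  · intro Q _ hQ
    obtain ⟨j, hj⟩ := Function.ne_iff.1 hQ
    rw [Finset.prod_eq_zero (Finset.mem_univ j), zero_smul]
    simp [Ne.symm hj]
  · simp

variable (n) in
theorem exists_repr_le : ∃ B : ℝ, 1 ≤ B ∧ ∀ (u : Fin n → ℂ) (i : RealIndex n),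
    |(realBasis n).repr u i| ≤ B * ‖u‖ := by
  let L : RealIndex n → ((Fin n → ℂ) →L[ℝ] ℝ) := fun i =>
    ((realBasis n).coord i).toContinuousLinearMap
  have h0 : 0 ≤ ∑ i, ‖L i‖ := Finset.sum_nonneg fun i _ => norm_nonneg (L i)
  refine ⟨1 + ∑ i, ‖L i‖, by linarith, fun u i => ?_⟩
  calc |(realBasis n).repr u i| = ‖L i u‖ := rfl
    _ ≤ ‖L i‖ * ‖u‖ := (L i).le_opNorm u
    _ ≤ _ := by
      gcongr
      have := Finset.single_le_sum (f := fun i => ‖L i‖) (fun i _ => norm_nonneg (L i))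
        (Finset.mem_univ i)
      linarith

variable (n k) in
theorem exists_norm_evalCoef_le : ∃ A : ℝ, 0 < A ∧ ∀ (c : Coef n k) (u : Fin k → Fin n → ℂ)
    (M : ℝ), (∀ j, ‖u j‖ ≤ M) → ‖evalCoef c u‖ ≤ A * M ^ k * ‖c‖ := by
  obtain ⟨B, hB, h⟩ := exists_repr_le n
  refine ⟨(Fintype.card (Fin k → RealIndex n) + 1) * B ^ k, by positivity, fun c u M hu => ?_⟩
  have h1 (Q : Fin k → RealIndex n) :
      ‖(∏ j, (realBasis n).repr (u j) (Q j)) • c Q‖ ≤ B ^ k * M ^ k * ‖c‖ := by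
    rw [norm_smul, Real.norm_eq_abs, Finset.abs_prod]
    have h2 : ∏ j, |(realBasis n).repr (u j) (Q j)| ≤ B ^ k * M ^ k := by
      calc ∏ j, |(realBasis n).repr (u j) (Q j)| ≤ ∏ _j : Fin k, (B * M) :=
          Finset.prod_le_prod (fun j _ => abs_nonneg _) fun j _ => (h _ _).trans (by
            gcongr; exact hu j)
        _ = B ^ k * M ^ k := by simp [mul_pow]
    exact mul_le_mul h2 (norm_le_pi_norm c Q) (norm_nonneg _)
      ((Finset.prod_nonneg fun j _ => abs_nonneg _).trans h2)
  have h0 : 0 ≤ B ^ k * M ^ k * ‖c‖ := by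
    rcases Nat.eq_zero_or_pos k with rfl | hk
    · simp
    · have := (norm_nonneg _).trans (hu ⟨0, hk⟩)
      positivity
  calc ‖evalCoef c u‖ ≤ ∑ _Q : Fin k → RealIndex n, B ^ k * M ^ k * ‖c‖ :=
        (norm_sum_le _ _).trans (Finset.sum_le_sum fun Q _ => h1 Q)
    _ = Fintype.card (Fin k → RealIndex n) * (B ^ k * M ^ k * ‖c‖) := by simp
    _ ≤ (Fintype.card (Fin k → RealIndex n) + 1) * (B ^ k * M ^ k * ‖c‖) := by
      gcongr; linarith
    _ = _ := by ring

variable [RiemannianBundle (fun x : X => TangentSpace 𝓘(ℝ, Fin n → ℂ) x)]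

/-- The pointwise norm controls the values on bounded vectors. The factor `√k!` undoes the
normalization of the pointwise norm, which sums over all multi-indices and not only the increasing
ones. -/
theorem norm_apply_le_pointNorm {p : X} (α : (TangentSpace 𝓘(ℝ, Fin n → ℂ) p) [⋀^Fin k]→ₗ[ℝ] ℂ)
    (v : Fin k → TangentSpace 𝓘(ℝ, Fin n → ℂ) p) {M : ℝ} (hM : 0 ≤ M)
    (hv : ∀ j, tangentNorm p (v j) ≤ M) :
    ‖α v‖ ≤ Fintype.card (Fin k → RealIndex n) * M ^ k * (√(Nat.factorial k) * pointNorm α) := by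
  set b := stdOrthonormalBasis ℝ (TangentSpace 𝓘(ℝ, Fin n → ℂ) p) with hb
  have h1 (Q : Fin k → RealIndex n) :
      ‖α (fun j => b (Q j))‖ ≤ √(Nat.factorial k) * pointNorm α := by
    have h2 : ‖α (fun j => b (Q j))‖ ^ 2 ≤ ∑ i : Fin k → RealIndex n, ‖α (fun j => b (i j))‖ ^ 2 :=
      Finset.single_le_sum (f := fun i : Fin k → RealIndex n => ‖α (fun j => b (i j))‖ ^ 2)
        (fun i _ => by positivity) (Finset.mem_univ Q)
    have h3 : √(Nat.factorial k) * pointNorm α =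
        √(∑ i : Fin k → RealIndex n, ‖α (fun j => b (i j))‖ ^ 2) := by
      rw [pointNorm, ← Real.sqrt_mul (by positivity), ← mul_assoc, mul_inv_cancel₀ (by positivity),
        one_mul]
      rfl
    rw [h3]
    exact Real.le_sqrt_of_sq_le h2
  have h4 (j : Fin k) (i : Fin (Module.finrank ℝ (TangentSpace 𝓘(ℝ, Fin n → ℂ) p))) :
      |b.toBasis.repr (v j) i| ≤ M := by
    rw [OrthonormalBasis.coe_toBasis_repr_apply, OrthonormalBasis.repr_apply_apply]
    refine (abs_real_inner_le_norm _ _).trans ?_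
    rw [b.norm_eq_one, one_mul]
    exact hv j
  rw [α.apply_eq_sum_basis b.toBasis v]
  calc _ ≤ ∑ _Q : Fin k → Fin (Module.finrank ℝ (TangentSpace 𝓘(ℝ, Fin n → ℂ) p)),
        M ^ k * (√(Nat.factorial k) * pointNorm α) := by
        refine (norm_sum_le _ _).trans (Finset.sum_le_sum fun Q _ => ?_)
        rw [norm_smul, Real.norm_eq_abs, Finset.abs_prod]
        have := pointNorm_nonneg α
        gcongr
        · calc ∏ j, |b.toBasis.repr (v j) (Q j)| ≤ ∏ _j : Fin k, M :=
              Finset.prod_le_prod (fun j _ => abs_nonneg _) fun j _ => h4 _ _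
            _ = M ^ k := by simp
        · simpa using h1 Q
    _ = Fintype.card (Fin k → RealIndex n) * (M ^ k * (√(Nat.factorial k) * pointNorm α)) := by
      rw [Finset.sum_const, Finset.card_univ, nsmul_eq_mul]
      rfl
    _ = _ := by ring

theorem pointNorm_le_of_forall {p : X} (α : (TangentSpace 𝓘(ℝ, Fin n → ℂ) p) [⋀^Fin k]→ₗ[ℝ] ℂ)
    {a : ℝ} (h : ∀ v : Fin k → TangentSpace 𝓘(ℝ, Fin n → ℂ) p, (∀ j, tangentNorm p (v j) ≤ 1) →
      ‖α v‖ ≤ a) :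
    pointNorm α ≤ √(Fintype.card (Fin k → RealIndex n)) * a := by
  have ha : 0 ≤ a := (norm_nonneg _).trans (h 0 fun j => by simp [tangentNorm])
  set b := stdOrthonormalBasis ℝ (TangentSpace 𝓘(ℝ, Fin n → ℂ) p) with hb
  have h1 : ∑ i : Fin k → RealIndex n, ‖α (fun j => b (i j))‖ ^ 2 ≤
      Fintype.card (Fin k → RealIndex n) * a ^ 2 := by
    calc _ ≤ ∑ _i : Fin k → RealIndex n, a ^ 2 := by
          refine Finset.sum_le_sum fun i _ => ?_
          gcongr
          exact h _ fun j => (b.norm_eq_one _).le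
      _ = _ := by simp
  rw [← Real.sqrt_sq ha, ← Real.sqrt_mul (by positivity), pointNorm]
  refine Real.sqrt_le_sqrt (le_trans ?_ h1)
  refine mul_le_of_le_one_left (by positivity) (inv_le_one_of_one_le₀ ?_)
  exact_mod_cast Nat.one_le_iff_ne_zero.2 (Nat.factorial_ne_zero k)

/-- In a good chart, the pointwise norm is comparable to the norm of the coefficients. -/
theorem GoodChart.exists_pointNorm_bounds {φ : X → ℝ} {x₀ : X} {R C : ℝ}
    (h : GoodChart (n := n) φ x₀ R C) (k : ℕ) :
    ∃ C' : ℝ, 0 < C' ∧ ∀ z ∈ Metric.closedBall (chartAt (Fin n → ℂ) x₀ x₀) (3 * R),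
      ∀ α : (TangentSpace 𝓘(ℝ, Fin n → ℂ) ((chartAt (Fin n → ℂ) x₀).symm z)) [⋀^Fin k]→ₗ[ℝ] ℂ,
        pointNorm α ≤ C' * ‖coefAt x₀ α‖ ∧ ‖coefAt x₀ α‖ ≤ C' * pointNorm α := by
  obtain ⟨A, hA, hA'⟩ := exists_norm_evalCoef_le n k
  have hC := h.const_pos
  set N : ℝ := ((Fintype.card (Fin k → RealIndex n) : ℕ) : ℝ)
  set m : ℝ := ∑ i, ‖realBasis n i‖ with hm
  have hm0 : 0 ≤ m := Finset.sum_nonneg fun i _ => norm_nonneg _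
  set C₁ := √N * (A * C ^ k)
  set C₂ := N * (C * m) ^ k * √(Nat.factorial k)
  have h1 : 0 ≤ C₁ := by positivity
  have h2 : 0 ≤ C₂ := by positivity
  refine ⟨C₁ + C₂ + 1, by linarith, fun z hz α => ⟨?_, ?_⟩⟩
  · have hp := (chartAt (Fin n → ℂ) x₀).map_target (h.subset hz)
    calc pointNorm α ≤ √N * (A * C ^ k * ‖coefAt x₀ α‖) := by
          refine pointNorm_le_of_forall α fun v hv => ?_
          have h3 : v = fun j => coordField x₀ (coords x₀ _ (v j)) _ := by
            funext j
            exact (coordField_coords hp (v j)).symm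
          rw [h3, apply_coordField]
          refine hA' _ _ C fun j => ?_
          refine (h.le_norm z hz _).trans ?_
          rw [coordField_coords hp]
          exact mul_le_of_le_one_right hC.le (hv j)
      _ = C₁ * ‖coefAt x₀ α‖ := by ring
      _ ≤ _ := by gcongr; linarith
  · have h0 := pointNorm_nonneg α
    calc ‖coefAt x₀ α‖ ≤ N * (C * m) ^ k * (√(Nat.factorial k) * pointNorm α) := by
          refine (pi_norm_le_iff_of_nonneg (by positivity)).2 fun P => ?_
          refine norm_apply_le_pointNorm α _ (by positivity) fun j => ?_
          refine (h.norm_le z hz _).trans ?_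
          gcongr
          exact Finset.single_le_sum (f := fun i => ‖realBasis n i‖) (fun i _ => norm_nonneg _)
            (Finset.mem_univ _)
      _ = C₂ * pointNorm α := by ring
      _ ≤ _ := by gcongr; linarith

end Coefficients
end HermitianManifold


/-! ### Comparison of norms of forms and of their coefficients -/

/-- No measurability is required, at the price of an inequality. -/
theorem MeasureTheory.eLpNorm_two_map_le {Y Z G : Type*} [MeasurableSpace Y] [MeasurableSpace Z]
    [NormedAddCommGroup G] (F : Z → G) (g : Y → Z) (μ : Measure Y) :
    eLpNorm F 2 (μ.map g) ≤ eLpNorm (F ∘ g) 2 μ := by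
  rw [eLpNorm_eq_lintegral_rpow_enorm_toReal (by norm_num) (by norm_num),
    eLpNorm_eq_lintegral_rpow_enorm_toReal (by norm_num) (by norm_num)]
  gcongr
  exact lintegral_map_le _ _

/-- The constant is squared so that its square root, `c`, is the factor between the norms. -/
theorem MeasureTheory.eLpNorm_two_le_of_measure_le {Y G : Type*} [MeasurableSpace Y]
    [NormedAddCommGroup G] (F : Y → G) {c : ℝ} {μ ν : Measure Y}
    (h : μ ≤ (ENNReal.ofReal c ^ 2) • ν) : eLpNorm F 2 μ ≤ ENNReal.ofReal c * eLpNorm F 2 ν := by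
  refine (eLpNorm_mono_measure F h).trans ?_
  rw [eLpNorm_smul_measure_of_ne_top (by norm_num), smul_eq_mul]
  gcongr
  rw [← ENNReal.rpow_natCast, ← ENNReal.rpow_mul]
  simp

theorem MeasureTheory.eLpNorm_two_le_mul_of_bound {Y G H : Type*} [MeasurableSpace Y]
    [NormedAddCommGroup G] [NormedAddCommGroup H] {F : Y → G} {F' : Y → H} {c : ℝ} {S : Set Y}
    (hS : MeasurableSet S) {μ : Measure Y} (h : ∀ y ∈ S, ‖F y‖ ≤ c * ‖F' y‖) :
    eLpNorm F 2 (μ.restrict S) ≤ ENNReal.ofReal c * eLpNorm F' 2 (μ.restrict S) :=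
  eLpNorm_le_mul_eLpNorm_of_ae_le_mul ((ae_restrict_mem hS).mono h) 2

namespace HermitianManifold

section L2Comparison

variable {n : ℕ} {X : Type*} [TopologicalSpace X] [ChartedSpace (Fin n → ℂ) X]
  [IsManifold 𝓘(ℂ, Fin n → ℂ) ω X] {k : ℕ}
  [RiemannianBundle (fun x : X => TangentSpace 𝓘(ℝ, Fin n → ℂ) x)]
  [MeasurableSpace X] [BorelSpace X]

variable {φ : X → ℝ} {x₀ : X} {R C : ℝ}

/-- In a good chart, the norm of `L²_{p,q}(X, φ)` is comparable to the Euclidean `L²` norm of the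
coefficients. No measurability of the form is required. -/
theorem GoodChart.exists_l2Norm_bounds (hX : IsHermitianMetric n X)
    (h : GoodChart (n := n) φ x₀ R C) (k : ℕ) :
    ∃ c : ℝ, 0 < c ∧ ∀ S ⊆ Metric.closedBall (chartAt (Fin n → ℂ) x₀ x₀) (3 * R),
      MeasurableSet S → ∀ f : Form n X k,
        l2Norm φ ((chartAt (Fin n → ℂ) x₀).symm '' S) f ≤
          ENNReal.ofReal c * eLpNorm (coef x₀ f) 2 (volume.restrict S) ∧
        eLpNorm (coef x₀ f) 2 (volume.restrict S) ≤
          ENNReal.ofReal c * l2Norm φ ((chartAt (Fin n → ℂ) x₀).symm '' S) f := by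
  obtain ⟨C', hC', hb⟩ := h.exists_pointNorm_bounds k
  have hC := h.const_pos
  refine ⟨C * C', by positivity, fun S hS hm f => ⟨?_, ?_⟩⟩
  · calc l2Norm φ ((chartAt (Fin n → ℂ) x₀).symm '' S) f
        ≤ ENNReal.ofReal C * eLpNorm (fun x => pointNorm (f x)) 2
          ((volume.restrict S).map (chartAt (Fin n → ℂ) x₀).symm) :=
          eLpNorm_two_le_of_measure_le _ (h.weightedVolume_restrict_le hX hS hm)
      _ ≤ ENNReal.ofReal C * (ENNReal.ofReal C' * eLpNorm (coef x₀ f) 2 (volume.restrict S)) := by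
          gcongr ENNReal.ofReal C * ?_
          refine (eLpNorm_two_map_le _ _ _).trans ?_
          refine eLpNorm_two_le_mul_of_bound hm fun z hz => ?_
          rw [Function.comp_apply, Real.norm_of_nonneg (pointNorm_nonneg _)]
          exact (hb z (hS hz) _).1
      _ = _ := by rw [ENNReal.ofReal_mul hC.le, mul_assoc]
  · have hU := h.measurableSet_symm_image hS hm
    calc eLpNorm (coef x₀ f) 2 (volume.restrict S)
        ≤ ENNReal.ofReal C * eLpNorm (coef x₀ f) 2 (((weightedVolume n φ).restrict
          ((chartAt (Fin n → ℂ) x₀).symm '' S)).map (chartAt (Fin n → ℂ) x₀)) :=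
          eLpNorm_two_le_of_measure_le _ (h.volume_restrict_le hS hm)
      _ ≤ ENNReal.ofReal C * (ENNReal.ofReal C' * l2Norm φ
          ((chartAt (Fin n → ℂ) x₀).symm '' S) f) := by
          gcongr ENNReal.ofReal C * ?_
          refine (eLpNorm_two_map_le _ _ _).trans ?_
          refine eLpNorm_two_le_mul_of_bound hU ?_
          rintro _ ⟨z, hz, rfl⟩
          rw [Function.comp_apply, Real.norm_of_nonneg (pointNorm_nonneg _),
            (chartAt (Fin n → ℂ) x₀).right_inv (h.subset (hS hz))]
          exact (hb z (hS hz) _).2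
      _ = _ := by rw [ENNReal.ofReal_mul hC.le, mul_assoc]

/-- Measurability of forms is almost everywhere measurability for the volume of `X`; it passes to
the chart because null sets for the volume are Lebesgue null sets in the chart. -/
theorem GoodChart.aestronglyMeasurable_coef
    (h : GoodChart (n := n) φ x₀ R C) {f : Form n X k} (hf : IsMeasurableForm f)
    {S : Set (Fin n → ℂ)} (hS : S ⊆ Metric.closedBall (chartAt (Fin n → ℂ) x₀ x₀) (3 * R))
    (hm : MeasurableSet S) : AEStronglyMeasurable (coef x₀ f) (volume.restrict S) := by
  refine (aemeasurable_pi_iff.2 fun P => ?_).aestronglyMeasurable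
  have hae : AEMeasurable (chartAt (Fin n → ℂ) x₀).symm (volume.restrict S) :=
    aemeasurable_chart_symm x₀ (hS.trans h.subset) hm
  refine AEMeasurable.comp_aemeasurable
    (g := fun x => f x (fun j => coordField x₀ (realBasis n (P j)) x)) ?_ hae
  refine (hf x₀ fun j => realBasis n (P j)).mono_ac ?_
  refine Measure.AbsolutelyContinuous.mk fun E hE h0 => ?_
  have hs : MeasurableSet (chartAt (Fin n → ℂ) x₀).source :=
    (chartAt (Fin n → ℂ) x₀).open_source.measurableSet
  rw [Measure.restrict_apply' hs] at h0
  rw [Measure.map_apply_of_aemeasurable hae hE, Measure.restrict_apply' hm, inter_comm]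
  have hSE : MeasurableSet (S ∩ (chartAt (Fin n → ℂ) x₀).symm ⁻¹' E) :=
    ((chartAt (Fin n → ℂ) x₀).continuousOn_symm.mono
      (hS.trans h.subset)).measurableSet_inter_preimage hm hE
  refine le_antisymm ((h.volume_le_weightedVolume_symm_image (inter_subset_left.trans hS)
    hSE).trans ?_) zero_le
  have h1 : weightedVolume n φ ((chartAt (Fin n → ℂ) x₀).symm ''
      (S ∩ (chartAt (Fin n → ℂ) x₀).symm ⁻¹' E)) = 0 := by
    refine withDensity_absolutelyContinuous _ _ (measure_mono_null ?_ h0)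
    rintro _ ⟨z, hz, rfl⟩
    exact ⟨hz.2, (chartAt (Fin n → ℂ) x₀).map_target (h.subset (hS hz.1))⟩
  rw [h1, mul_zero]

end L2Comparison
end HermitianManifold


/-! ### Composition with maps close to the identity -/

section CompositionNearIdentity

variable {E W : Type*} [NormedAddCommGroup E] [NormedSpace ℝ E] [FiniteDimensional ℝ E]
  [MeasurableSpace E] [BorelSpace E] [NormedAddCommGroup W] [NormedSpace ℝ W]

/-- A square-integrable function changes little in `L²` under composition with a map that is
uniformly close to the identity and does not concentrate measure. -/
theorem MeasureTheory.exists_eLpNorm_comp_sub_le (μ : Measure E) [μ.IsAddHaarMeasure]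
    {S B : Set E} (hSB : S ⊆ B) (hS : MeasurableSet S) (hB : MeasurableSet B)
    (hfin : μ S ≠ ⊤) {F : E → W} (hF : MemLp F 2 (μ.restrict B)) {ε : ℝ} (hε : 0 < ε) :
    ∃ η : ℝ, 0 < η ∧ ∀ ψ : E → E, AEMeasurable ψ (μ.restrict S) →
      (μ.restrict S).map ψ ≤ (ENNReal.ofReal 2 ^ 2) • μ.restrict B →
      (∀ z ∈ S, ‖ψ z - z‖ ≤ η) →
      eLpNorm (fun z => F (ψ z) - F z) 2 (μ.restrict S) ≤ ENNReal.ofReal ε := by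
  have hF' : MemLp (B.indicator F) 2 μ := (memLp_indicator_iff_restrict hB).2 hF
  -- a continuous approximation with compact support, which is uniformly continuous
  obtain ⟨g, hgc, hg1, hg2, -⟩ := hF'.exists_hasCompactSupport_eLpNorm_sub_le (by norm_num)
    (ε := ENNReal.ofReal (ε / 4)) (by simpa using hε)
  have hFg : eLpNorm (fun z => F z - g z) 2 (μ.restrict B) ≤ ENNReal.ofReal (ε / 4) := by
    refine le_trans (le_of_eq ?_) ((eLpNorm_restrict_le _ _ _ B).trans hg1)
    refine eLpNorm_congr_ae ?_
    filter_upwards [ae_restrict_mem hB] with z hz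
    simp [hz]
  have huc := hgc.uniformContinuous_of_continuous hg2
  set m : ℝ := (μ S).toReal ^ (1 / 2 : ℝ) with hm
  have hm0 : 0 ≤ m := by positivity
  obtain ⟨η, hη, hηg⟩ := Metric.uniformContinuous_iff.1 huc (ε / (4 * (m + 1))) (by positivity)
  refine ⟨η / 2, by positivity, fun ψ hψ hmap hclose => ?_⟩
  have hgm : AEStronglyMeasurable g (μ.restrict B) := hg2.aestronglyMeasurable
  have hFgm : AEStronglyMeasurable (fun z => F z - g z) (μ.restrict B) := hF.1.sub hgm
  have hac : (μ.restrict S).map ψ ≪ μ.restrict B :=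
    (Measure.absolutelyContinuous_of_le hmap).trans Measure.smul_absolutelyContinuous
  have hres : μ.restrict S ≤ μ.restrict B := Measure.restrict_mono hSB le_rfl
  have h1m : AEStronglyMeasurable ((fun z => F z - g z) ∘ ψ) (μ.restrict S) :=
    (hFgm.mono_ac hac).comp_aemeasurable hψ
  have h1 : eLpNorm ((fun z => F z - g z) ∘ ψ) 2 (μ.restrict S) ≤ ENNReal.ofReal (ε / 2) := by
    rw [← eLpNorm_map_measure (hFgm.mono_ac hac) hψ]
    refine (eLpNorm_two_le_of_measure_le _ hmap).trans ?_
    calc _ ≤ ENNReal.ofReal 2 * ENNReal.ofReal (ε / 4) := by gcongr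
      _ = ENNReal.ofReal (ε / 2) := by rw [← ENNReal.ofReal_mul (by norm_num)]; congr 1; ring
  have h2m : AEStronglyMeasurable (fun z => g (ψ z) - g z) (μ.restrict S) :=
    (hg2.comp_aestronglyMeasurable hψ.aestronglyMeasurable).sub hg2.aestronglyMeasurable
  have h2 : eLpNorm (fun z => g (ψ z) - g z) 2 (μ.restrict S) ≤ ENNReal.ofReal (ε / 4) := by
    have hb : ∀ᵐ z ∂μ.restrict S, ‖g (ψ z) - g z‖ ≤ ε / (4 * (m + 1)) := by
      filter_upwards [ae_restrict_mem hS] with z hz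
      rw [← dist_eq_norm]
      refine (hηg ?_).le
      rw [dist_eq_norm]
      have := hclose z hz
      linarith
    refine (eLpNorm_le_of_ae_bound hb).trans ?_
    rw [Measure.restrict_apply_univ]
    have h3 : μ S ^ (ENNReal.toReal 2)⁻¹ = ENNReal.ofReal m := by
      rw [hm, ← ENNReal.ofReal_rpow_of_nonneg ENNReal.toReal_nonneg (by norm_num),
        ENNReal.ofReal_toReal hfin]
      norm_num
    rw [h3, ← ENNReal.ofReal_mul hm0]
    refine ENNReal.ofReal_le_ofReal ?_
    calc m * (ε / (4 * (m + 1))) = (ε / 4) * (m / (m + 1)) := by field_simp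
      _ ≤ (ε / 4) * 1 := by
        gcongr
        rw [div_le_one (by positivity)]
        linarith
      _ = ε / 4 := mul_one _
  have h3 : eLpNorm (fun z => F z - g z) 2 (μ.restrict S) ≤ ENNReal.ofReal (ε / 4) :=
    (eLpNorm_mono_measure _ hres).trans hFg
  have hsplit : (fun z => F (ψ z) - F z) =
      ((fun z => F z - g z) ∘ ψ + fun z => g (ψ z) - g z) - fun z => F z - g z := by
    funext z
    simp only [Pi.sub_apply, Pi.add_apply, Function.comp_apply]
    abel
  rw [hsplit]
  calc _ ≤ eLpNorm ((fun z => F z - g z) ∘ ψ + fun z => g (ψ z) - g z) 2 (μ.restrict S) +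
        eLpNorm (fun z => F z - g z) 2 (μ.restrict S) :=
        eLpNorm_sub_le (h1m.add h2m) (hFgm.mono_measure hres) (by norm_num)
    _ ≤ (ENNReal.ofReal (ε / 2) + ENNReal.ofReal (ε / 4)) + ENNReal.ofReal (ε / 4) := by
        gcongr
        exact (eLpNorm_add_le h1m h2m (by norm_num)).trans (by gcongr)
    _ = ENNReal.ofReal ε := by
        rw [← ENNReal.ofReal_add (by positivity) (by positivity),
          ← ENNReal.ofReal_add (by positivity) (by positivity)]
        congr 1
        ring

/-- A map which is injective and close to the identity in `C¹` does not concentrate measure. -/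
theorem MeasureTheory.exists_map_restrict_le (μ : Measure E) [μ.IsAddHaarMeasure] :
    ∃ η : ℝ, 0 < η ∧ ∀ (S B : Set E) (ψ : E → E), MeasurableSet S → MeasurableSet B →
      MapsTo ψ S B → InjOn ψ S → (∀ z ∈ S, DifferentiableAt ℝ ψ z) →
      (∀ z ∈ S, ‖fderiv ℝ ψ z - ContinuousLinearMap.id ℝ E‖ ≤ η) →
      AEMeasurable ψ (μ.restrict S) ∧
      (μ.restrict S).map ψ ≤ (ENNReal.ofReal 2 ^ 2) • μ.restrict B := by
  have hdet : ContinuousAt (fun L : E →L[ℝ] E => |L.det|) (ContinuousLinearMap.id ℝ E) :=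
    (ContinuousLinearMap.continuous_det.abs).continuousAt
  -- the bound `1 / 4` on the Jacobian gives the factor `2` between the `L²` norms
  have h1 : ∀ᶠ L : E →L[ℝ] E in 𝓝 (ContinuousLinearMap.id ℝ E), (1 / 4 : ℝ) < |L.det| := by
    refine hdet.eventually (lt_mem_nhds ?_)
    have : (ContinuousLinearMap.id ℝ E).det = 1 := by
      simp [ContinuousLinearMap.det]
    show (1 / 4 : ℝ) < |(ContinuousLinearMap.id ℝ E).det|
    rw [this]
    norm_num
  obtain ⟨η, hη, hball⟩ := Metric.mem_nhds_iff.1 h1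
  refine ⟨η / 2, by positivity, fun S B ψ hS hB hmaps hinj hd hη' => ?_⟩
  have hae : AEMeasurable ψ (μ.restrict S) :=
    ContinuousOn.aemeasurable (fun z hz => (hd z hz).continuousAt.continuousWithinAt) hS
  refine ⟨hae, Measure.le_iff.2 fun T hT => ?_⟩
  have hcont : ContinuousOn ψ S := fun z hz => (hd z hz).continuousAt.continuousWithinAt
  have hST : MeasurableSet (S ∩ ψ ⁻¹' T) := hcont.measurableSet_inter_preimage hS hT
  rw [Measure.map_apply_of_aemeasurable hae hT, Measure.restrict_apply' hS, inter_comm,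
    Measure.smul_apply, Measure.restrict_apply hT, smul_eq_mul]
  have h4 : (1 : ℝ≥0∞) = ENNReal.ofReal 2 ^ 2 * ENNReal.ofReal (1 / 4) := by
    rw [← ENNReal.ofReal_pow (by norm_num), ← ENNReal.ofReal_mul (by norm_num)]
    norm_num
  calc μ (S ∩ ψ ⁻¹' T) = ∫⁻ z in S ∩ ψ ⁻¹' T, 1 ∂μ := by rw [setLIntegral_const, one_mul]
    _ ≤ ∫⁻ z in S ∩ ψ ⁻¹' T, ENNReal.ofReal 2 ^ 2 *
        (ENNReal.ofReal |(fderiv ℝ ψ z).det| * 1) ∂μ := by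
      refine setLIntegral_mono' hST fun z hz => ?_
      rw [mul_one, h4]
      gcongr
      have : fderiv ℝ ψ z ∈ Metric.ball (ContinuousLinearMap.id ℝ E) η := by
        rw [Metric.mem_ball, dist_eq_norm]
        exact (hη' z hz.1).trans_lt (by linarith)
      exact (hball this).le
    _ = ENNReal.ofReal 2 ^ 2 * ∫⁻ z in S ∩ ψ ⁻¹' T, ENNReal.ofReal |(fderiv ℝ ψ z).det| * 1 ∂μ := by
      rw [lintegral_const_mul' _ _ (by simp)]
    _ = ENNReal.ofReal 2 ^ 2 * μ (ψ '' (S ∩ ψ ⁻¹' T)) := by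
      rw [← lintegral_image_eq_lintegral_abs_det_fderiv_mul μ hST
        (fun z hz => (hd z hz.1).hasFDerivAt.hasFDerivWithinAt) (hinj.mono inter_subset_left)
        (fun _ => 1), setLIntegral_const, one_mul]
    _ ≤ ENNReal.ofReal 2 ^ 2 * μ (T ∩ B) := by
      gcongr ENNReal.ofReal 2 ^ 2 * ?_
      refine measure_mono ?_
      rintro _ ⟨z, hz, rfl⟩
      exact ⟨hz.2, hmaps hz.1⟩

end CompositionNearIdentity

namespace HermitianManifold

variable (n k : ℕ) in
/-- Pulling back a multilinear form by a linear map close to the identity changes its coefficients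
little, relative to the norm of the coefficients. -/
theorem exists_norm_evalCoef_sub_le {ε : ℝ} (hε : 0 < ε) : ∃ η : ℝ, 0 < η ∧
    ∀ L : (Fin n → ℂ) →L[ℝ] (Fin n → ℂ), ‖L - ContinuousLinearMap.id ℝ (Fin n → ℂ)‖ ≤ η →
    ∀ (c : Coef n k) (P : Fin k → RealIndex n),
      ‖evalCoef c (fun j => L (realBasis n (P j))) - c P‖ ≤ ε * ‖c‖ := by
  let w : ((Fin n → ℂ) →L[ℝ] (Fin n → ℂ)) → (Fin k → RealIndex n) → (Fin k → RealIndex n) → ℝ :=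
    fun L P Q => ∏ j, (realBasis n).repr (L (realBasis n (P j))) (Q j)
  have hw (P Q) : Continuous fun L => w L P Q := by
    refine continuous_finsetProd _ fun j _ => ?_
    have h1 : Continuous fun u : Fin n → ℂ => (realBasis n).repr u (Q j) :=
      (((realBasis n).coord (Q j)).toContinuousLinearMap).continuous
    exact h1.comp ((ContinuousLinearMap.apply ℝ (Fin n → ℂ) (realBasis n (P j))).continuous)
  let s : ((Fin n → ℂ) →L[ℝ] (Fin n → ℂ)) → ℝ := fun L =>
    ∑ P, ∑ Q, |w L P Q - w (ContinuousLinearMap.id ℝ _) P Q|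
  have hs : Continuous s := continuous_finsetSum _ fun P _ => continuous_finsetSum _ fun Q _ =>
    ((hw P Q).sub continuous_const).abs
  have hs0 : s (ContinuousLinearMap.id ℝ _) = 0 := by simp [s]
  obtain ⟨η, hη, hball⟩ := Metric.mem_nhds_iff.1
    (hs.continuousAt.eventually (gt_mem_nhds (show s (ContinuousLinearMap.id ℝ _) < ε by
      rw [hs0]; exact hε)))
  refine ⟨η / 2, by positivity, fun L hL c P => ?_⟩
  have hsL : s L < ε := hball (by
    rw [Metric.mem_ball, dist_eq_norm]
    exact hL.trans_lt (by linarith))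
  have h1 : evalCoef c (fun j => L (realBasis n (P j))) - c P =
      ∑ Q, (w L P Q - w (ContinuousLinearMap.id ℝ _) P Q) • c Q := by
    have h2 := evalCoef_realBasis c P
    conv_lhs => rw [← h2]
    rw [evalCoef, evalCoef, ← Finset.sum_sub_distrib]
    refine Finset.sum_congr rfl fun Q _ => ?_
    rw [sub_smul]
    rfl
  rw [h1]
  calc _ ≤ ∑ Q, |w L P Q - w (ContinuousLinearMap.id ℝ _) P Q| * ‖c‖ := by
        refine (norm_sum_le _ _).trans (Finset.sum_le_sum fun Q _ => ?_)
        rw [norm_smul, Real.norm_eq_abs]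
        gcongr
        exact norm_le_pi_norm c Q
    _ = (∑ Q, |w L P Q - w (ContinuousLinearMap.id ℝ _) P Q|) * ‖c‖ := by rw [Finset.sum_mul]
    _ ≤ s L * ‖c‖ := by
        gcongr
        exact Finset.single_le_sum
          (f := fun P => ∑ Q, |w L P Q - w (ContinuousLinearMap.id ℝ _) P Q|)
          (fun P _ => Finset.sum_nonneg fun Q _ => abs_nonneg _) (Finset.mem_univ P)
    _ ≤ ε * ‖c‖ := by gcongr

end HermitianManifold


/-! ### Pull-back by variations in a good chart -/

theorem MeasureTheory.eLpNorm_two_comp_le_of_map_le {Y G : Type*} [MeasurableSpace Y]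
    [NormedAddCommGroup G] {μ ν : Measure Y} {c : ℝ} {ψ : Y → Y} (hψ : AEMeasurable ψ μ)
    (hmap : μ.map ψ ≤ (ENNReal.ofReal c ^ 2) • ν) {F : Y → G} (hF : AEStronglyMeasurable F ν) :
    AEStronglyMeasurable (F ∘ ψ) μ ∧ eLpNorm (F ∘ ψ) 2 μ ≤ ENNReal.ofReal c * eLpNorm F 2 ν := by
  have hac : μ.map ψ ≪ ν :=
    (Measure.absolutelyContinuous_of_le hmap).trans Measure.smul_absolutelyContinuous
  have hF' := hF.mono_ac hac
  refine ⟨hF'.comp_aemeasurable hψ, ?_⟩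
  rw [← eLpNorm_map_measure hF' hψ]
  exact eLpNorm_two_le_of_measure_le _ hmap

namespace HermitianManifold

section Pullback

variable {n : ℕ} {X : Type*} [TopologicalSpace X] [ChartedSpace (Fin n → ℂ) X]
  [IsManifold 𝓘(ℂ, Fin n → ℂ) ω X] {k : ℕ}

theorem coef_pullback_apply {x₀ : X} {Φ : X → X} {z : Fin n → ℂ}
    (hz : z ∈ (chartAt (Fin n → ℂ) x₀).target)
    (hΦ : MDifferentiableAt 𝓘(ℝ, Fin n → ℂ) 𝓘(ℝ, Fin n → ℂ) Φ ((chartAt (Fin n → ℂ) x₀).symm z))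
    (hΦz : Φ ((chartAt (Fin n → ℂ) x₀).symm z) ∈ (chartAt (Fin n → ℂ) x₀).source)
    (f : Form n X k) (P : Fin k → RealIndex n) :
    coef x₀ (f.pullback Φ) z P = evalCoef (coef x₀ f (coordMap x₀ Φ z))
      (fun j => fderiv ℝ (coordMap x₀ Φ) z (realBasis n (P j))) := by
  have hzz : chartAt (Fin n → ℂ) x₀ ((chartAt (Fin n → ℂ) x₀).symm z) = z :=
    (chartAt (Fin n → ℂ) x₀).right_inv hz
  have h1 := (mfderiv_coordField hΦ ((chartAt (Fin n → ℂ) x₀).map_target hz) hΦz).2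
  rw [hzz] at h1
  have h2 : (chartAt (Fin n → ℂ) x₀).symm (coordMap x₀ Φ z) =
      Φ ((chartAt (Fin n → ℂ) x₀).symm z) := (chartAt (Fin n → ℂ) x₀).left_inv hΦz
  have h3 : coef x₀ f (coordMap x₀ Φ z) =
      coefAt x₀ (f (Φ ((chartAt (Fin n → ℂ) x₀).symm z))) := by rw [coef, h2]
  rw [h3, ← apply_coordField]
  exact congrArg (f (Φ ((chartAt (Fin n → ℂ) x₀).symm z))) (funext fun j => h1 _)

theorem coef_sub (x₀ : X) (f g : Form n X k) (z : Fin n → ℂ) :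
    coef x₀ (f - g) z = coef x₀ f z - coef x₀ g z := rfl

theorem IsMeasurableForm.sub [RiemannianBundle (fun x : X => TangentSpace 𝓘(ℝ, Fin n → ℂ) x)]
    [MeasurableSpace X] {f g : Form n X k} (hf : IsMeasurableForm f) (hg : IsMeasurableForm g) :
    IsMeasurableForm (f - g) := fun x₀ u => (hf x₀ u).sub (hg x₀ u)

variable [RiemannianBundle (fun x : X => TangentSpace 𝓘(ℝ, Fin n → ℂ) x)]
  [MeasurableSpace X] [BorelSpace X]

theorem l2Norm_mono_set {φ : X → ℝ} {S T : Set X} (h : S ⊆ T) (f : Form n X k) :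
    l2Norm φ S f ≤ l2Norm φ T f :=
  eLpNorm_mono_measure _ (Measure.restrict_mono h le_rfl)

variable [IsContMDiffRiemannianBundle 𝓘(ℝ, Fin n → ℂ) ∞ (Fin n → ℂ)
    (fun x : X => TangentSpace 𝓘(ℝ, Fin n → ℂ) x)] [T2Space X] [ConnectedSpace X]

/-- The pull-back by a variation that is close to the identity changes a form little, locally; the
required closeness depends on the form `f` only through an approximation `g` of it. -/
theorem GoodChart.exists_l2Norm_pullback_sub_le (hX : IsHermitianMetric n X) {φ : X → ℝ} {x₀ : X}
    {R C : ℝ} (h : GoodChart (n := n) φ x₀ R C) (k : ℕ) :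
    ∃ K : ℝ, 0 < K ∧ ∀ g : Form n X k, IsMeasurableForm g → l2Norm φ univ g < ⊤ →
      ∀ ε : ℝ, 0 < ε → ∃ δ : ℝ, 0 < δ ∧ ∀ δ' ≤ δ, ∀ Ω : Set X, ∀ Φ ∈ Var (n := n) δ' Ω,
        ∀ f : Form n X k, IsMeasurableForm f →
          l2Norm φ ((chartAt (Fin n → ℂ) x₀).symm ''
              Metric.closedBall (chartAt (Fin n → ℂ) x₀ x₀) R) (f.pullback Φ - f) ≤
            ENNReal.ofReal ε * (1 + l2Norm φ univ f) +
              ENNReal.ofReal K * l2Norm φ univ (f - g) := by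
  obtain ⟨c, hc, hbd⟩ := h.exists_l2Norm_bounds hX k
  have hR := h.pos
  set z₀ := chartAt (Fin n → ℂ) x₀ x₀ with hz₀
  set S := Metric.closedBall z₀ R with hS
  set B := Metric.closedBall z₀ (2 * R) with hB
  have hSm : MeasurableSet S := Metric.isClosed_closedBall.measurableSet
  have hBm : MeasurableSet B := Metric.isClosed_closedBall.measurableSet
  have hSB : S ⊆ B := Metric.closedBall_subset_closedBall (by linarith)
  have hB3 : B ⊆ Metric.closedBall z₀ (3 * R) := Metric.closedBall_subset_closedBall (by linarith)
  have hnorm (f : Form n X k) : eLpNorm (coef x₀ f) 2 (volume.restrict B) ≤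
      ENNReal.ofReal c * l2Norm φ univ f :=
    (hbd B hB3 hBm f).2.trans (by
      gcongr ENNReal.ofReal c * ?_; exact l2Norm_mono_set (subset_univ _) f)
  refine ⟨3 * c ^ 2, by positivity, fun g hg hgt ε hε => ?_⟩
  have hGm : AEStronglyMeasurable (coef x₀ g) (volume.restrict B) :=
    h.aestronglyMeasurable_coef hg hB3 hBm
  have hGL : MemLp (coef x₀ g) 2 (volume.restrict B) :=
    ⟨hGm, (hnorm g).trans_lt (ENNReal.mul_lt_top ENNReal.ofReal_lt_top hgt)⟩
  obtain ⟨η₁, hη₁, H1⟩ := exists_map_restrict_le (volume : Measure (Fin n → ℂ))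
  obtain ⟨η₂, hη₂, H2⟩ := exists_eLpNorm_comp_sub_le volume hSB hSm hBm
    (isCompact_closedBall z₀ R).measure_lt_top.ne hGL (ε := ε / c) (by positivity)
  obtain ⟨η₃, hη₃, H3⟩ := exists_norm_evalCoef_sub_le n k (ε := ε / (2 * c ^ 2)) (by positivity)
  obtain ⟨δ, hδ, H⟩ := h.exists_coordMap_close hX (η := min R (min η₁ (min η₂ η₃)))
    (lt_min hR (lt_min hη₁ (lt_min hη₂ hη₃)))
  refine ⟨δ, hδ, fun δ' hδ' Ω Φ hΦ f hf => ?_⟩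
  set ψ := coordMap (n := n) x₀ Φ with hψ
  have hH (z) (hz : z ∈ S) := H δ' hδ' Ω Φ hΦ z (hSB hz)
  have hSt : S ⊆ (chartAt (Fin n → ℂ) x₀).target := (hSB.trans hB3).trans h.subset
  have hΦd (p : X) : MDifferentiableAt 𝓘(ℝ, Fin n → ℂ) 𝓘(ℝ, Fin n → ℂ) Φ p :=
    (Φ.contMDiff p).mdifferentiableAt (by simp)
  have hmaps : MapsTo ψ S B := fun z hz => by
    have h1 : ‖ψ z - z‖ ≤ R := (hH z hz).2.1.trans (min_le_left _ _)
    have h2 : ‖z - z₀‖ ≤ R := by simpa [hS, dist_eq_norm] using hz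
    rw [hB, Metric.mem_closedBall, dist_eq_norm]
    calc ‖ψ z - z₀‖ = ‖(ψ z - z) + (z - z₀)‖ := by congr 1; abel
      _ ≤ R + R := (norm_add_le _ _).trans (add_le_add h1 h2)
      _ = 2 * R := by ring
  have hinj : InjOn ψ S := fun z hz w hw hzw => by
    have h1 := (chartAt (Fin n → ℂ) x₀).injOn (hH z hz).1 (hH w hw).1 hzw
    exact (chartAt (Fin n → ℂ) x₀).symm.injOn (hSt hz) (hSt hw) (Φ.injective h1)
  have hdiff : ∀ z ∈ S, DifferentiableAt ℝ ψ z := fun z hz => by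
    have h1 := (mfderiv_coordField (hΦd _) ((chartAt (Fin n → ℂ) x₀).map_target (hSt hz))
      (hH z hz).1).1
    rwa [(chartAt (Fin n → ℂ) x₀).right_inv (hSt hz)] at h1
  obtain ⟨hψm, hmap⟩ := H1 S B ψ hSm hBm hmaps hinj hdiff fun z hz =>
    (hH z hz).2.2.trans ((min_le_right _ _).trans (min_le_left _ _))
  have hG := H2 ψ hψm hmap fun z hz => (hH z hz).2.1.trans
    ((min_le_right _ _).trans ((min_le_right _ _).trans (min_le_left _ _)))
  have hFm : AEStronglyMeasurable (coef x₀ f) (volume.restrict B) :=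
    h.aestronglyMeasurable_coef hf hB3 hBm
  have hDm : AEStronglyMeasurable (coef x₀ (f - g)) (volume.restrict B) :=
    h.aestronglyMeasurable_coef (hf.sub hg) hB3 hBm
  have hres : volume.restrict S ≤ volume.restrict B := Measure.restrict_mono hSB le_rfl
  obtain ⟨hFψm, hFψ⟩ := eLpNorm_two_comp_le_of_map_le hψm hmap hFm
  obtain ⟨hDψm, hDψ⟩ := eLpNorm_two_comp_le_of_map_le hψm hmap hDm
  obtain ⟨hGψm, -⟩ := eLpNorm_two_comp_le_of_map_le hψm hmap hGm
  -- the function `F ∘ ψ - F` of the coefficients `F`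
  have h1 : eLpNorm (fun z => coef x₀ f (ψ z) - coef x₀ f z) 2 (volume.restrict S) ≤
      ENNReal.ofReal (3 * c) * l2Norm φ univ (f - g) + ENNReal.ofReal (ε / c) := by
    have e1 : (fun z => coef x₀ f (ψ z) - coef x₀ f z) =
        (coef x₀ (f - g) ∘ ψ + fun z => coef x₀ g (ψ z) - coef x₀ g z) - coef x₀ (f - g) := by
      funext z
      simp only [Pi.sub_apply, Pi.add_apply, Function.comp_apply, coef_sub]
      abel
    have hGd : AEStronglyMeasurable (fun z => coef x₀ g (ψ z) - coef x₀ g z)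
        (volume.restrict S) := hGψm.sub (hGm.mono_measure hres)
    rw [e1]
    calc _ ≤ (ENNReal.ofReal 2 * (ENNReal.ofReal c * l2Norm φ univ (f - g)) +
          ENNReal.ofReal (ε / c)) + ENNReal.ofReal c * l2Norm φ univ (f - g) := by
          refine (eLpNorm_sub_le (hDψm.add hGd) (hDm.mono_measure hres) (by norm_num)).trans ?_
          refine add_le_add ((eLpNorm_add_le hDψm hGd (by norm_num)).trans
            (add_le_add (hDψ.trans ?_) hG)) ((eLpNorm_mono_measure _ hres).trans (hnorm _))
          gcongr ENNReal.ofReal 2 * ?_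
          exact hnorm _
      _ = ENNReal.ofReal (3 * c) * l2Norm φ univ (f - g) + ENNReal.ofReal (ε / c) := by
          rw [ENNReal.ofReal_mul (by norm_num), show (3 : ℝ) = 2 + 1 by norm_num,
            ENNReal.ofReal_add (by norm_num) (by norm_num), ENNReal.ofReal_one]
          ring
  -- the derivative of `ψ` acts on the coefficients as a small perturbation of the identity
  have h2 : eLpNorm (coef x₀ (f.pullback Φ - f)) 2 (volume.restrict S) ≤
      eLpNorm (fun z => coef x₀ f (ψ z) - coef x₀ f z) 2 (volume.restrict S) +
      ENNReal.ofReal (ε / (2 * c ^ 2)) * eLpNorm (coef x₀ f ∘ ψ) 2 (volume.restrict S) := by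
    have hd : AEStronglyMeasurable (fun z => coef x₀ f (ψ z) - coef x₀ f z) (volume.restrict S) :=
      hFψm.sub (hFm.mono_measure hres)
    rw [← eLpNorm_norm (fun z => coef x₀ f (ψ z) - coef x₀ f z),
      ← eLpNorm_norm (coef x₀ f ∘ ψ)]
    have e2 : ENNReal.ofReal (ε / (2 * c ^ 2)) *
        eLpNorm (fun z => ‖(coef x₀ f ∘ ψ) z‖) 2 (volume.restrict S) =
        eLpNorm ((ε / (2 * c ^ 2)) • fun z => ‖(coef x₀ f ∘ ψ) z‖) 2 (volume.restrict S) := by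
      rw [eLpNorm_const_smul, Real.enorm_of_nonneg (by positivity)]
    rw [e2]
    refine le_trans (eLpNorm_mono_ae_real ?_) (eLpNorm_add_le hd.norm
      (hFψm.norm.const_smul (ε / (2 * c ^ 2))) (by norm_num))
    filter_upwards [ae_restrict_mem hSm] with z hz
    refine (pi_norm_le_iff_of_nonneg (by
      simp only [Pi.add_apply, Pi.smul_apply, smul_eq_mul]; positivity)).2 fun P => ?_
    have e3 := H3 (fderiv ℝ ψ z) ((hH z hz).2.2.trans
      ((min_le_right _ _).trans ((min_le_right _ _).trans (min_le_right _ _))))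
      (coef x₀ f (ψ z)) P
    rw [coef_sub, Pi.sub_apply, coef_pullback_apply (hSt hz) (hΦd _) (hH z hz).1]
    have e4 : ‖coef x₀ f (ψ z) P - coef x₀ f z P‖ ≤ ‖coef x₀ f (ψ z) - coef x₀ f z‖ :=
      norm_le_pi_norm (coef x₀ f (ψ z) - coef x₀ f z) P
    calc _ = ‖(coef x₀ f (ψ z) P - coef x₀ f z P) +
          (evalCoef (coef x₀ f (ψ z)) (fun j => fderiv ℝ ψ z (realBasis n (P j))) -
            coef x₀ f (ψ z) P)‖ := by congr 1; ring
      _ ≤ _ := (norm_add_le _ _).trans (add_le_add e4 e3)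
  calc _ ≤ ENNReal.ofReal c * eLpNorm (coef x₀ (f.pullback Φ - f)) 2 (volume.restrict S) :=
        (hbd S (hSB.trans hB3) hSm _).1
    _ ≤ ENNReal.ofReal c * ((ENNReal.ofReal (3 * c) * l2Norm φ univ (f - g) +
          ENNReal.ofReal (ε / c)) + ENNReal.ofReal (ε / (2 * c ^ 2)) *
          (ENNReal.ofReal 2 * (ENNReal.ofReal c * l2Norm φ univ f))) := by
        gcongr ENNReal.ofReal c * ?_
        refine h2.trans (add_le_add h1 ?_)
        gcongr ENNReal.ofReal (ε / (2 * c ^ 2)) * ?_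
        refine hFψ.trans ?_
        gcongr ENNReal.ofReal 2 * ?_
        exact hnorm f
    _ = ENNReal.ofReal (c * (3 * c)) * l2Norm φ univ (f - g) + ENNReal.ofReal (c * (ε / c)) +
          ENNReal.ofReal (c * (ε / (2 * c ^ 2)) * 2 * c) * l2Norm φ univ f := by
        rw [ENNReal.ofReal_mul (by positivity : 0 ≤ c * (ε / (2 * c ^ 2)) * 2),
          ENNReal.ofReal_mul (by positivity : 0 ≤ c * (ε / (2 * c ^ 2))),
          ENNReal.ofReal_mul hc.le, ENNReal.ofReal_mul hc.le, ENNReal.ofReal_mul hc.le]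
        ring
    _ = _ := by
        rw [show c * (3 * c) = 3 * c ^ 2 by ring, show c * (ε / c) = ε by field_simp,
          show c * (ε / (2 * c ^ 2)) * 2 * c = ε by field_simp]
        ring

end Pullback
end HermitianManifold


/-! ### Consequences of total boundedness -/

theorem MeasureTheory.eLpNorm_two_add_measure_le {Y G : Type*} [MeasurableSpace Y]
    [NormedAddCommGroup G] (F : Y → G) (μ ν : Measure Y) :
    eLpNorm F 2 (μ + ν) ≤ eLpNorm F 2 μ + eLpNorm F 2 ν := by
  simp only [eLpNorm_eq_lintegral_rpow_enorm_toReal (p := 2) (by norm_num) (by norm_num),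
    lintegral_add_measure]
  exact ENNReal.rpow_add_le_add_rpow _ _ (by norm_num) (by norm_num)

namespace HermitianManifold

section Norms

variable {n : ℕ} {X : Type*} [TopologicalSpace X] [ChartedSpace (Fin n → ℂ) X]
  [IsManifold 𝓘(ℂ, Fin n → ℂ) ω X] {k : ℕ}
  [RiemannianBundle (fun x : X => TangentSpace 𝓘(ℝ, Fin n → ℂ) x)]
  [MeasurableSpace X] [BorelSpace X] {φ : X → ℝ}

theorem l2Norm_union_le (S T : Set X) (f : Form n X k) :
    l2Norm φ (S ∪ T) f ≤ l2Norm φ S f + l2Norm φ T f :=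
  (eLpNorm_mono_measure _ (Measure.restrict_union_le S T)).trans (eLpNorm_two_add_measure_le _ _ _)

theorem l2Norm_eq_zero {S : Set X} (hS : MeasurableSet S) {f : Form n X k}
    (h : ∀ x ∈ S, f x = 0) : l2Norm φ S f = 0 := by
  rw [l2Norm, eLpNorm_congr_ae (g := fun _ => (0 : ℝ)), eLpNorm_zero']
  filter_upwards [ae_restrict_mem hS] with x hx
  simp [h x hx, pointNorm]

theorem l2Norm_biUnion_le {ι : Type*} (t : Finset ι) (U : ι → Set X) (f : Form n X k) :
    l2Norm φ (⋃ i ∈ t, U i) f ≤ ∑ i ∈ t, l2Norm φ (U i) f := by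
  classical
  induction t using Finset.induction_on with
  | empty => simp [l2Norm]
  | insert a s ha ih =>
    rw [Finset.set_biUnion_insert, Finset.sum_insert ha]
    exact (l2Norm_union_le _ _ f).trans (by gcongr)

/-- The norm of a form that vanishes outside of a set covered by finitely many sets. -/
theorem l2Norm_univ_le_sum {ι : Type*} {t : Finset ι} {U : ι → Set X} {K : Set X}
    (hK : MeasurableSet K) (hKU : K ⊆ ⋃ i ∈ t, U i) {f : Form n X k} (hf : ∀ x ∉ K, f x = 0) :
    l2Norm φ univ f ≤ ∑ i ∈ t, l2Norm φ (U i) f := by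
  rw [← union_compl_self K]
  refine (l2Norm_union_le _ _ f).trans ?_
  rw [l2Norm_eq_zero hK.compl hf, add_zero]
  exact (l2Norm_mono_set hKU f).trans (l2Norm_biUnion_le t U f)

theorem pullback_eq_self_of_eventuallyEq {Φ : X → X} {x : X} (h : Φ =ᶠ[𝓝 x] id) (f : Form n X k) :
    f.pullback Φ x = f x := by
  have key : ∀ (y : X) (L : (Fin n → ℂ) →L[ℝ] (Fin n → ℂ)), y = x →
      L = ContinuousLinearMap.id ℝ (Fin n → ℂ) → (f y).compLinearMap L.toLinearMap = f x := by
    rintro y L rfl rfl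
    rfl
  refine key (Φ x) (mfderiv 𝓘(ℝ, Fin n → ℂ) 𝓘(ℝ, Fin n → ℂ) Φ x) h.eq_of_nhds ?_
  exact h.mfderiv_eq.trans mfderiv_id

variable [IsContMDiffRiemannianBundle 𝓘(ℝ, Fin n → ℂ) ∞ (Fin n → ℂ)
    (fun x : X => TangentSpace 𝓘(ℝ, Fin n → ℂ) x)]

/-- Compact sets are covered by finitely many balls in good charts. -/
theorem exists_finset_goodChart (hX : IsHermitianMetric n X) (hφ : Continuous φ) {K : Set X}
    (hK : IsCompact K) : ∃ (t : Finset X) (R C : X → ℝ), (∀ x, GoodChart (n := n) φ x (R x) (C x)) ∧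
      K ⊆ ⋃ x ∈ t, (chartAt (Fin n → ℂ) x).symm ''
        Metric.closedBall (chartAt (Fin n → ℂ) x x) (R x) := by
  choose R C h using fun x : X => exists_goodChart hX hφ x
  obtain ⟨t, -, ht⟩ := hK.elim_nhds_subcover (fun x => (chartAt (Fin n → ℂ) x).symm ''
    Metric.closedBall (chartAt (Fin n → ℂ) x x) (R x)) fun x _ => by
      have h1 := (chartAt (Fin n → ℂ) x).symm.image_mem_nhds (mem_chart_target _ x)
        (Metric.closedBall_mem_nhds (chartAt (Fin n → ℂ) x x) (h x).pos)
      rwa [(chartAt (Fin n → ℂ) x).left_inv (mem_chart_source _ x)] at h1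
  exact ⟨t, R, C, h, ht⟩

variable [SecondCountableTopology X] {p q : ℕ}

theorem dist_mk (f g : squareIntegrable n X φ p q) :
    ENNReal.ofReal (dist (SeparationQuotient.mk f) (SeparationQuotient.mk g)) =
      l2Norm φ univ (f.1 - g.1) := by
  rw [SeparationQuotient.dist_mk, dist_eq_norm]
  exact ENNReal.ofReal_toReal (f - g).2.2.2.ne

theorem norm_mk (f : squareIntegrable n X φ p q) :
    ENNReal.ofReal ‖SeparationQuotient.mk f‖ = l2Norm φ univ f.1 := by
  rw [SeparationQuotient.norm_mk]
  exact ENNReal.ofReal_toReal f.2.2.2.ne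

theorem TotallyBounded.exists_finite_net {A : Set (L2 n X φ p q)} (hA : TotallyBounded A) {ε : ℝ}
    (hε : 0 < ε) : ∃ t : Set (squareIntegrable n X φ p q), t.Finite ∧
      ∀ f, SeparationQuotient.mk f ∈ A → ∃ g ∈ t, l2Norm φ univ (f.1 - g.1) < ENNReal.ofReal ε := by
  obtain ⟨t, ht, hAt⟩ := Metric.totallyBounded_iff.1 hA ε hε
  refine ⟨Quotient.out '' t, ht.image _, fun f hf => ?_⟩
  obtain ⟨y, hy, hfy⟩ := mem_iUnion₂.1 (hAt hf)
  refine ⟨Quotient.out y, mem_image_of_mem _ hy, ?_⟩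
  have h1 : SeparationQuotient.mk (Quotient.out y) = y := Quotient.out_eq y
  rw [← dist_mk, h1]
  exact (ENNReal.ofReal_lt_ofReal_iff hε).2 hfy

/-- Total boundedness implies smallness near infinity, uniformly in the family. -/
theorem TotallyBounded.exists_l2Norm_compl_lt {A : Set (L2 n X φ p q)} (hA : TotallyBounded A)
    [T2Space X] {ε : ℝ} (hε : 0 < ε) : ∃ Ω : Set X, IsOpen Ω ∧ IsCompact (closure Ω) ∧
      ∀ f : squareIntegrable n X φ p q, SeparationQuotient.mk f ∈ A →
        l2Norm φ Ωᶜ f.1 < ENNReal.ofReal ε := by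
  have := ChartedSpace.locallyCompactSpace (Fin n → ℂ) X
  let K : CompactExhaustion X := default
  have hΩc (j : ℕ) : IsCompact (closure (interior (K j))) :=
    (K.isCompact j).closure_of_subset interior_subset
  obtain ⟨t, ht, hAt⟩ := TotallyBounded.exists_finite_net hA (half_pos hε)
  -- a single form has small norm outside of a large compact set, by continuity from above of the
  -- finite measure with density `|g|²`
  have key (g : squareIntegrable n X φ p q) : ∀ᶠ j in Filter.atTop,
      l2Norm φ (interior (K j))ᶜ g.1 < ENNReal.ofReal (ε / 2) := by
    let ν : Measure X := (weightedVolume n φ).withDensity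
      fun x => ‖pointNorm (g.1 x)‖ₑ ^ (2 : ℝ)
    have hν (S : Set X) (hS : MeasurableSet S) : l2Norm φ S g.1 = ν S ^ (1 / 2 : ℝ) := by
      rw [l2Norm, eLpNorm_eq_lintegral_rpow_enorm_toReal (by norm_num) (by norm_num),
        withDensity_apply _ hS]
      simp
    have hfin : ν univ ≠ ⊤ := by
      intro h
      have h1 := g.2.2.2
      rw [hν univ MeasurableSet.univ, h] at h1
      simp at h1
    have hanti : Antitone fun j => (interior (K j))ᶜ := fun i j hij =>
      compl_subset_compl.2 (interior_mono (K.subset hij))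
    have hinter : ⋂ j, (interior (K j))ᶜ = ∅ := by
      rw [← compl_iUnion, compl_empty_iff]
      refine eq_univ_of_forall fun x => ?_
      obtain ⟨j, hj⟩ := K.exists_mem x
      exact mem_iUnion.2 ⟨j + 1, K.subset_interior_succ j hj⟩
    have h1 := tendsto_measure_iInter_atTop (μ := ν)
      (fun j => isOpen_interior.measurableSet.compl.nullMeasurableSet) hanti
      ⟨0, ((measure_mono (subset_univ _)).trans_lt hfin.lt_top).ne⟩
    rw [hinter, measure_empty] at h1
    have h2 := h1.ennrpow_const (1 / 2 : ℝ)
    rw [ENNReal.zero_rpow_of_pos (by norm_num)] at h2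
    filter_upwards [h2.eventually (gt_mem_nhds (ENNReal.ofReal_pos.2 (half_pos hε)))] with j hj
    rw [hν _ isOpen_interior.measurableSet.compl]
    exact hj
  obtain ⟨j, hj⟩ := ((Filter.eventually_all_finite ht).2 fun g _ => key g).exists
  refine ⟨interior (K j), isOpen_interior, hΩc j, fun f hf => ?_⟩
  obtain ⟨g, hg, hfg⟩ := hAt f hf
  calc l2Norm φ (interior (K j))ᶜ f.1 = l2Norm φ (interior (K j))ᶜ ((f.1 - g.1) + g.1) := by
        rw [sub_add_cancel]
    _ ≤ l2Norm φ (interior (K j))ᶜ (f.1 - g.1) + l2Norm φ (interior (K j))ᶜ g.1 :=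
        l2Norm_add_le (f.2.1.sub g.2.1) g.2.1 φ _
    _ < ENNReal.ofReal (ε / 2) + ENNReal.ofReal (ε / 2) :=
        ENNReal.add_lt_add ((l2Norm_mono_set (subset_univ _) _).trans_lt hfg) (hj g hg)
    _ = ENNReal.ofReal ε := by
        rw [← ENNReal.ofReal_add (by positivity) (by positivity), add_halves]

theorem Def_subset_Var (δ : ℝ) (Ω : Set X) : Def (n := n) δ Ω ⊆ Var δ Ω := by
  rintro Φ ⟨F, -, hF, -, rfl, -⟩
  exact hF 1 ⟨zero_le_one, le_rfl⟩

/-- Total boundedness implies that pull-backs by variations which are close to the identity change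
the forms of the family uniformly little. -/
theorem TotallyBounded.exists_l2Norm_pullback_sub_lt [T2Space X] [ConnectedSpace X]
    (hX : IsHermitianMetric n X) (hφ : Continuous φ) {A : Set (L2 n X φ p q)}
    (hA : TotallyBounded A) {ε : ℝ} (hε : 0 < ε) {Ω : Set X} (hΩ : IsCompact (closure Ω)) :
    ∃ δ : ℝ, 0 < δ ∧ ∀ Φ ∈ Var (n := n) δ Ω,
      ∀ f : squareIntegrable n X φ p q, SeparationQuotient.mk f ∈ A →
        l2Norm φ univ (f.1.pullback Φ - f.1) < ENNReal.ofReal ε := by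
  obtain ⟨M, hM0, hM⟩ := (TotallyBounded.isBounded hA).exists_pos_norm_le
  obtain ⟨t, R, C, hgood, hcov⟩ := exists_finset_goodChart hX hφ hΩ
  choose K hK0 hK using fun x => (hgood x).exists_l2Norm_pullback_sub_le hX (p + q)
  have h_sum : 0 ≤ ∑ x ∈ t, K x := Finset.sum_nonneg fun x _ => (hK0 x).le
  set ρ := ε / (2 * (∑ x ∈ t, K x + 1)) with hρ
  have hρ0 : 0 < ρ := by positivity
  set ε' := ε / (2 * (t.card + 1) * (1 + M)) with hε'
  have hε'0 : 0 < ε' := by positivity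
  obtain ⟨s, hs, hAs⟩ := TotallyBounded.exists_finite_net hA hρ0
  -- one `δ` serves all charts and all elements of the finite net
  have hev : ∀ᶠ δ in 𝓝[>] (0 : ℝ), ∀ x ∈ t, ∀ g ∈ s, ∀ Φ ∈ Var (n := n) δ Ω,
      ∀ f : Form n X (p + q), IsMeasurableForm f →
        l2Norm φ ((chartAt (Fin n → ℂ) x).symm ''
            Metric.closedBall (chartAt (Fin n → ℂ) x x) (R x)) (f.pullback Φ - f) ≤
          ENNReal.ofReal ε' * (1 + l2Norm φ univ f) +
            ENNReal.ofReal (K x) * l2Norm φ univ (f - g.1) := by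
    refine (Filter.eventually_all_finset t).2 fun x _ =>
      (Filter.eventually_all_finite hs).2 fun g _ => ?_
    obtain ⟨δ, hδ, H⟩ := hK x g.1 g.2.1 g.2.2.2 ε' hε'0
    filter_upwards [Ioc_mem_nhdsGT hδ] with δ' hδ' Φ hΦ f hf
    exact H δ' hδ'.2 Ω Φ hΦ f hf
  obtain ⟨δ, hδ, hδ0⟩ := (hev.and self_mem_nhdsWithin).exists
  refine ⟨δ, hδ0, fun Φ hΦ f hf => ?_⟩
  obtain ⟨g, hg, hfg⟩ := hAs f hf
  have hzero : ∀ x ∉ closure Ω, (f.1.pullback Φ - f.1) x = 0 := fun x hx => by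
    have h1 : (Φ : X → X) =ᶠ[𝓝 x] id := by
      filter_upwards [isClosed_closure.isOpen_compl.mem_nhds hx] with y hy
      exact hΦ.2.1 y fun h => hy (subset_closure h)
    rw [Pi.sub_apply, pullback_eq_self_of_eventuallyEq h1, sub_self]
  have hfM : l2Norm φ univ f.1 ≤ ENNReal.ofReal M := by
    rw [← norm_mk]
    exact ENNReal.ofReal_le_ofReal (hM _ hf)
  calc l2Norm φ univ (f.1.pullback Φ - f.1)
      ≤ ∑ x ∈ t, l2Norm φ ((chartAt (Fin n → ℂ) x).symm ''
          Metric.closedBall (chartAt (Fin n → ℂ) x x) (R x)) (f.1.pullback Φ - f.1) :=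
        l2Norm_univ_le_sum isClosed_closure.measurableSet hcov hzero
    _ ≤ ∑ x ∈ t, ENNReal.ofReal (ε' * (1 + M) + K x * ρ) := by
        refine Finset.sum_le_sum fun x hx => (hδ x hx g hg Φ hΦ f.1 f.2.1).trans ?_
        have := (hK0 x).le
        rw [ENNReal.ofReal_add (by positivity) (by positivity), ENNReal.ofReal_mul hε'0.le,
          ENNReal.ofReal_mul (hK0 x).le, ENNReal.ofReal_add zero_le_one hM0.le, ENNReal.ofReal_one]
        gcongr
    _ = ENNReal.ofReal (t.card * (ε' * (1 + M)) + (∑ x ∈ t, K x) * ρ) := by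
        rw [← ENNReal.ofReal_sum_of_nonneg fun x _ => by
          have := (hK0 x).le
          positivity]
        rw [Finset.sum_add_distrib, Finset.sum_const, nsmul_eq_mul, Finset.sum_mul]
    _ < ENNReal.ofReal ε := by
        refine (ENNReal.ofReal_lt_ofReal_iff hε).2 ?_
        have h1 : t.card * (ε' * (1 + M)) < ε / 2 := by
          rw [hε', show (t.card : ℝ) * (ε / (2 * (t.card + 1) * (1 + M)) * (1 + M)) =
            ε / 2 * (t.card / (t.card + 1)) by field_simp]
          refine mul_lt_of_lt_one_right (half_pos hε) ?_
          rw [div_lt_one (by positivity)]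
          linarith
        have h2 : (∑ x ∈ t, K x) * ρ ≤ ε / 2 := by
          rw [hρ, show (∑ x ∈ t, K x) * (ε / (2 * (∑ x ∈ t, K x + 1))) =
            ε / 2 * ((∑ x ∈ t, K x) / (∑ x ∈ t, K x + 1)) by field_simp]
          refine mul_le_of_le_one_right (half_pos hε).le ?_
          rw [div_le_one (by positivity)]
          linarith
        linarith

end Norms
end HermitianManifold


/-! ### Distances along coordinate segments -/

namespace HermitianManifold

section Segments

variable {n : ℕ} {X : Type*} [TopologicalSpace X] [ChartedSpace (Fin n → ℂ) X]
  [IsManifold 𝓘(ℂ, Fin n → ℂ) ω X]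

theorem hasMFDerivAt_chart_symm_comp {x₀ : X} {c : ℝ → Fin n → ℂ} {c' : Fin n → ℂ} {t : ℝ}
    (hc : HasDerivAt c c' t) (ht : c t ∈ (chartAt (Fin n → ℂ) x₀).target) :
    MDifferentiableAt 𝓘(ℝ, ℝ) 𝓘(ℝ, Fin n → ℂ) (fun s => (chartAt (Fin n → ℂ) x₀).symm (c s)) t ∧
    mfderiv 𝓘(ℝ, ℝ) 𝓘(ℝ, Fin n → ℂ) (fun s => (chartAt (Fin n → ℂ) x₀).symm (c s)) t (1 : ℝ) =
      coordField x₀ c' ((chartAt (Fin n → ℂ) x₀).symm (c t)) := by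
  set p := (chartAt (Fin n → ℂ) x₀).symm (c t) with hp
  have hps : p ∈ (chartAt (Fin n → ℂ) x₀).source := (chartAt (Fin n → ℂ) x₀).map_target ht
  have hcp : chartAt (Fin n → ℂ) x₀ p = c t := (chartAt (Fin n → ℂ) x₀).right_inv ht
  have h1 : c t ∈ transSource x₀ p := ⟨ht, mem_chart_source _ p⟩
  have h2 : HasFDerivAt (trans x₀ p) ((fderiv ℂ (trans (n := n) x₀ p) (c t)).restrictScalars ℝ)
      (c t) := (differentiableAt_trans h1).hasFDerivAt.restrictScalars ℝ
  have h3 : HasDerivAt (trans (n := n) x₀ p ∘ c) (fderiv ℂ (trans (n := n) x₀ p) (c t) c') t :=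
    h2.comp_hasDerivAt t hc
  have hcont : ContinuousAt (fun s => (chartAt (Fin n → ℂ) x₀).symm (c s)) t :=
    ContinuousAt.comp (g := (chartAt (Fin n → ℂ) x₀).symm)
      ((chartAt (Fin n → ℂ) x₀).symm.continuousAt ht) hc.continuousAt
  have h4 : HasMFDerivAt 𝓘(ℝ, ℝ) 𝓘(ℝ, Fin n → ℂ)
      (fun s => (chartAt (Fin n → ℂ) x₀).symm (c s)) t
      (ContinuousLinearMap.toSpanSingleton ℝ (fderiv ℂ (trans (n := n) x₀ p) (c t) c')) := by
    refine ⟨hcont, ?_⟩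
    exact h3.hasFDerivAt.hasFDerivWithinAt
  refine ⟨h4.mdifferentiableAt, ?_⟩
  have h5 := (coordField_eq hps c').trans (tangentCoordChange_eq hps (mem_chart_source _ p) c')
  rw [hcp] at h5
  refine Eq.trans ?_ h5.symm
  exact (congrArg (fun L : ℝ →L[ℝ] (Fin n → ℂ) => L 1) h4.mfderiv).trans (one_smul ℝ _)

variable [RiemannianBundle (fun x : X => TangentSpace 𝓘(ℝ, Fin n → ℂ) x)]

attribute [local instance] tangentBundleENorm

variable {φ : X → ℝ} {x₀ : X} {R C : ℝ}

theorem GoodChart.riemDist_le (h : GoodChart (n := n) φ x₀ R C) {z w : Fin n → ℂ}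
    (hz : z ∈ Metric.closedBall (chartAt (Fin n → ℂ) x₀ x₀) (3 * R))
    (hw : w ∈ Metric.closedBall (chartAt (Fin n → ℂ) x₀ x₀) (3 * R)) :
    riemDist (n := n) ((chartAt (Fin n → ℂ) x₀).symm z) ((chartAt (Fin n → ℂ) x₀).symm w) ≤
      ENNReal.ofReal (C * ‖w - z‖) := by
  let c : ℝ → Fin n → ℂ := AffineMap.lineMap z w
  have hc (t : ℝ) : HasDerivAt c (w - z) t := AffineMap.hasDerivAt_lineMap
  have hcB (t : ℝ) (ht : t ∈ Icc (0 : ℝ) 1) :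
      c t ∈ Metric.closedBall (chartAt (Fin n → ℂ) x₀ x₀) (3 * R) :=
    (convex_closedBall _ _).lineMap_mem hz hw ht
  let γ : ℝ → X := fun s => (chartAt (Fin n → ℂ) x₀).symm (c s)
  have hγ : ContMDiffOn 𝓘(ℝ, ℝ) 𝓘(ℝ, Fin n → ℂ) 1 γ (Icc 0 1) := by
    have h1 : ContMDiffOn 𝓘(ℝ, Fin n → ℂ) 𝓘(ℝ, Fin n → ℂ) 1 (chartAt (Fin n → ℂ) x₀).symm
        (chartAt (Fin n → ℂ) x₀).target :=
      (contMDiffOn_chart_symm (I := 𝓘(ℝ, Fin n → ℂ)) (n := ∞)).of_le (by norm_num)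
    have h2 : ContDiff ℝ 1 fun t : ℝ => AffineMap.lineMap (k := ℝ) z w t := by
      simp only [AffineMap.lineMap_apply_module]
      fun_prop
    have h3 : ContMDiff 𝓘(ℝ, ℝ) 𝓘(ℝ, Fin n → ℂ) 1 c := h2.contMDiff
    exact h1.comp h3.contMDiffOn fun t ht => h.subset (hcB t ht)
  refine (Manifold.riemannianEDist_le_pathELength hγ
    (congrArg (chartAt (Fin n → ℂ) x₀).symm (AffineMap.lineMap_apply_zero (k := ℝ) z w))
    (congrArg (chartAt (Fin n → ℂ) x₀).symm (AffineMap.lineMap_apply_one (k := ℝ) z w))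
    zero_le_one).trans ?_
  rw [Manifold.pathELength_eq_lintegral_mfderiv_Ioo]
  calc _ ≤ ∫⁻ _t in Ioo (0 : ℝ) 1, ENNReal.ofReal (C * ‖w - z‖) := by
        refine setLIntegral_mono' measurableSet_Ioo fun t ht => ?_
        have ht' := hcB t (Ioo_subset_Icc_self ht)
        have h2 := (hasMFDerivAt_chart_symm_comp (hc t) (h.subset ht')).2
        refine (congrArg (fun v => ‖v‖ₑ) h2).trans_le ?_
        rw [← ofReal_norm]
        exact ENNReal.ofReal_le_ofReal (h.norm_le _ ht' _)
    _ = _ := by simp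

variable [IsContMDiffRiemannianBundle 𝓘(ℝ, Fin n → ℂ) ∞ (Fin n → ℂ)
    (fun x : X => TangentSpace 𝓘(ℝ, Fin n → ℂ) x)]

/-- The distance of two tangent vectors is at most the length of the segment between their
coordinates. -/
theorem GoodChart.riemDistTangent_le (hX : IsHermitianMetric n X)
    (h : GoodChart (n := n) φ x₀ R C) {M : ℝ} {ζ ζ' : (Fin n → ℂ) × (Fin n → ℂ)}
    (hζ : ζ.1 ∈ Metric.closedBall (chartAt (Fin n → ℂ) x₀ x₀) (3 * R)) (hM : ‖ζ.2‖ ≤ M)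
    (hζ' : ζ'.1 ∈ Metric.closedBall (chartAt (Fin n → ℂ) x₀ x₀) (3 * R)) (hM' : ‖ζ'.2‖ ≤ M) :
    riemDistTangent (n := n) (ofTcoords x₀ ζ) (ofTcoords x₀ ζ') ≤
      ENNReal.ofReal ((2 * C + C ^ 2 * M) * ‖ζ' - ζ‖) := by
  have hM0 : 0 ≤ M := (norm_nonneg _).trans hM
  let c : ℝ → (Fin n → ℂ) × (Fin n → ℂ) := AffineMap.lineMap ζ ζ'
  have hc (t : ℝ) : HasDerivAt c (ζ' - ζ) t := AffineMap.hasDerivAt_lineMap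
  have hcB (t : ℝ) (ht : t ∈ Icc (0 : ℝ) 1) :
      c t ∈ Metric.closedBall (chartAt (Fin n → ℂ) x₀ x₀) (3 * R) ×ˢ Metric.closedBall 0 M :=
    ((convex_closedBall _ _).prod (convex_closedBall _ _)).lineMap_mem
      (mem_prod.2 ⟨hζ, by simpa using hM⟩) (mem_prod.2 ⟨hζ', by simpa using hM'⟩) ht
  let γ : ℝ → TangentBundle 𝓘(ℝ, Fin n → ℂ) X := fun s => ofTcoords x₀ (c s)
  have hcs : ContMDiff 𝓘(ℝ, ℝ) 𝓘(ℝ, (Fin n → ℂ) × (Fin n → ℂ)) 1 c := by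
    have h2 : ContDiff ℝ 1 fun t : ℝ => AffineMap.lineMap (k := ℝ) ζ ζ' t := by
      simp only [AffineMap.lineMap_apply_module]
      fun_prop
    exact h2.contMDiff
  have hγ : ContMDiffOn 𝓘(ℝ, ℝ) 𝓘(ℝ, Fin n → ℂ).tangent 1 γ (Icc 0 1) :=
    (contMDiffOn_ofTcoords x₀).comp hcs.contMDiffOn fun t ht => h.subset (hcB t ht).1
  refine (Manifold.riemannianEDist_le_pathELength hγ
    (congrArg (ofTcoords x₀) (AffineMap.lineMap_apply_zero ζ ζ'))
    (congrArg (ofTcoords x₀) (AffineMap.lineMap_apply_one ζ ζ')) zero_le_one).trans ?_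
  rw [Manifold.pathELength_eq_lintegral_mfderiv_Ioo]
  calc _ ≤ ∫⁻ _t in Ioo (0 : ℝ) 1, ENNReal.ofReal ((2 * C + C ^ 2 * M) * ‖ζ' - ζ‖) := by
        refine setLIntegral_mono' measurableSet_Ioo fun t ht => ?_
        obtain ⟨ht1, ht2⟩ := hcB t (Ioo_subset_Icc_self ht)
        have htt : (c t).1 ∈ (chartAt (Fin n → ℂ) x₀).target := h.subset ht1
        have hd : MDifferentiableAt 𝓘(ℝ, ℝ) 𝓘(ℝ, Fin n → ℂ).tangent γ t :=
          (hγ.contMDiffAt (Icc_mem_nhds ht.1 ht.2)).mdifferentiableAt (by simp)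
        have hγt : tcoords x₀ (γ t) = c t := tcoords_ofTcoords htt
        obtain ⟨d, hd1, -, hd2⟩ := h.exists_velocity_bounds hX hM0 hd
          ((chartAt (Fin n → ℂ) x₀).map_target htt) (by rw [hγt]; exact ht1)
          (by rw [hγt]; simpa using ht2)
        have hev : (fun s => tcoords x₀ (γ s)) =ᶠ[𝓝 t] c := by
          filter_upwards [Icc_mem_nhds ht.1 ht.2] with s hs
          exact tcoords_ofTcoords (h.subset (hcB s hs).1)
        have hdd : d = ζ' - ζ := (hd1.congr_of_eventuallyEq hev.symm).unique (hc t)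
        rw [hdd] at hd2
        exact ENNReal.ofReal_le_ofReal hd2
    _ = _ := by simp

end Segments
end HermitianManifold


/-! ### Diffeomorphisms supported in a chart -/

section Shift

variable {E : Type*} [NormedAddCommGroup E] [NormedSpace ℝ E]

theorem hasFDerivAt_add_smul {χ : E → ℝ} (hχ : ContDiff ℝ ∞ χ) (s z : E) :
    HasFDerivAt (fun z => z + χ z • s)
      (ContinuousLinearMap.id ℝ E + (fderiv ℝ χ z).smulRight s) z :=
  (hasFDerivAt_id z).add (((hχ.differentiable (by simp)) z).hasFDerivAt.smul_const s)

/-- A small multiple of a compactly supported vector field of constant direction, added to the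
identity, is a diffeomorphism. -/
theorem exists_homeomorph_add_smul [CompleteSpace E] {χ : E → ℝ} (hχ : ContDiff ℝ ∞ χ) {L : ℝ}
    (hL : ∀ z, ‖fderiv ℝ χ z‖ ≤ L) {s : E} (hs : L * ‖s‖ ≤ 1 / 2) :
    ∃ e : E ≃ₜ E, (∀ z, e z = z + χ z • s) ∧ ContDiff ℝ ∞ e ∧ ContDiff ℝ ∞ e.symm := by
  have hT : ContDiff ℝ ∞ fun z => z + χ z • s := by fun_prop
  have happ : ApproximatesLinearOn (fun z => z + χ z • s)
      ((ContinuousLinearEquiv.refl ℝ E : E ≃L[ℝ] E) : E →L[ℝ] E) univ (1 / 2) := by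
    intro x _ y _
    have h1 : ‖χ x - χ y‖ ≤ L * ‖x - y‖ :=
      convex_univ.norm_image_sub_le_of_norm_fderiv_le
        (fun z _ => (hχ.differentiable (by simp)) z) (fun z _ => hL z) (mem_univ y) (mem_univ x)
    have h2 : (x + χ x • s) - (y + χ y • s) -
        ((ContinuousLinearEquiv.refl ℝ E : E ≃L[ℝ] E) : E →L[ℝ] E) (x - y) =
        (χ x - χ y) • s := by
      simp only [ContinuousLinearEquiv.coe_refl, ContinuousLinearMap.coe_id', id_eq, sub_smul]
      abel
    rw [h2, norm_smul]
    calc ‖χ x - χ y‖ * ‖s‖ ≤ (L * ‖x - y‖) * ‖s‖ := by gcongr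
      _ = (L * ‖s‖) * ‖x - y‖ := by ring
      _ ≤ 1 / 2 * ‖x - y‖ := by gcongr
      _ = _ := by norm_num
  have hc : Subsingleton E ∨ (1 / 2 : NNReal) <
      ‖((ContinuousLinearEquiv.refl ℝ E).symm : E →L[ℝ] E)‖₊⁻¹ := by
    rcases subsingleton_or_nontrivial E with h | h
    · exact Or.inl h
    · right
      have : ‖((ContinuousLinearEquiv.refl ℝ E).symm : E →L[ℝ] E)‖₊ = 1 := by
        ext
        exact ContinuousLinearMap.norm_id
      rw [this, inv_one]
      exact NNReal.half_lt_self one_ne_zero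
  let e : E ≃ₜ E := happ.toHomeomorph _ hc
  have he (z) : e z = z + χ z • s := rfl
  have hinv (z : E) : ∃ D : E ≃L[ℝ] E, (D : E →L[ℝ] E) =
      ContinuousLinearMap.id ℝ E + (fderiv ℝ χ z).smulRight s := by
    have hn : ‖-(fderiv ℝ χ z).smulRight s‖ < 1 := by
      rw [norm_neg, ContinuousLinearMap.norm_smulRight_apply]
      calc _ ≤ L * ‖s‖ := by gcongr; exact hL z
        _ < 1 := by linarith
    refine ⟨ContinuousLinearEquiv.unitsEquiv ℝ E (Units.oneSub _ hn), ?_⟩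
    ext v
    simp
  choose D hD using hinv
  refine ⟨e, he, hT, e.contDiff_symm (f₀' := D) (fun z => ?_) hT⟩
  rw [hD]
  exact hasFDerivAt_add_smul hχ s z

end Shift

namespace HermitianManifold

section Glue

variable {n : ℕ} {X : Type*} [TopologicalSpace X] [ChartedSpace (Fin n → ℂ) X]

open Classical in
/-- The self-map of `X` which is `T` in the chart at `x₀` and the identity elsewhere. -/
def glue (x₀ : X) (T : (Fin n → ℂ) → (Fin n → ℂ)) (x : X) : X :=
  if x ∈ (chartAt (Fin n → ℂ) x₀).source then
    (chartAt (Fin n → ℂ) x₀).symm (T (chartAt (Fin n → ℂ) x₀ x)) else x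

theorem glue_of_mem {x₀ x : X} (T : (Fin n → ℂ) → (Fin n → ℂ))
    (hx : x ∈ (chartAt (Fin n → ℂ) x₀).source) :
    glue x₀ T x = (chartAt (Fin n → ℂ) x₀).symm (T (chartAt (Fin n → ℂ) x₀ x)) := if_pos hx

theorem glue_of_notMem {x₀ x : X} (T : (Fin n → ℂ) → (Fin n → ℂ))
    (hx : x ∉ (chartAt (Fin n → ℂ) x₀).source) : glue x₀ T x = x := if_neg hx

theorem glue_of_notMem_image {x₀ x : X} {T : (Fin n → ℂ) → (Fin n → ℂ)} {K : Set (Fin n → ℂ)}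
    (hT : ∀ z ∉ K, T z = z) (hx : x ∉ (chartAt (Fin n → ℂ) x₀).symm '' K) : glue x₀ T x = x := by
  by_cases hxs : x ∈ (chartAt (Fin n → ℂ) x₀).source
  · rw [glue_of_mem T hxs, hT, (chartAt (Fin n → ℂ) x₀).left_inv hxs]
    exact fun h => hx ⟨_, h, (chartAt (Fin n → ℂ) x₀).left_inv hxs⟩
  · exact glue_of_notMem T hxs

theorem glue_symm {x₀ : X} (T : (Fin n → ℂ) → (Fin n → ℂ)) {z : Fin n → ℂ}
    (hz : z ∈ (chartAt (Fin n → ℂ) x₀).target) :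
    glue x₀ T ((chartAt (Fin n → ℂ) x₀).symm z) = (chartAt (Fin n → ℂ) x₀).symm (T z) := by
  rw [glue_of_mem T ((chartAt (Fin n → ℂ) x₀).map_target hz), (chartAt (Fin n → ℂ) x₀).right_inv hz]

theorem mapsTo_target {x₀ : X} {T : (Fin n → ℂ) → (Fin n → ℂ)} {K : Set (Fin n → ℂ)}
    (hK : K ⊆ (chartAt (Fin n → ℂ) x₀).target) (hT : ∀ z ∉ K, T z = z) (hm : MapsTo T K K) :
    MapsTo T (chartAt (Fin n → ℂ) x₀).target (chartAt (Fin n → ℂ) x₀).target := fun z hz => by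
  by_cases hzK : z ∈ K
  · exact hK (hm hzK)
  · rwa [hT z hzK]

theorem glue_glue {x₀ : X} {S T : (Fin n → ℂ) → (Fin n → ℂ)} {K : Set (Fin n → ℂ)}
    (hK : K ⊆ (chartAt (Fin n → ℂ) x₀).target) (hT : ∀ z ∉ K, T z = z) (hm : MapsTo T K K)
    (hST : ∀ z, S (T z) = z) (x : X) : glue x₀ S (glue x₀ T x) = x := by
  by_cases hxs : x ∈ (chartAt (Fin n → ℂ) x₀).source
  · rw [glue_of_mem T hxs,
      glue_symm S (mapsTo_target hK hT hm ((chartAt (Fin n → ℂ) x₀).map_source hxs)), hST,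
      (chartAt (Fin n → ℂ) x₀).left_inv hxs]
  · rw [glue_of_notMem T hxs, glue_of_notMem S hxs]

variable [IsManifold 𝓘(ℂ, Fin n → ℂ) ω X] [T2Space X]

/-- A smooth family of maps which are the identity outside of a compact subset `K` of the chart
gives a smooth family of self-maps of `X`. The image of `K` is closed since `X` is Hausdorff, so
near the points outside of the chart the glued map is the identity. -/
theorem contMDiffOn_glue {x₀ : X} {T : ℝ → (Fin n → ℂ) → (Fin n → ℂ)}
    (hT : ContDiff ℝ ∞ fun q : ℝ × (Fin n → ℂ) => T q.1 q.2) {J : Set ℝ} {K : Set (Fin n → ℂ)}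
    (hK : IsCompact K) (hKt : K ⊆ (chartAt (Fin n → ℂ) x₀).target)
    (hid : ∀ t, ∀ z ∉ K, T t z = z) (hm : ∀ t ∈ J, MapsTo (T t) K K) :
    ContMDiffOn (𝓘(ℝ, ℝ).prod 𝓘(ℝ, Fin n → ℂ)) 𝓘(ℝ, Fin n → ℂ) ∞
      (fun tx : ℝ × X => glue x₀ (T tx.1) tx.2) (J ×ˢ univ) := by
  rintro ⟨t, x⟩ ⟨ht, -⟩
  by_cases hx : x ∈ (chartAt (Fin n → ℂ) x₀).source
  · have hopen : (Prod.snd ⁻¹' (chartAt (Fin n → ℂ) x₀).source : Set (ℝ × X)) ∈ 𝓝 (t, x) :=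
      ((chartAt (Fin n → ℂ) x₀).open_source.preimage continuous_snd).mem_nhds hx
    have h1 : ContMDiffOn (𝓘(ℝ, ℝ).prod 𝓘(ℝ, Fin n → ℂ)) 𝓘(ℝ, ℝ × (Fin n → ℂ)) ∞
        (fun tx : ℝ × X => (tx.1, chartAt (Fin n → ℂ) x₀ tx.2))
        (Prod.snd ⁻¹' (chartAt (Fin n → ℂ) x₀).source) :=
      contMDiffOn_fst.prodMk_space
        ((contMDiffOn_chart (I := 𝓘(ℝ, Fin n → ℂ)) (n := ∞)).comp contMDiffOn_snd fun _ h => h)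
    have h2 : ContMDiffOn (𝓘(ℝ, ℝ).prod 𝓘(ℝ, Fin n → ℂ)) 𝓘(ℝ, Fin n → ℂ) ∞
        (fun tx : ℝ × X => T tx.1 (chartAt (Fin n → ℂ) x₀ tx.2))
        (Prod.snd ⁻¹' (chartAt (Fin n → ℂ) x₀).source) :=
      hT.contMDiff.comp_contMDiffOn h1
    have h3 : ContMDiffOn (𝓘(ℝ, ℝ).prod 𝓘(ℝ, Fin n → ℂ)) 𝓘(ℝ, Fin n → ℂ) ∞
        (fun tx : ℝ × X => (chartAt (Fin n → ℂ) x₀).symm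
          (T tx.1 (chartAt (Fin n → ℂ) x₀ tx.2)))
        (J ×ˢ (chartAt (Fin n → ℂ) x₀).source) :=
      (contMDiffOn_chart_symm (I := 𝓘(ℝ, Fin n → ℂ)) (n := ∞)).comp
        (h2.mono fun q hq => hq.2) fun q hq => mapsTo_target hKt (hid q.1) (hm q.1 hq.1)
          ((chartAt (Fin n → ℂ) x₀).map_source hq.2)
    have h4 := (h3 (t, x) ⟨ht, hx⟩).mono_of_mem_nhdsWithin (t := J ×ˢ univ) (by
      filter_upwards [self_mem_nhdsWithin, mem_nhdsWithin_of_mem_nhds hopen] with q hq1 hq2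
      exact ⟨hq1.1, hq2⟩)
    refine h4.congr_of_eventuallyEq ?_ (glue_of_mem _ hx)
    filter_upwards [mem_nhdsWithin_of_mem_nhds hopen] with q hq
    exact glue_of_mem _ hq
  · have hKc : IsClosed ((chartAt (Fin n → ℂ) x₀).symm '' K) :=
      (hK.image_of_continuousOn ((chartAt (Fin n → ℂ) x₀).continuousOn_symm.mono hKt)).isClosed
    have hxK : x ∉ (chartAt (Fin n → ℂ) x₀).symm '' K := by
      rintro ⟨z, hz, rfl⟩
      exact hx ((chartAt (Fin n → ℂ) x₀).map_target (hKt hz))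
    have hopen : (Prod.snd ⁻¹' ((chartAt (Fin n → ℂ) x₀).symm '' K)ᶜ : Set (ℝ × X)) ∈ 𝓝 (t, x) :=
      (hKc.isOpen_compl.preimage continuous_snd).mem_nhds hxK
    have h1 : ContMDiffAt (𝓘(ℝ, ℝ).prod 𝓘(ℝ, Fin n → ℂ)) 𝓘(ℝ, Fin n → ℂ) ∞
        (fun tx : ℝ × X => tx.2) (t, x) := contMDiffAt_snd
    refine (h1.congr_of_eventuallyEq ?_).contMDiffWithinAt
    filter_upwards [hopen] with q hq
    exact glue_of_notMem_image (hid q.1) hq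

theorem contMDiff_glue {x₀ : X} {T : (Fin n → ℂ) → (Fin n → ℂ)} (hT : ContDiff ℝ ∞ T)
    {K : Set (Fin n → ℂ)} (hK : IsCompact K) (hKt : K ⊆ (chartAt (Fin n → ℂ) x₀).target)
    (hid : ∀ z ∉ K, T z = z) (hm : MapsTo T K K) :
    ContMDiff 𝓘(ℝ, Fin n → ℂ) 𝓘(ℝ, Fin n → ℂ) ∞ (glue x₀ T) := by
  have h1 := contMDiffOn_glue (x₀ := x₀) (T := fun _ => T) (J := univ)
    (hT.comp contDiff_snd) hK hKt (fun _ => hid) (fun _ _ => hm)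
  rw [univ_prod_univ, contMDiffOn_univ] at h1
  exact h1.comp (contMDiff_const.prodMk contMDiff_id : ContMDiff 𝓘(ℝ, Fin n → ℂ)
    (𝓘(ℝ, ℝ).prod 𝓘(ℝ, Fin n → ℂ)) ∞ fun x : X => ((0 : ℝ), x))

theorem mapsTo_of_eq_self_compl {E : Type*} (e : E ≃ E) {K : Set E} (h : ∀ z ∉ K, e z = z) :
    MapsTo e K K := fun z hz => by
  by_contra hn
  exact hn (by rwa [e.injective (h _ hn)])

theorem symm_eq_self_compl {E : Type*} (e : E ≃ E) {K : Set E} (h : ∀ z ∉ K, e z = z) :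
    ∀ z ∉ K, e.symm z = z := fun z hz => by
  rw [Equiv.symm_apply_eq, h z hz]

theorem exists_diffeomorph_glue {x₀ : X} (e : (Fin n → ℂ) ≃ₜ (Fin n → ℂ)) (he : ContDiff ℝ ∞ e)
    (he' : ContDiff ℝ ∞ e.symm) {K : Set (Fin n → ℂ)} (hK : IsCompact K)
    (hKt : K ⊆ (chartAt (Fin n → ℂ) x₀).target) (hid : ∀ z ∉ K, e z = z) :
    ∃ Φ : X ≃ₘ^∞⟮𝓘(ℝ, Fin n → ℂ), 𝓘(ℝ, Fin n → ℂ)⟯ X, ∀ x, Φ x = glue x₀ e x := by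
  have hm : MapsTo e K K := mapsTo_of_eq_self_compl e.toEquiv hid
  have hid' : ∀ z ∉ K, e.symm z = z := symm_eq_self_compl e.toEquiv hid
  have hm' : MapsTo e.symm K K := mapsTo_of_eq_self_compl e.symm.toEquiv hid'
  exact ⟨{ toFun := glue x₀ e
           invFun := glue x₀ e.symm
           left_inv := glue_glue hKt hid hm e.symm_apply_apply
           right_inv := glue_glue hKt hid' hm' e.apply_symm_apply
           contMDiff_toFun := contMDiff_glue he hK hKt hid hm
           contMDiff_invFun := contMDiff_glue he' hK hKt hid' hm' }, fun _ => rfl⟩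

end Glue
end HermitianManifold


/-! ### Translations extend to deformations -/

namespace HermitianManifold

section Deformations

variable {n : ℕ} {X : Type*} [TopologicalSpace X] [ChartedSpace (Fin n → ℂ) X]
  [IsManifold 𝓘(ℂ, Fin n → ℂ) ω X]

theorem tangentMap_eq_self_of_eventuallyEq {Φ : X → X} {P : TangentBundle 𝓘(ℝ, Fin n → ℂ) X}
    (h : Φ =ᶠ[𝓝 P.proj] id) : tangentMap 𝓘(ℝ, Fin n → ℂ) 𝓘(ℝ, Fin n → ℂ) Φ P = P := by
  have key : ∀ (y : X) (L : (Fin n → ℂ) →L[ℝ] (Fin n → ℂ)), y = P.proj →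
      L = ContinuousLinearMap.id ℝ (Fin n → ℂ) →
      (⟨y, L P.snd⟩ : TangentBundle 𝓘(ℝ, Fin n → ℂ) X) = P := by
    rintro y L rfl rfl
    rfl
  exact key _ (mfderiv 𝓘(ℝ, Fin n → ℂ) 𝓘(ℝ, Fin n → ℂ) Φ P.proj) h.eq_of_nhds
    (h.mfderiv_eq.trans mfderiv_id)

/-- The tangent map in the coordinates of a chart. -/
theorem tangentMap_ofTcoords {x₀ : X} {Φ : X → X} {z : Fin n → ℂ}
    (hz : z ∈ (chartAt (Fin n → ℂ) x₀).target)
    (hΦ : MDifferentiableAt 𝓘(ℝ, Fin n → ℂ) 𝓘(ℝ, Fin n → ℂ) Φ ((chartAt (Fin n → ℂ) x₀).symm z))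
    (hΦz : Φ ((chartAt (Fin n → ℂ) x₀).symm z) ∈ (chartAt (Fin n → ℂ) x₀).source)
    (a : Fin n → ℂ) :
    tangentMap 𝓘(ℝ, Fin n → ℂ) 𝓘(ℝ, Fin n → ℂ) Φ (ofTcoords x₀ (z, a)) =
      ofTcoords x₀ (coordMap x₀ Φ z, fderiv ℝ (coordMap x₀ Φ) z a) := by
  have h1 := (mfderiv_coordField hΦ ((chartAt (Fin n → ℂ) x₀).map_target hz) hΦz).2 a
  rw [(chartAt (Fin n → ℂ) x₀).right_inv hz] at h1
  have h2 : Φ ((chartAt (Fin n → ℂ) x₀).symm z) =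
      (chartAt (Fin n → ℂ) x₀).symm (coordMap x₀ Φ z) :=
    ((chartAt (Fin n → ℂ) x₀).left_inv hΦz).symm
  have h3 : tangentMap 𝓘(ℝ, Fin n → ℂ) 𝓘(ℝ, Fin n → ℂ) Φ (ofTcoords x₀ (z, a)) =
      ⟨Φ ((chartAt (Fin n → ℂ) x₀).symm z), coordField x₀ (fderiv ℝ (coordMap x₀ Φ) z a)
        (Φ ((chartAt (Fin n → ℂ) x₀).symm z))⟩ :=
    congrArg (fun v : TangentSpace 𝓘(ℝ, Fin n → ℂ) (Φ ((chartAt (Fin n → ℂ) x₀).symm z)) =>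
      (⟨_, v⟩ : TangentBundle 𝓘(ℝ, Fin n → ℂ) X)) h1
  rw [h3, ofTcoords, h2]

theorem tangentMap_diffeomorph_symm (Φ : X ≃ₘ^∞⟮𝓘(ℝ, Fin n → ℂ), 𝓘(ℝ, Fin n → ℂ)⟯ X)
    (P : TangentBundle 𝓘(ℝ, Fin n → ℂ) X) :
    tangentMap 𝓘(ℝ, Fin n → ℂ) 𝓘(ℝ, Fin n → ℂ) Φ
      (tangentMap 𝓘(ℝ, Fin n → ℂ) 𝓘(ℝ, Fin n → ℂ) Φ.symm P) = P := by
  have h1 := tangentMap_comp_at (I := 𝓘(ℝ, Fin n → ℂ)) (I' := 𝓘(ℝ, Fin n → ℂ))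
    (I'' := 𝓘(ℝ, Fin n → ℂ)) (f := Φ.symm) (g := Φ) P
    ((Φ.contMDiff _).mdifferentiableAt (by simp)) ((Φ.symm.contMDiff _).mdifferentiableAt (by simp))
  rw [← h1]
  refine tangentMap_eq_self_of_eventuallyEq (Filter.Eventually.of_forall fun x => ?_)
  exact Φ.apply_symm_apply x

variable [RiemannianBundle (fun x : X => TangentSpace 𝓘(ℝ, Fin n → ℂ) x)]

theorem tangentNorm_mfderivWithin_Icc {g γ : ℝ → X} {t : ℝ} (ht : t ∈ Icc (0 : ℝ) 1)
    (h : EqOn g γ (Icc 0 1)) (hγ : MDifferentiableAt 𝓘(ℝ, ℝ) 𝓘(ℝ, Fin n → ℂ) γ t) :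
    tangentNorm (g t) (mfderivWithin 𝓘(ℝ, ℝ) 𝓘(ℝ, Fin n → ℂ) g (Icc 0 1) t (1 : ℝ)) =
      tangentNorm (γ t) (mfderiv 𝓘(ℝ, ℝ) 𝓘(ℝ, Fin n → ℂ) γ t (1 : ℝ)) := by
  have key : ∀ (y y' : X) (L L' : ℝ →L[ℝ] (Fin n → ℂ)), y = y' → L = L' →
      tangentNorm y (L 1 : Fin n → ℂ) = tangentNorm y' (L' 1 : Fin n → ℂ) := by
    rintro y y' L L' rfl rfl
    rfl
  refine key _ _ (mfderivWithin 𝓘(ℝ, ℝ) 𝓘(ℝ, Fin n → ℂ) g (Icc 0 1) t)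
    (mfderiv 𝓘(ℝ, ℝ) 𝓘(ℝ, Fin n → ℂ) γ t) (h ht) ?_
  have h1 : UniqueMDiffWithinAt 𝓘(ℝ, ℝ) (Icc (0 : ℝ) 1) t :=
    (uniqueDiffOn_Icc zero_lt_one t ht).uniqueMDiffWithinAt
  exact (mfderivWithin_congr (fun x hx => h hx) (h ht)).trans (mfderivWithin_eq_mfderiv h1 hγ)

attribute [local instance] tangentBundleENorm

variable [IsContMDiffRiemannianBundle 𝓘(ℝ, Fin n → ℂ) ∞ (Fin n → ℂ)
    (fun x : X => TangentSpace 𝓘(ℝ, Fin n → ℂ) x)] [T2Space X]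

variable {φ : X → ℝ} {x₀ : X} {R C : ℝ}

/-- A diffeomorphism that moves the points of a good chart by `χ • s`, with a cut-off function `χ`
and a small vector `s`, is a `δ`-variation. The distances between vectors and their images are
bounded by the lengths of segments in coordinates. -/
theorem GoodChart.mem_Var_of_eq_glue (hX : IsHermitianMetric n X)
    (h : GoodChart (n := n) φ x₀ R C) {r δ L : ℝ} (hr : r < 3 * R) {χ : (Fin n → ℂ) → ℝ}
    (hχ : ContDiff ℝ ∞ χ) (hχ1 : ∀ z, |χ z| ≤ 1) (hL : ∀ z, ‖fderiv ℝ χ z‖ ≤ L)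
    (hχ0 : ∀ z ∉ Metric.closedBall (chartAt (Fin n → ℂ) x₀ x₀) r, χ z = 0) {s : Fin n → ℂ}
    (hs : L * ‖s‖ ≤ 1 / 2)
    (hm : MapsTo (fun z => z + χ z • s) (Metric.closedBall (chartAt (Fin n → ℂ) x₀ x₀) r)
      (Metric.closedBall (chartAt (Fin n → ℂ) x₀ x₀) r))
    (hδ1 : C * ‖s‖ < δ) (hδ2 : (2 * C + C ^ 2 * (3 * C)) * ((1 + 2 * C * L) * ‖s‖) < 3 * δ)
    {Φ : X ≃ₘ^∞⟮𝓘(ℝ, Fin n → ℂ), 𝓘(ℝ, Fin n → ℂ)⟯ X}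
    (hΦ : ∀ x, Φ x = glue x₀ (fun z => z + χ z • s) x) :
    Φ ∈ Var (n := n) δ ((chartAt (Fin n → ℂ) x₀).symm ''
      Metric.ball (chartAt (Fin n → ℂ) x₀ x₀) (3 * R)) := by
  set K := Metric.closedBall (chartAt (Fin n → ℂ) x₀ x₀) r with hK
  set T : (Fin n → ℂ) → (Fin n → ℂ) := fun z => z + χ z • s with hT
  have hC : 0 < C := h.const_pos
  have hL0 : 0 ≤ L := (norm_nonneg _).trans (hL 0)
  have hδ : 0 < δ := lt_of_le_of_lt (by positivity) hδ1
  have hK3 : K ⊆ Metric.ball (chartAt (Fin n → ℂ) x₀ x₀) (3 * R) := Metric.closedBall_subset_ball hr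
  have hK3' := hK3.trans Metric.ball_subset_closedBall
  have hKt : K ⊆ (chartAt (Fin n → ℂ) x₀).target := hK3'.trans h.subset
  have hT0 : ∀ z ∉ K, T z = z := fun z hz => by simp [hT, hχ0 z hz]
  have hKc : IsClosed ((chartAt (Fin n → ℂ) x₀).symm '' K) :=
    ((isCompact_closedBall _ r).image_of_continuousOn
      ((chartAt (Fin n → ℂ) x₀).continuousOn_symm.mono hKt)).isClosed
  have hout : ∀ x ∉ (chartAt (Fin n → ℂ) x₀).symm '' K, Φ x = x := fun x hx => by
    rw [hΦ, glue_of_notMem_image hT0 hx]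
  have hout' : ∀ x ∉ (chartAt (Fin n → ℂ) x₀).symm '' K, Φ.symm x = x :=
    symm_eq_self_compl Φ.toEquiv hout
  have houtΩ : ∀ x ∉ (chartAt (Fin n → ℂ) x₀).symm ''
      Metric.ball (chartAt (Fin n → ℂ) x₀ x₀) (3 * R), Φ x = x := fun x hx =>
    hout x fun hxK => hx (image_mono hK3 hxK)
  have hd (p : X) : MDifferentiableAt 𝓘(ℝ, Fin n → ℂ) 𝓘(ℝ, Fin n → ℂ) Φ p :=
    (Φ.contMDiff p).mdifferentiableAt (by simp)
  have hΦs : ∀ z ∈ (chartAt (Fin n → ℂ) x₀).target, Φ ((chartAt (Fin n → ℂ) x₀).symm z) =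
      (chartAt (Fin n → ℂ) x₀).symm (T z) := fun z hz => (hΦ _).trans (glue_symm T hz)
  have hTt := mapsTo_target hKt hT0 hm
  have hcm : ∀ z ∈ (chartAt (Fin n → ℂ) x₀).target, coordMap x₀ Φ z = T z := fun z hz => by
    rw [coordMap, Function.comp_apply, Function.comp_apply, hΦs z hz,
      (chartAt (Fin n → ℂ) x₀).right_inv (hTt hz)]
  -- the tangent map in the chart
  have htan : ∀ z ∈ K, ∀ a : Fin n → ℂ,
      tangentMap 𝓘(ℝ, Fin n → ℂ) 𝓘(ℝ, Fin n → ℂ) Φ (ofTcoords x₀ (z, a)) =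
        ofTcoords x₀ (T z, a + fderiv ℝ χ z a • s) := fun z hz a => by
    rw [tangentMap_ofTcoords (hKt hz) (hd _) (by
      rw [hΦs z (hKt hz)]
      exact (chartAt (Fin n → ℂ) x₀).map_target (hTt (hKt hz)))]
    have h1 : coordMap x₀ Φ =ᶠ[𝓝 z] T := by
      filter_upwards [(chartAt (Fin n → ℂ) x₀).open_target.mem_nhds (hKt hz)] with w hw
      exact hcm w hw
    rw [h1.fderiv_eq, (hasFDerivAt_add_smul hχ s z).fderiv, h1.eq_of_nhds]
    rfl
  -- the bound `2 * C` leaves room for the preimages of unit vectors, whose coordinates may be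
  -- longer than those of unit vectors
  have hdist : ∀ z ∈ K, ∀ a : Fin n → ℂ, ‖a‖ ≤ 2 * C →
      riemDistTangent (n := n) (ofTcoords x₀ (z, a))
        (tangentMap 𝓘(ℝ, Fin n → ℂ) 𝓘(ℝ, Fin n → ℂ) Φ (ofTcoords x₀ (z, a))) ≤
      ENNReal.ofReal ((2 * C + C ^ 2 * (3 * C)) * ((1 + 2 * C * L) * ‖s‖)) := fun z hz a ha => by
    have h0 : ‖fderiv ℝ χ z a • s‖ ≤ 2 * C * (L * ‖s‖) := by
      rw [norm_smul]
      calc ‖fderiv ℝ χ z a‖ * ‖s‖ ≤ (L * (2 * C)) * ‖s‖ := by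
            gcongr
            exact (ContinuousLinearMap.le_opNorm _ _).trans (by gcongr; exact hL z)
        _ = _ := by ring
    have h1 : ‖a + fderiv ℝ χ z a • s‖ ≤ 3 * C := by
      refine (norm_add_le _ _).trans ?_
      have : 2 * C * (L * ‖s‖) ≤ 2 * C * (1 / 2) := by gcongr
      linarith
    rw [htan z hz a]
    refine (h.riemDistTangent_le hX (M := 3 * C) (ζ := (z, a))
      (ζ' := (T z, a + fderiv ℝ χ z a • s)) (hK3' hz) (by simpa using ha.trans (by linarith))
      (hK3' (hm hz)) h1).trans (ENNReal.ofReal_le_ofReal ?_)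
    gcongr
    have h2 : ((T z, a + fderiv ℝ χ z a • s) : (Fin n → ℂ) × (Fin n → ℂ)) - (z, a) =
        (χ z • s, fderiv ℝ χ z a • s) := by
      ext1 <;> simp [hT]
    rw [h2, Prod.norm_def]
    have h3 : ‖χ z • s‖ ≤ ‖s‖ := by
      rw [norm_smul, Real.norm_eq_abs]
      exact mul_le_of_le_one_left (norm_nonneg _) (hχ1 z)
    have h4 : 0 ≤ 2 * C * (L * ‖s‖) := by positivity
    refine max_le ?_ ?_ <;> nlinarith [norm_nonneg s]
  have hself (P : TangentBundle 𝓘(ℝ, Fin n → ℂ) X) : riemDistTangent (n := n) P P = 0 :=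
    Manifold.riemannianEDist_self
  have hcomm (P Q : TangentBundle 𝓘(ℝ, Fin n → ℂ) X) :
      riemDistTangent (n := n) P Q = riemDistTangent (n := n) Q P := Manifold.riemannianEDist_comm
  -- unit vectors have coordinates of norm at most `C`
  have hunit : ∀ x ∈ (chartAt (Fin n → ℂ) x₀).symm '' K, ∀ v : TangentSpace 𝓘(ℝ, Fin n → ℂ) x,
      tangentNorm x v = 1 → ‖coords x₀ x v‖ ≤ C := by
    rintro _ ⟨z, hz, rfl⟩ v hv
    have h1 := h.le_norm z (hK3' hz) (coords x₀ _ v)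
    rwa [coordField_coords ((chartAt (Fin n → ℂ) x₀).map_target (hKt hz)), hv, mul_one] at h1
  have hsrc : ∀ x ∈ (chartAt (Fin n → ℂ) x₀).symm '' K, x ∈ (chartAt (Fin n → ℂ) x₀).source := by
    rintro _ ⟨z, hz, rfl⟩
    exact (chartAt (Fin n → ℂ) x₀).map_target (hKt hz)
  have hpt : ∀ P : TangentBundle 𝓘(ℝ, Fin n → ℂ) X,
      P.proj ∈ (chartAt (Fin n → ℂ) x₀).symm '' K →
        ∃ z ∈ K, P = ofTcoords x₀ (z, coords x₀ _ P.snd) := by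
    intro P hP
    obtain ⟨z, hz, hzP⟩ := id hP
    have h1 : tcoords x₀ P = (z, coords x₀ _ P.snd) := by
      rw [tcoords, ← hzP, (chartAt (Fin n → ℂ) x₀).right_inv (hKt hz)]
    refine ⟨z, hz, ?_⟩
    rw [← h1, ofTcoords_tcoords (hsrc _ hP)]
  refine ⟨?_, houtΩ, ?_, ?_, ?_⟩
  · refine Subset.antisymm (mapsTo_of_eq_self_compl Φ.toEquiv houtΩ).image_subset fun y hy =>
      ⟨Φ.symm y, mapsTo_of_eq_self_compl Φ.toEquiv.symm (symm_eq_self_compl Φ.toEquiv houtΩ) hy,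
        Φ.apply_symm_apply y⟩
  · refine lt_of_le_of_lt (iSup_le fun x => ?_) ((ENNReal.ofReal_lt_ofReal_iff hδ).2 hδ1)
    by_cases hx : x ∈ (chartAt (Fin n → ℂ) x₀).symm '' K
    · obtain ⟨z, hz, rfl⟩ := hx
      rw [hΦs z (hKt hz)]
      refine (h.riemDist_le (hK3' hz) (hK3' (hm hz))).trans (ENNReal.ofReal_le_ofReal ?_)
      gcongr
      rw [hT, add_sub_cancel_left, norm_smul, Real.norm_eq_abs]
      exact mul_le_of_le_one_left (norm_nonneg _) (hχ1 z)
    · rw [hout x hx, riemDist, Manifold.riemannianEDist_self]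
      exact zero_le
  · refine lt_of_le_of_lt (iSup_le fun x => iSup_le fun v => iSup_le fun hv => ?_)
      ((ENNReal.ofReal_lt_ofReal_iff (by positivity)).2 hδ2)
    change riemDistTangent (n := n) (tangentMap 𝓘(ℝ, Fin n → ℂ) 𝓘(ℝ, Fin n → ℂ) Φ ⟨x, v⟩) ⟨x, v⟩ ≤ _
    by_cases hx : x ∈ (chartAt (Fin n → ℂ) x₀).symm '' K
    · obtain ⟨z, hz, hzP⟩ := hpt ⟨x, v⟩ hx
      rw [hcomm, hzP]
      exact hdist z hz _ ((hunit x hx v hv).trans (by linarith))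
    · rw [tangentMap_eq_self_of_eventuallyEq, hself]
      · exact zero_le
      · filter_upwards [hKc.isOpen_compl.mem_nhds hx] with y hy
        exact hout y hy
  · refine lt_of_le_of_lt (iSup_le fun y => iSup_le fun v => iSup_le fun hv => ?_)
      ((ENNReal.ofReal_lt_ofReal_iff (by positivity)).2 hδ2)
    set Q : TangentBundle 𝓘(ℝ, Fin n → ℂ) X := ⟨y, v⟩ with hQ
    change riemDistTangent (n := n) (tangentMap 𝓘(ℝ, Fin n → ℂ) 𝓘(ℝ, Fin n → ℂ) Φ.symm Q) Q ≤ _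
    by_cases hy : y ∈ (chartAt (Fin n → ℂ) x₀).symm '' K
    -- the estimate for the inverse follows from the one for `Φ` at the preimage `P` of `Q`; the
    -- coordinates `a` of `P` satisfy `‖a‖ ≤ 2 * C` since the derivative of `χ • s` has norm at most
    -- `1 / 2`
    · have hx : Φ.symm y ∈ (chartAt (Fin n → ℂ) x₀).symm '' K :=
        mapsTo_of_eq_self_compl Φ.toEquiv.symm hout' hy
      have hinv := tangentMap_diffeomorph_symm Φ Q
      set P := tangentMap 𝓘(ℝ, Fin n → ℂ) 𝓘(ℝ, Fin n → ℂ) Φ.symm Q with hP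
      obtain ⟨z, hz, hzP⟩ := hpt P hx
      set a := coords x₀ _ P.snd with ha
      have hb : coords x₀ y v = a + fderiv ℝ χ z a • s := by
        have h1 : tcoords x₀ Q = (T z, a + fderiv ℝ χ z a • s) := by
          rw [← hinv, hzP, htan z hz, tcoords_ofTcoords (hTt (hKt hz))]
        exact congrArg Prod.snd h1
      have hbn : ‖a + fderiv ℝ χ z a • s‖ ≤ C := by
        rw [← hb]
        exact hunit y hy v hv
      have han : ‖a‖ ≤ 2 * C := by
        have h1 : ‖fderiv ℝ χ z a • s‖ ≤ ‖a‖ / 2 := by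
          rw [norm_smul]
          calc ‖fderiv ℝ χ z a‖ * ‖s‖ ≤ (L * ‖a‖) * ‖s‖ := by
                gcongr
                exact (ContinuousLinearMap.le_opNorm _ _).trans (by gcongr; exact hL z)
            _ = (L * ‖s‖) * ‖a‖ := by ring
            _ ≤ 1 / 2 * ‖a‖ := by gcongr
            _ = _ := by ring
        have h2 : ‖a‖ ≤ ‖a + fderiv ℝ χ z a • s‖ + ‖fderiv ℝ χ z a • s‖ := by
          calc ‖a‖ = ‖(a + fderiv ℝ χ z a • s) - fderiv ℝ χ z a • s‖ := by rw [add_sub_cancel_right]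
            _ ≤ _ := norm_sub_le _ _
        linarith
      have h5 := hdist z hz a han
      rwa [← hzP, hinv] at h5
    · rw [tangentMap_eq_self_of_eventuallyEq, hself]
      · exact zero_le
      · filter_upwards [hKc.isOpen_compl.mem_nhds hy] with x hx
        exact hout' x hx

/-- In a good chart, all small translations of the ball of radius `2 * R` extend to
`δ`-deformations. -/
theorem GoodChart.exists_deformation (hX : IsHermitianMetric n X)
    (h : GoodChart (n := n) φ x₀ R C) {δ : ℝ} (hδ : 0 < δ) :
    ∃ s₀ : ℝ, 0 < s₀ ∧ ∀ s : Fin n → ℂ, ‖s‖ ≤ s₀ →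
      ∃ Φ ∈ Def (n := n) δ ((chartAt (Fin n → ℂ) x₀).symm ''
        Metric.ball (chartAt (Fin n → ℂ) x₀ x₀) (3 * R)),
      ∀ z ∈ Metric.closedBall (chartAt (Fin n → ℂ) x₀ x₀) (2 * R),
        Φ ((chartAt (Fin n → ℂ) x₀).symm z) = (chartAt (Fin n → ℂ) x₀).symm (z + s) := by
  have hR := h.pos
  have hC := h.const_pos
  set z₀ := chartAt (Fin n → ℂ) x₀ x₀ with hz₀
  -- equal to `1` where the map has to be a translation, with support well inside the chart ball
  let χ : ContDiffBump z₀ := ⟨2 * R, 5 / 2 * R, by linarith, by linarith⟩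
  have hχ : ContDiff ℝ ∞ χ := χ.contDiff
  have hχ1 (z) : |χ z| ≤ 1 := by
    rw [abs_of_nonneg χ.nonneg]
    exact χ.le_one
  have hχ0 : ∀ z ∉ Metric.closedBall z₀ (5 / 2 * R), χ z = 0 := fun z hz =>
    χ.zero_of_le_dist (not_le.1 hz).le
  obtain ⟨L, hL⟩ := (hχ.continuous_fderiv (by simp)).bounded_above_of_compact_support
    (χ.hasCompactSupport.fderiv ℝ)
  have hL0 : 0 ≤ L := (norm_nonneg _).trans (hL 0)
  set K := Metric.closedBall z₀ (5 / 2 * R) with hK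
  have hK3 : K ⊆ Metric.closedBall z₀ (3 * R) := Metric.closedBall_subset_closedBall (by linarith)
  have hKt : K ⊆ (chartAt (Fin n → ℂ) x₀).target := hK3.trans h.subset
  have hsmall (A b : ℝ) (hb : 0 < b) : ∀ᶠ r in 𝓝[>] (0 : ℝ), A * r < b := by
    have h1 : Filter.Tendsto (fun r : ℝ => A * r) (𝓝[>] 0) (𝓝 (A * 0)) :=
      ((continuous_const_mul A).tendsto 0).mono_left nhdsWithin_le_nhds
    rw [mul_zero] at h1
    exact h1.eventually (gt_mem_nhds hb)
  obtain ⟨s₀, ⟨⟨hs1, hs2⟩, hs3⟩, hs0⟩ := (((hsmall L (1 / 2) (by norm_num)).and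
    (hsmall C δ hδ)).and (hsmall ((2 * C + C ^ 2 * (3 * C)) * (1 + 2 * C * L)) (3 * δ)
      (by positivity))).and self_mem_nhdsWithin |>.exists
  refine ⟨s₀, hs0, ?_⟩
  have hLs (s : Fin n → ℂ) (hs : ‖s‖ ≤ s₀) : L * ‖s‖ ≤ 1 / 2 :=
    (mul_le_mul_of_nonneg_left hs hL0).trans hs1.le
  have hex (s : Fin n → ℂ) : ‖s‖ ≤ s₀ → MapsTo (fun z => z + χ z • s) K K ∧
      ∃ Φ : X ≃ₘ^∞⟮𝓘(ℝ, Fin n → ℂ), 𝓘(ℝ, Fin n → ℂ)⟯ X,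
        ∀ x, Φ x = glue x₀ (fun z => z + χ z • s) x := fun hs => by
    obtain ⟨e, he, he1, he2⟩ := exists_homeomorph_add_smul hχ hL (hLs s hs)
    have he' : (fun z => z + χ z • s) = e := funext fun z => (he z).symm
    have hid : ∀ z ∉ K, e z = z := fun z hz => by rw [he, hχ0 z hz, zero_smul, add_zero]
    rw [he']
    exact ⟨mapsTo_of_eq_self_compl e.toEquiv hid,
      exists_diffeomorph_glue e he1 he2 (isCompact_closedBall _ _) hKt hid⟩
  have hne : Nonempty (X ≃ₘ^∞⟮𝓘(ℝ, Fin n → ℂ), 𝓘(ℝ, Fin n → ℂ)⟯ X) := ⟨Diffeomorph.refl _ X ∞⟩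
  choose! hm D hD using hex
  intro s hs
  have hts : ∀ t ∈ Icc (0 : ℝ) 1, ‖t • s‖ ≤ s₀ := fun t ht => by
    rw [norm_smul, Real.norm_of_nonneg ht.1]
    exact (mul_le_of_le_one_left (norm_nonneg _) ht.2).trans hs
  have hsmooth : ContDiff ℝ ∞ fun q : ℝ × (Fin n → ℂ) => q.2 + χ q.2 • (q.1 • s) := by
    have h1 : ContDiff ℝ ∞ fun q : ℝ × (Fin n → ℂ) => χ q.2 := hχ.comp contDiff_snd
    fun_prop
  -- the deformation shifts by `t • s`
  refine ⟨D s, ⟨fun t => D (t • s), ?_, fun t ht => ?_, ?_, ?_, fun t ht x => ?_⟩, fun z hz => ?_⟩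
  · refine (contMDiffOn_glue (x₀ := x₀) (T := fun t z => z + χ z • (t • s)) (J := Icc 0 1) hsmooth
      (isCompact_closedBall z₀ (5 / 2 * R)) hKt (fun t z hz => ?_)
      (fun t ht => hm _ (hts t ht))).congr fun q hq => hD _ (hts q.1 hq.1) q.2
    rw [hχ0 z hz, zero_smul, add_zero]
  · have hn := hts t ht
    refine h.mem_Var_of_eq_glue hX (r := 5 / 2 * R) (by linarith) hχ hχ1 hL hχ0 (hLs _ hn)
      (hm _ hn) ?_ ?_ (hD _ hn)
    · exact (mul_le_mul_of_nonneg_left hn hC.le).trans_lt hs2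
    · rw [← mul_assoc]
      exact (mul_le_mul_of_nonneg_left hn (by positivity)).trans_lt hs3
  · refine Diffeomorph.ext fun x => ?_
    rw [hD _ (hts 0 ⟨le_rfl, zero_le_one⟩)]
    exact glue_of_notMem_image (n := n) (K := ∅) (fun z _ => by simp) (by simp)
  · exact congrArg D (one_smul ℝ s)
  · by_cases hx : x ∈ (chartAt (Fin n → ℂ) x₀).symm '' K
    · obtain ⟨z, hz, rfl⟩ := hx
      have hc : HasDerivAt (fun τ : ℝ => z + χ z • (τ • s)) (χ z • s) t := by
        have h1 : HasDerivAt (fun τ : ℝ => τ • s) ((1 : ℝ) • s) t := (hasDerivAt_id t).smul_const s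
        rw [one_smul] at h1
        exact (h1.const_smul (χ z)).const_add z
      have hB : z + χ z • (t • s) ∈ Metric.closedBall z₀ (3 * R) := hK3 (hm _ (hts t ht) hz)
      obtain ⟨h1, h2⟩ := hasMFDerivAt_chart_symm_comp (x₀ := x₀) hc (h.subset hB)
      have h3 := tangentNorm_mfderivWithin_Icc (g := fun τ => D (τ • s)
        ((chartAt (Fin n → ℂ) x₀).symm z)) ht (fun τ hτ =>
          (hD _ (hts τ hτ) _).trans (glue_symm _ (hKt hz))) h1
      rw [h3]
      refine (congrArg (tangentNorm _) h2).trans_le ((h.norm_le _ hB _).trans ?_)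
      calc C * ‖χ z • s‖ ≤ C * s₀ := by
            gcongr
            rw [norm_smul, Real.norm_eq_abs]
            exact (mul_le_of_le_one_left (norm_nonneg _) (hχ1 z)).trans hs
        _ ≤ 3 * δ := by linarith
    · have h3 := tangentNorm_mfderivWithin_Icc (g := fun τ => D (τ • s) x) (γ := fun _ => x) ht
        (fun τ hτ => (hD _ (hts τ hτ) _).trans (glue_of_notMem_image (n := n) (K := K)
          (fun z hz => by
          rw [hχ0 z hz, zero_smul, add_zero]) hx))
        (mdifferentiableAt_const (I := 𝓘(ℝ, ℝ)) (I' := 𝓘(ℝ, Fin n → ℂ)))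
      rw [h3, mfderiv_const]
      refine le_of_eq_of_le ?_ (by positivity : 0 ≤ 3 * δ)
      exact norm_zero
  · have hz3 : z ∈ Metric.closedBall z₀ (3 * R) :=
      Metric.closedBall_subset_closedBall (by linarith) hz
    rw [hD s hs, glue_symm _ (h.subset hz3), χ.one_of_mem_closedBall hz, one_smul]

end Deformations
end HermitianManifold


/-! ### Local averages -/

namespace MeasureTheory

section LocalAverage

variable {E W : Type*} [NormedAddCommGroup E] [NormedSpace ℝ E] [FiniteDimensional ℝ E]
  [MeasurableSpace E] [BorelSpace E] [NormedAddCommGroup W] [NormedSpace ℝ W] [CompleteSpace W]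

/-- The average, with weight `k` centred at `z`, of the restriction of `h` to `B`. -/
def localAverage (μ : Measure E) (B : Set E) (k : E → ℝ) (h : E → W) (z : E) : W :=
  ∫ w in B, k (w - z) • h w ∂μ

variable {μ : Measure E} {B S : Set E} {k : E → ℝ} {h : E → W}

theorem integrable_smul_of_bound (hk : Continuous k) {c : ℝ} (hc : ∀ w, ‖k w‖ ≤ c) {ν : Measure E}
    (hh : Integrable h ν) (z : E) : Integrable (fun w => k (w - z) • h w) ν :=
  hh.bdd_smul c (by fun_prop) (Filter.Eventually.of_forall fun w => hc (w - z))

theorem norm_localAverage_le {c : ℝ} (hc : ∀ w, ‖k w‖ ≤ c) (hh : IntegrableOn h B μ) (z : E) :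
    ‖localAverage μ B k h z‖ ≤ c * ∫ w in B, ‖h w‖ ∂μ := by
  rw [← integral_const_mul]
  refine norm_integral_le_of_norm_le (hh.norm.const_mul c) (Filter.Eventually.of_forall fun w => ?_)
  rw [norm_smul]
  gcongr
  exact hc _

theorem norm_localAverage_sub_le (hk : Continuous k) {c : ℝ} (hc : ∀ w, ‖k w‖ ≤ c) {σ : ℝ}
    {z z' : E}
    (hσ : ∀ w, ‖k (w - z) - k (w - z')‖ ≤ σ) (hh : IntegrableOn h B μ) :
    ‖localAverage μ B k h z - localAverage μ B k h z'‖ ≤ σ * ∫ w in B, ‖h w‖ ∂μ := by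
  rw [localAverage, localAverage, ← integral_sub (integrable_smul_of_bound hk hc hh z)
    (integrable_smul_of_bound hk hc hh z'), ← integral_const_mul]
  refine norm_integral_le_of_norm_le (hh.norm.const_mul σ) (Filter.Eventually.of_forall fun w => ?_)
  rw [← sub_smul, norm_smul]
  gcongr
  exact hσ w

theorem continuous_localAverage (hk : Continuous k) (hks : HasCompactSupport k)
    (hh : IntegrableOn h B μ) : Continuous (localAverage μ B k h) := by
  obtain ⟨c, hc⟩ := hk.bounded_above_of_compact_support hks
  have huc := hks.uniformContinuous_of_continuous hk
  set I := ∫ w in B, ‖h w‖ ∂μ with hI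
  have hI0 : 0 ≤ I := integral_nonneg fun w => norm_nonneg _
  refine Metric.continuous_iff.2 fun z ε hε => ?_
  obtain ⟨η, hη, H⟩ := Metric.uniformContinuous_iff.1 huc (ε / (I + 1)) (by positivity)
  refine ⟨η, hη, fun z' hz' => ?_⟩
  rw [dist_eq_norm]
  refine (norm_localAverage_sub_le hk hc (σ := ε / (I + 1)) (fun w => ?_) hh).trans_lt ?_
  · rw [← dist_eq_norm]
    refine (H ?_).le
    rwa [dist_sub_left]
  · rw [div_mul_eq_mul_div, div_lt_iff₀ (by positivity)]
    nlinarith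

theorem localAverage_congr {h' : E → W} (hh : h =ᵐ[μ.restrict B] h') (z : E) :
    localAverage μ B k h z = localAverage μ B k h' z := by
  refine integral_congr_ae ?_
  filter_upwards [hh] with w hw
  rw [hw]

variable [μ.IsAddHaarMeasure]

/-- A local average differs from the function by an average of the differences with its
translates. -/
theorem localAverage_sub_self (hk : Continuous k) (hks : HasCompactSupport k)
    (hk1 : ∫ s, k s ∂μ = 1) (hh : IntegrableOn h B μ) {z : E} (hz : ∀ w ∉ B, k (w - z) = 0) :
    localAverage μ B k h z - h z = ∫ s, k s • (h (z + s) - h z) ∂μ := by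
  obtain ⟨c, hc⟩ := hk.bounded_above_of_compact_support hks
  have h1 : localAverage μ B k h z = ∫ w, k (w - z) • h w ∂μ :=
    setIntegral_eq_integral_of_forall_compl_eq_zero fun w hw => by rw [hz w hw, zero_smul]
  have h2 : Integrable (fun w => k (w - z) • h w) μ := by
    refine (integrableOn_iff_integrable_of_support_subset fun w hw => ?_).1
      (integrable_smul_of_bound hk hc hh z)
    by_contra hwB
    exact hw (by simp [hz w hwB])
  have h3 : Integrable (fun w => k (w - z) • h z) μ :=
    ((integrable_of_integral_eq_one hk1).comp_sub_right z).smul_const (h z)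
  have h4 : h z = ∫ w, k (w - z) • h z ∂μ := by
    rw [integral_smul_const, integral_sub_right_eq_self (fun w => k w) z, hk1, one_smul]
  conv_lhs => rw [h1, h4, ← integral_sub h2 h3]
  rw [← integral_add_left_eq_self _ z]
  refine integral_congr_ae (Filter.Eventually.of_forall fun s => ?_)
  simp only [add_sub_cancel_left, smul_sub]

/-- Averages over small balls approximate, in `L²`, a function whose small translates are close
to it in `L²`: this is Minkowski's inequality, proved by Jensen's inequality and Tonelli's
theorem. -/
theorem eLpNorm_localAverage_sub_self_le_of_stronglyMeasurable (hk : Continuous k)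
    (hks : HasCompactSupport k) (hk0 : ∀ s, 0 ≤ k s) (hk1 : ∫ s, k s ∂μ = 1) {s₀ : ℝ}
    (hksupp : ∀ s, s₀ < ‖s‖ → k s = 0) (hh : IntegrableOn h B μ) (hm : StronglyMeasurable h)
    (hS : MeasurableSet S) (hSB : ∀ z ∈ S, ∀ w ∉ B, s₀ < ‖w - z‖) {a : ℝ≥0∞}
    (ha : ∀ s, ‖s‖ ≤ s₀ → eLpNorm (fun z => h (z + s) - h z) 2 (μ.restrict S) ≤ a) :
    eLpNorm (fun z => localAverage μ B k h z - h z) 2 (μ.restrict S) ≤ a := by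
  set ν : Measure E := μ.withDensity fun s => ENNReal.ofReal (k s) with hν
  have hkm : Measurable fun s => ENNReal.ofReal (k s) := by fun_prop
  have hν1 : IsProbabilityMeasure ν := by
    refine ⟨?_⟩
    rw [hν, withDensity_apply _ MeasurableSet.univ, Measure.restrict_univ,
      ← ofReal_integral_eq_lintegral_ofReal (integrable_of_integral_eq_one hk1)
        (Filter.Eventually.of_forall hk0), hk1, ENNReal.ofReal_one]
  have hg : StronglyMeasurable (Function.uncurry fun z s : E => h (z + s) - h z) :=
    (hm.comp_measurable (measurable_fst.add measurable_snd)).sub (hm.comp_measurable measurable_fst)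
  have hgz (z : E) : StronglyMeasurable fun s => h (z + s) - h z := hg.comp_measurable
    (measurable_const.prodMk measurable_id)
  have hpt : ∀ z ∈ S, ‖localAverage μ B k h z - h z‖ₑ ≤ eLpNorm (fun s => h (z + s) - h z) 2 ν := by
    intro z hz
    rw [localAverage_sub_self hk hks hk1 hh fun w hw => hksupp _ (hSB z hz w hw)]
    calc _ ≤ ∫⁻ s, ‖k s • (h (z + s) - h z)‖ₑ ∂μ := enorm_integral_le_lintegral_enorm _
      _ = ∫⁻ s, ‖h (z + s) - h z‖ₑ ∂ν := by
        rw [hν, lintegral_withDensity_eq_lintegral_mul _ hkm (hgz z).enorm]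
        refine lintegral_congr fun s => ?_
        rw [enorm_smul, Pi.mul_apply, Real.enorm_of_nonneg (hk0 s)]
      _ = eLpNorm (fun s => h (z + s) - h z) 1 ν := eLpNorm_one_eq_lintegral_enorm.symm
      _ ≤ _ := eLpNorm_le_eLpNorm_of_exponent_le (by norm_num) (hgz z).aestronglyMeasurable
  have hsq {Y : Type _} [MeasurableSpace Y] (F : Y → W) (ρ : Measure Y) :
      eLpNorm F 2 ρ ^ (2 : ℝ) = ∫⁻ y, ‖F y‖ₑ ^ (2 : ℝ) ∂ρ := by
    rw [eLpNorm_eq_lintegral_rpow_enorm_toReal (by norm_num) (by norm_num), ← ENNReal.rpow_mul]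
    norm_num
  have hνs : ∀ᵐ s ∂ν, ‖s‖ ≤ s₀ := by
    rw [hν, ae_withDensity_iff hkm]
    refine Filter.Eventually.of_forall fun s hs => ?_
    by_contra hn
    exact hs (by rw [hksupp s (not_le.1 hn), ENNReal.ofReal_zero])
  refine (ENNReal.rpow_le_rpow_iff (z := 2) (by norm_num)).1 ?_
  calc _ = ∫⁻ z in S, ‖localAverage μ B k h z - h z‖ₑ ^ (2 : ℝ) ∂μ := hsq _ _
    _ ≤ ∫⁻ z in S, ∫⁻ s, ‖h (z + s) - h z‖ₑ ^ (2 : ℝ) ∂ν ∂μ := by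
        refine setLIntegral_mono' hS fun z hz => ?_
        rw [← hsq]
        exact ENNReal.rpow_le_rpow (hpt z hz) (by norm_num)
    _ = ∫⁻ s, ∫⁻ z in S, ‖h (z + s) - h z‖ₑ ^ (2 : ℝ) ∂μ ∂ν :=
        lintegral_lintegral_swap (hg.enorm.pow_const 2).aemeasurable
    _ ≤ ∫⁻ _s, a ^ (2 : ℝ) ∂ν := by
        refine lintegral_mono_ae ?_
        filter_upwards [hνs] with s hs
        rw [← hsq]
        exact ENNReal.rpow_le_rpow (ha s hs) (by norm_num)
    _ = a ^ (2 : ℝ) := by simp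

/-- The case of functions which are only almost everywhere strongly measurable: translation
invariance of the measure makes the translates of equivalent functions equivalent. -/
theorem eLpNorm_localAverage_sub_self_le (hk : Continuous k)
    (hks : HasCompactSupport k) (hk0 : ∀ s, 0 ≤ k s) (hk1 : ∫ s, k s ∂μ = 1) {s₀ : ℝ}
    (hksupp : ∀ s, s₀ < ‖s‖ → k s = 0) (hh : IntegrableOn h B μ)
    (hS : MeasurableSet S) (hB : MeasurableSet B) (hs₀ : 0 ≤ s₀)
    (hSB : ∀ z ∈ S, ∀ w ∉ B, s₀ < ‖w - z‖) {a : ℝ≥0∞}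
    (ha : ∀ s, ‖s‖ ≤ s₀ → eLpNorm (fun z => h (z + s) - h z) 2 (μ.restrict S) ≤ a) :
    eLpNorm (fun z => localAverage μ B k h z - h z) 2 (μ.restrict S) ≤ a := by
  obtain ⟨H, hH, hhH⟩ := hh.aestronglyMeasurable
  have hae : ∀ᵐ z ∂μ, z ∈ B → h z = H z := (ae_restrict_iff' hB).1 hhH
  -- translates of points of `S` by at most `s₀` remain in `B`
  have hmem : ∀ z ∈ S, ∀ s, ‖s‖ ≤ s₀ → z + s ∈ B := fun z hz s hs => by
    by_contra hn
    have := hSB z hz _ hn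
    rw [add_sub_cancel_left] at this
    linarith
  have htrans (s : E) (hs : ‖s‖ ≤ s₀) : ∀ᵐ z ∂μ.restrict S, h (z + s) = H (z + s) := by
    rw [ae_restrict_iff' hS]
    filter_upwards [(measurePreserving_add_right μ s).quasiMeasurePreserving.ae hae] with z hz hzS
    exact hz (hmem z hzS s hs)
  have h0 : ∀ᵐ z ∂μ.restrict S, h z = H z := by
    simpa using htrans 0 (by simpa using hs₀)
  have key := eLpNorm_localAverage_sub_self_le_of_stronglyMeasurable (h := H) hk hks hk0 hk1 hksupp
    (hh.congr hhH) hH hS hSB (a := a) fun s hs => by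
      refine le_of_eq_of_le (eLpNorm_congr_ae ?_) (ha s hs)
      filter_upwards [htrans s hs, h0] with z h1 h2
      rw [h1, h2]
  refine le_of_eq_of_le (eLpNorm_congr_ae ?_) key
  filter_upwards [h0] with z hz
  rw [localAverage_congr hhH, hz]

end LocalAverage

end MeasureTheory


/-! ### Finitely many local averages -/

namespace MeasureTheory

section FiniteFunctionals

variable {E W : Type*} [NormedAddCommGroup E] [NormedSpace ℝ E] [FiniteDimensional ℝ E]
  [MeasurableSpace E] [BorelSpace E] [NormedAddCommGroup W] [NormedSpace ℝ W] [CompleteSpace W]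

theorem eLpNorm_two_le_of_bound {μ : Measure E} {S : Set E} (hS : MeasurableSet S) (hμ : μ S ≠ ⊤)
    {f : E → W} {c : ℝ} (h : ∀ z ∈ S, ‖f z‖ ≤ c) :
    eLpNorm f 2 (μ.restrict S) ≤ ENNReal.ofReal ((μ S).toReal ^ (1 / 2 : ℝ) * c) := by
  refine (eLpNorm_le_of_ae_bound ((ae_restrict_mem hS).mono h)).trans (le_of_eq ?_)
  rw [Measure.restrict_apply_univ, ENNReal.ofReal_mul (by positivity),
    ← ENNReal.ofReal_rpow_of_nonneg ENNReal.toReal_nonneg (by norm_num), ENNReal.ofReal_toReal hμ]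
  norm_num

theorem integral_norm_le_of_eLpNorm_two_le {μ : Measure E} {B : Set E} (hμ : μ B ≠ ⊤)
    {f : E → W} (hf : MemLp f 2 (μ.restrict B)) {M : ℝ} (hM : 0 ≤ M)
    (h : eLpNorm f 2 (μ.restrict B) ≤ ENNReal.ofReal M) :
    IntegrableOn f B μ ∧ ∫ w in B, ‖f w‖ ∂μ ≤ (μ B).toReal ^ (1 / 2 : ℝ) * M := by
  have : IsFiniteMeasure (μ.restrict B) := ⟨by rwa [Measure.restrict_apply_univ, lt_top_iff_ne_top]⟩
  refine ⟨hf.integrable (by norm_num), ?_⟩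
  rw [integral_norm_eq_lintegral_enorm hf.1]
  refine ENNReal.toReal_le_of_le_ofReal (by positivity) ?_
  rw [← eLpNorm_one_eq_lintegral_enorm]
  refine (eLpNorm_le_eLpNorm_mul_rpow_measure_univ (q := 2) (by norm_num) hf.1).trans ?_
  rw [Measure.restrict_apply_univ, mul_comm, ENNReal.ofReal_mul (by positivity),
    ← ENNReal.ofReal_rpow_of_nonneg ENNReal.toReal_nonneg (by norm_num), ENNReal.ofReal_toReal hμ]
  norm_num
  gcongr

/-- The core of the Kolmogorov–Riesz theorem: among functions which are bounded in `L²` and close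
to their small translates, finitely many local averages determine a function up to a small error.
-/
theorem exists_finite_localAverages (μ : Measure E) [μ.IsAddHaarMeasure] (z₀ : E) {R s₀ M ε : ℝ}
    (hs₀ : 0 < s₀) (hsR : s₀ ≤ R) (hM : 0 ≤ M) (hε : 0 < ε) :
    ∃ (t : Finset E) (F : (E → W) → (t → W)) (M' ρ : ℝ), 0 < ρ ∧
      (∀ h : E → W, MemLp h 2 (μ.restrict (Metric.closedBall z₀ (2 * R))) →
        eLpNorm h 2 (μ.restrict (Metric.closedBall z₀ (2 * R))) ≤ ENNReal.ofReal M →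
        ‖F h‖ ≤ M') ∧
      ∀ h h' : E → W, MemLp h 2 (μ.restrict (Metric.closedBall z₀ (2 * R))) →
        MemLp h' 2 (μ.restrict (Metric.closedBall z₀ (2 * R))) →
        eLpNorm h 2 (μ.restrict (Metric.closedBall z₀ (2 * R))) ≤ ENNReal.ofReal M →
        eLpNorm h' 2 (μ.restrict (Metric.closedBall z₀ (2 * R))) ≤ ENNReal.ofReal M →
        (∀ s, ‖s‖ ≤ s₀ → eLpNorm (fun z => h (z + s) - h z) 2
          (μ.restrict (Metric.closedBall z₀ R)) ≤ ENNReal.ofReal ε) →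
        (∀ s, ‖s‖ ≤ s₀ → eLpNorm (fun z => h' (z + s) - h' z) 2
          (μ.restrict (Metric.closedBall z₀ R)) ≤ ENNReal.ofReal ε) →
        dist (F h) (F h') < ρ →
        eLpNorm (h - h') 2 (μ.restrict (Metric.closedBall z₀ R)) ≤ ENNReal.ofReal (3 * ε) := by
  set S := Metric.closedBall z₀ R with hS
  set B := Metric.closedBall z₀ (2 * R) with hB
  have hSm : MeasurableSet S := Metric.isClosed_closedBall.measurableSet
  have hBm : MeasurableSet B := Metric.isClosed_closedBall.measurableSet
  have hSμ : μ S ≠ ⊤ := (isCompact_closedBall z₀ R).measure_lt_top.ne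
  have hBμ : μ B ≠ ⊤ := (isCompact_closedBall z₀ (2 * R)).measure_lt_top.ne
  have hSB : ∀ z ∈ S, ∀ w ∉ B, s₀ < ‖w - z‖ := fun z hz w hw => by
    have h1 : ‖z - z₀‖ ≤ R := by simpa [hS, dist_eq_norm] using hz
    have h2 : 2 * R < ‖w - z₀‖ := by simpa [hB, dist_eq_norm] using hw
    have h3 : ‖w - z₀‖ ≤ ‖w - z‖ + ‖z - z₀‖ := norm_sub_le_norm_sub_add_norm_sub w z z₀
    linarith
  have hSBs : S ⊆ B := Metric.closedBall_subset_closedBall (by linarith)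
  let χ : ContDiffBump (0 : E) := ⟨s₀ / 2, s₀, by linarith, by linarith⟩
  set k : E → ℝ := χ.normed μ with hk'
  have hk : Continuous k := χ.continuous_normed
  have hks : HasCompactSupport k := χ.hasCompactSupport_normed
  have hk0 : ∀ s, 0 ≤ k s := χ.nonneg_normed
  have hk1 : ∫ s, k s ∂μ = 1 := χ.integral_normed
  have hksupp : ∀ s, s₀ < ‖s‖ → k s = 0 := fun s hs => by
    have h1 : s ∉ Function.support k := by
      rw [hk', χ.support_normed_eq, mem_ball_zero_iff]
      exact not_lt.2 hs.le
    simpa using h1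
  obtain ⟨c, hc⟩ := hk.bounded_above_of_compact_support hks
  have hc0 : 0 ≤ c := (norm_nonneg _).trans (hc 0)
  set β := (μ B).toReal ^ (1 / 2 : ℝ) * M with hβ
  have hβ0 : 0 ≤ β := by positivity
  set m := (μ S).toReal ^ (1 / 2 : ℝ) with hm
  have hm0 : 0 ≤ m := by positivity
  set τ := ε / (m + 1) with hτ
  have hτ0 : 0 < τ := by positivity
  obtain ⟨η, hη, H⟩ := Metric.uniformContinuous_iff.1 (hks.uniformContinuous_of_continuous hk)
    (τ / (3 * (β + 1))) (by positivity)
  obtain ⟨t, -, ht⟩ := (isCompact_closedBall z₀ R).elim_nhds_subcover (fun z => Metric.ball z η)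
    fun z _ => Metric.ball_mem_nhds z hη
  refine ⟨t, fun h i => localAverage μ B k h i, c * β, τ / 3, by positivity, ?_, ?_⟩
  · intro h hh hhM
    obtain ⟨hi, hI⟩ := integral_norm_le_of_eLpNorm_two_le hBμ hh hM hhM
    refine (pi_norm_le_iff_of_nonneg (by positivity)).2 fun i => ?_
    exact (norm_localAverage_le hc hi _).trans (by gcongr)
  · intro h h' hh hh' hhM hhM' htr htr' hd
    obtain ⟨hi, hI⟩ := integral_norm_le_of_eLpNorm_two_le hBμ hh hM hhM
    obtain ⟨hi', hI'⟩ := integral_norm_le_of_eLpNorm_two_le hBμ hh' hM hhM'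
    have hclose (f : E → W) (hf : IntegrableOn f B μ) (hfI : ∫ w in B, ‖f w‖ ∂μ ≤ β) {z z' : E}
        (hz : dist z z' < η) :
        ‖localAverage μ B k f z - localAverage μ B k f z'‖ ≤ τ / 3 := by
      refine (norm_localAverage_sub_le hk hc (σ := τ / (3 * (β + 1))) (fun w => ?_) hf).trans ?_
      · rw [← dist_eq_norm]
        refine (H ?_).le
        rwa [dist_sub_left]
      · calc τ / (3 * (β + 1)) * ∫ w in B, ‖f w‖ ∂μ ≤ τ / (3 * (β + 1)) * (β + 1) := by
              gcongr
              linarith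
          _ = τ / 3 := by field_simp
    have hpt : ∀ z ∈ S, ‖localAverage μ B k h z - localAverage μ B k h' z‖ ≤ τ := by
      intro z hz
      obtain ⟨i, hit, hzi⟩ := mem_iUnion₂.1 (ht hz)
      have h1 := hclose h hi hI (Metric.mem_ball.1 hzi)
      have h2 := hclose h' hi' hI' (Metric.mem_ball'.1 hzi)
      have h3 : ‖localAverage μ B k h i - localAverage μ B k h' i‖ ≤ τ / 3 := by
        rw [← dist_eq_norm]
        exact (dist_le_pi_dist (fun i : t => localAverage μ B k h i)
          (fun i : t => localAverage μ B k h' i) ⟨i, hit⟩).trans hd.le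
      calc _ = ‖(localAverage μ B k h z - localAverage μ B k h i) +
            (localAverage μ B k h i - localAverage μ B k h' i) +
            (localAverage μ B k h' i - localAverage μ B k h' z)‖ := by
              congr 1
              abel
        _ ≤ τ / 3 + τ / 3 + τ / 3 := (norm_add₃_le).trans (by gcongr)
        _ = τ := by ring
    have e1 := eLpNorm_localAverage_sub_self_le hk hks hk0 hk1 hksupp hi hSm hBm hs₀.le hSB htr
    have e2 := eLpNorm_localAverage_sub_self_le hk hks hk0 hk1 hksupp hi' hSm hBm hs₀.le hSB htr'
    have e3 := eLpNorm_two_le_of_bound hSm hSμ hpt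
    have hmτ : m * τ ≤ ε := by
      rw [hτ, mul_div_assoc', div_le_iff₀ (by positivity)]
      nlinarith
    have hres : μ.restrict S ≤ μ.restrict B := Measure.restrict_mono hSBs le_rfl
    have m0 := (continuous_localAverage hk hks hi).aestronglyMeasurable (μ := μ.restrict S)
    have m0' := (continuous_localAverage hk hks hi').aestronglyMeasurable (μ := μ.restrict S)
    have m1 : AEStronglyMeasurable (fun z => localAverage μ B k h z - h z) (μ.restrict S) :=
      m0.sub (hh.1.mono_measure hres)
    have m2 : AEStronglyMeasurable (fun z => localAverage μ B k h' z - h' z) (μ.restrict S) :=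
      m0'.sub (hh'.1.mono_measure hres)
    have hsplit : h - h' = ((fun z => localAverage μ B k h' z - h' z) -
        fun z => localAverage μ B k h z - h z) +
        fun z => localAverage μ B k h z - localAverage μ B k h' z := by
      funext z
      simp only [Pi.sub_apply, Pi.add_apply]
      abel
    rw [hsplit]
    calc _ ≤ (ENNReal.ofReal ε + ENNReal.ofReal ε) + ENNReal.ofReal (m * τ) :=
          (eLpNorm_add_le (m2.sub m1) (m0.sub m0') (by norm_num)).trans
            (add_le_add ((eLpNorm_sub_le m2 m1 (by norm_num)).trans (add_le_add e2 e1)) e3)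
      _ = ENNReal.ofReal (ε + ε + m * τ) := by
          rw [ENNReal.ofReal_add (by positivity) (by positivity), ENNReal.ofReal_add hε.le hε.le]
      _ ≤ _ := ENNReal.ofReal_le_ofReal (by linarith)

end FiniteFunctionals

end MeasureTheory


/-! ### Sufficiency of the two conditions -/

/-- A bounded map to a proper normed space takes only finitely many values, up to a small error. -/
theorem exists_finite_discretization_of_norm_le {α V : Type*} [NormedAddCommGroup V] [ProperSpace V]
    (Φ : α → V) {M ρ : ℝ} (hΦ : ∀ a, ‖Φ a‖ ≤ M) (hρ : 0 < ρ) :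
    ∃ (N : ℕ) (D : α → Fin N), ∀ a b, D a = D b → dist (Φ a) (Φ b) < ρ := by
  obtain ⟨s, hs, hcov⟩ := Metric.totallyBounded_iff.1
    (isCompact_closedBall (0 : V) M).totallyBounded (ρ / 2) (half_pos hρ)
  have h1 (a : α) : ∃ y : s, dist (Φ a) y < ρ / 2 := by
    obtain ⟨y, hy, hay⟩ := mem_iUnion₂.1 (hcov (mem_closedBall_zero_iff.2 (hΦ a)))
    exact ⟨⟨y, hy⟩, hay⟩
  choose D hD using h1
  have := hs.to_subtype
  refine ⟨Nat.card s, fun a => Finite.equivFin s (D a), fun a b hab => ?_⟩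
  have h2 : D a = D b := (Finite.equivFin s).injective hab
  calc dist (Φ a) (Φ b) ≤ dist (Φ a) (D a) + dist (Φ b) (D a) := dist_triangle_right _ _ _
    _ < ρ / 2 + ρ / 2 := by
      gcongr
      · exact hD a
      · rw [h2]
        exact hD b
    _ = ρ := add_halves ρ

namespace HermitianManifold

section Converse

variable {n : ℕ} {X : Type*} [TopologicalSpace X] [ChartedSpace (Fin n → ℂ) X]
  [IsManifold 𝓘(ℂ, Fin n → ℂ) ω X] {k : ℕ}
  [RiemannianBundle (fun x : X => TangentSpace 𝓘(ℝ, Fin n → ℂ) x)]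
  [MeasurableSpace X] [BorelSpace X] {φ : X → ℝ}

/-- Where a map is a translation in the chart, its derivative is the identity, and the pull-back
translates the coefficients. -/
theorem coef_pullback_of_translation [T2Space X] {x₀ : X} {Φ : X → X} {r : ℝ} {s : Fin n → ℂ}
    (hr : Metric.ball (chartAt (Fin n → ℂ) x₀ x₀) r ⊆ (chartAt (Fin n → ℂ) x₀).target)
    (hΦ : ∀ z ∈ Metric.ball (chartAt (Fin n → ℂ) x₀ x₀) r, Φ ((chartAt (Fin n → ℂ) x₀).symm z) =
      (chartAt (Fin n → ℂ) x₀).symm (z + s))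
    (hs : ∀ z ∈ Metric.ball (chartAt (Fin n → ℂ) x₀ x₀) r, z + s ∈ (chartAt (Fin n → ℂ) x₀).target)
    (hd : MDifferentiable 𝓘(ℝ, Fin n → ℂ) 𝓘(ℝ, Fin n → ℂ) Φ) (f : Form n X k) {z : Fin n → ℂ}
    (hz : z ∈ Metric.ball (chartAt (Fin n → ℂ) x₀ x₀) r) :
    coef x₀ (f.pullback Φ) z = coef x₀ f (z + s) := by
  have h1 : coordMap x₀ Φ =ᶠ[𝓝 z] fun w => w + s := by
    filter_upwards [Metric.isOpen_ball.mem_nhds hz] with w hw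
    rw [coordMap, Function.comp_apply, Function.comp_apply, hΦ w hw,
      (chartAt (Fin n → ℂ) x₀).right_inv (hs w hw)]
  have h2 : fderiv ℝ (coordMap x₀ Φ) z = ContinuousLinearMap.id ℝ (Fin n → ℂ) := by
    rw [h1.fderiv_eq]
    exact ((hasFDerivAt_id z).add_const s).fderiv
  funext P
  rw [coef_pullback_apply (hr hz) (hd _) (by
    rw [hΦ z hz]
    exact (chartAt (Fin n → ℂ) x₀).map_target (hs z hz)), h1.eq_of_nhds, h2]
  exact evalCoef_realBasis _ P

variable [IsContMDiffRiemannianBundle 𝓘(ℝ, Fin n → ℂ) ∞ (Fin n → ℂ)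
    (fun x : X => TangentSpace 𝓘(ℝ, Fin n → ℂ) x)] [SecondCountableTopology X] {p q : ℕ}

theorem l2Norm_sub_le {f g : Form n X k} (hf : IsMeasurableForm f) (hg : IsMeasurableForm g)
    (S : Set X) : l2Norm φ S (f - g) ≤ l2Norm φ S f + l2Norm φ S g := by
  have h0 : IsMeasurableForm ((-1 : ℂ) • g) := fun x₀ u => (hg x₀ u).const_smul (-1 : ℂ)
  have h1 : f - g = f + (-1 : ℂ) • g := by rw [neg_one_smul, sub_eq_add_neg]
  rw [h1]
  refine (l2Norm_add_le hf h0 φ S).trans ?_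
  rw [l2Norm_smul]
  simp

variable [T2Space X]

/-- Stability under pull-back by deformations yields, in a good chart, stability of the
coefficients under small translations. -/
theorem GoodChart.exists_eLpNorm_translate_sub_le (hX : IsHermitianMetric n X) {x₀ : X} {R C : ℝ}
    (h : GoodChart (n := n) φ x₀ R C) {A : Set (Form n X k)}
    (hA : ∀ ε : ℝ, 0 < ε → ∀ Ω : Set X, IsOpen Ω → IsCompact (closure Ω) →
      ∃ δ : ℝ, 0 < δ ∧ ∀ Φ ∈ Def (n := n) δ Ω, ∀ f ∈ A,
        l2Norm φ univ (f.pullback Φ - f) < ENNReal.ofReal ε) {ε : ℝ} (hε : 0 < ε) :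
    ∃ s₀ : ℝ, 0 < s₀ ∧ s₀ ≤ R ∧ ∀ f ∈ A, ∀ s : Fin n → ℂ, ‖s‖ ≤ s₀ →
      eLpNorm (fun z => coef x₀ f (z + s) - coef x₀ f z) 2
        (volume.restrict (Metric.closedBall (chartAt (Fin n → ℂ) x₀ x₀) R)) ≤
          ENNReal.ofReal ε := by
  obtain ⟨c, hc, hbd⟩ := h.exists_l2Norm_bounds hX k
  have hR := h.pos
  set z₀ := chartAt (Fin n → ℂ) x₀ x₀ with hz₀
  have hΩo : IsOpen ((chartAt (Fin n → ℂ) x₀).symm '' Metric.ball z₀ (3 * R)) :=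
    (chartAt (Fin n → ℂ) x₀).isOpen_image_symm_of_subset_target Metric.isOpen_ball
      (Metric.ball_subset_closedBall.trans h.subset)
  have hΩc : IsCompact (closure ((chartAt (Fin n → ℂ) x₀).symm '' Metric.ball z₀ (3 * R))) :=
    ((isCompact_closedBall z₀ (3 * R)).image_of_continuousOn
      ((chartAt (Fin n → ℂ) x₀).continuousOn_symm.mono h.subset)).closure_of_subset
      (image_mono Metric.ball_subset_closedBall)
  obtain ⟨δ, hδ, H⟩ := hA (ε / c) (by positivity) _ hΩo hΩc
  obtain ⟨s₀, hs₀, hdef⟩ := h.exists_deformation hX hδ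
  refine ⟨min s₀ R, lt_min hs₀ hR, min_le_right _ _, fun f hf s hs => ?_⟩
  obtain ⟨Φ, hΦ, hΦz⟩ := hdef s (hs.trans (min_le_left _ _))
  have hSm : MeasurableSet (Metric.closedBall z₀ R) := Metric.isClosed_closedBall.measurableSet
  have hS3 : Metric.closedBall z₀ R ⊆ Metric.closedBall z₀ (3 * R) :=
    Metric.closedBall_subset_closedBall (by linarith)
  have hzs : ∀ z ∈ Metric.ball z₀ (2 * R), z + s ∈ (chartAt (Fin n → ℂ) x₀).target := by
    intro z hz
    refine h.subset ?_
    have h1 : ‖z - z₀‖ < 2 * R := by simpa [dist_eq_norm] using hz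
    rw [Metric.mem_closedBall, dist_eq_norm]
    calc ‖z + s - z₀‖ = ‖(z - z₀) + s‖ := by congr 1; abel
      _ ≤ 2 * R + R := (norm_add_le _ _).trans (add_le_add h1.le (hs.trans (min_le_right _ _)))
      _ = 3 * R := by ring
  have hcoef : ∀ z ∈ Metric.closedBall z₀ R,
      coef x₀ f (z + s) - coef x₀ f z = coef x₀ (f.pullback Φ - f) z := fun z hz => by
    rw [coef_sub, coef_pullback_of_translation (r := 2 * R)
      ((Metric.ball_subset_ball (by linarith)).trans
        (Metric.ball_subset_closedBall.trans h.subset))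
      (fun w hw => hΦz w (Metric.ball_subset_closedBall hw)) hzs
      (Φ.contMDiff.mdifferentiable (by simp)) f (Metric.closedBall_subset_ball (by linarith) hz)]
  calc _ = eLpNorm (coef x₀ (f.pullback Φ - f)) 2 (volume.restrict (Metric.closedBall z₀ R)) := by
        refine eLpNorm_congr_ae ?_
        filter_upwards [ae_restrict_mem hSm] with z hz
        exact hcoef z hz
    _ ≤ ENNReal.ofReal c * l2Norm φ univ (f.pullback Φ - f) :=
        (hbd _ hS3 hSm _).2.trans (by
          gcongr ENNReal.ofReal c * ?_
          exact l2Norm_mono_set (subset_univ _) _)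
    _ ≤ ENNReal.ofReal c * ENNReal.ofReal (ε / c) := by
        gcongr
        exact (H Φ hΦ f hf).le
    _ = ENNReal.ofReal ε := by
        rw [← ENNReal.ofReal_mul hc.le]
        congr 1
        field_simp

/-- A bounded family which is stable under deformations takes, up to a small error in a good chart,
only finitely many values. -/
theorem GoodChart.exists_discretization (hX : IsHermitianMetric n X) {x₀ : X} {R C : ℝ}
    (h : GoodChart (n := n) φ x₀ R C) {A : Set (Form n X k)}
    (hA : ∀ ε : ℝ, 0 < ε → ∀ Ω : Set X, IsOpen Ω → IsCompact (closure Ω) →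
      ∃ δ : ℝ, 0 < δ ∧ ∀ Φ ∈ Def (n := n) δ Ω, ∀ f ∈ A,
        l2Norm φ univ (f.pullback Φ - f) < ENNReal.ofReal ε)
    (hAm : ∀ f ∈ A, IsMeasurableForm f) {M : ℝ} (hM : 0 ≤ M)
    (hAM : ∀ f ∈ A, l2Norm φ univ f ≤ ENNReal.ofReal M) {ε : ℝ} (hε : 0 < ε) :
    ∃ (N : ℕ) (D : A → Fin N), ∀ f g, D f = D g →
      l2Norm φ ((chartAt (Fin n → ℂ) x₀).symm ''
        Metric.closedBall (chartAt (Fin n → ℂ) x₀ x₀) R) (f.1 - g.1) ≤ ENNReal.ofReal ε := by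
  obtain ⟨c, hc, hbd⟩ := h.exists_l2Norm_bounds hX k
  have hR := h.pos
  obtain ⟨s₀, hs₀, hsR, htr⟩ := h.exists_eLpNorm_translate_sub_le hX hA (ε := ε / (3 * c))
    (by positivity)
  set z₀ := chartAt (Fin n → ℂ) x₀ x₀ with hz₀
  have hSm : MeasurableSet (Metric.closedBall z₀ R) := Metric.isClosed_closedBall.measurableSet
  have hBm : MeasurableSet (Metric.closedBall z₀ (2 * R)) :=
    Metric.isClosed_closedBall.measurableSet
  have hS3 : Metric.closedBall z₀ R ⊆ Metric.closedBall z₀ (3 * R) :=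
    Metric.closedBall_subset_closedBall (by linarith)
  have hB3 : Metric.closedBall z₀ (2 * R) ⊆ Metric.closedBall z₀ (3 * R) :=
    Metric.closedBall_subset_closedBall (by linarith)
  have hnorm : ∀ f ∈ A, eLpNorm (coef x₀ f) 2 (volume.restrict (Metric.closedBall z₀ (2 * R))) ≤
      ENNReal.ofReal (c * M) := fun f hf => by
    rw [ENNReal.ofReal_mul hc.le]
    refine (hbd _ hB3 hBm f).2.trans ?_
    gcongr ENNReal.ofReal c * ?_
    exact (l2Norm_mono_set (subset_univ _) f).trans (hAM f hf)
  have hmem : ∀ f ∈ A, MemLp (coef x₀ f) 2 (volume.restrict (Metric.closedBall z₀ (2 * R))) :=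
    fun f hf => ⟨h.aestronglyMeasurable_coef (hAm f hf) hB3 hBm,
      (hnorm f hf).trans_lt ENNReal.ofReal_lt_top⟩
  obtain ⟨t, F, M', ρ, hρ, hF1, hF2⟩ := exists_finite_localAverages (W := Coef n k) volume z₀
    (M := c * M) (ε := ε / (3 * c)) hs₀ hsR (by positivity) (by positivity)
  obtain ⟨N, D, hD⟩ := exists_finite_discretization_of_norm_le (fun f : A => F (coef x₀ f.1))
    (fun f => hF1 _ (hmem f.1 f.2) (hnorm f.1 f.2)) hρ
  refine ⟨N, D, fun f g hfg => ?_⟩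
  have h1 := hF2 _ _ (hmem f.1 f.2) (hmem g.1 g.2) (hnorm f.1 f.2) (hnorm g.1 g.2)
    (htr f.1 f.2) (htr g.1 g.2) (hD f g hfg)
  calc _ ≤ ENNReal.ofReal c * eLpNorm (coef x₀ (f.1 - g.1)) 2
          (volume.restrict (Metric.closedBall z₀ R)) := (hbd _ hS3 hSm _).1
    _ ≤ ENNReal.ofReal c * ENNReal.ofReal (3 * (ε / (3 * c))) := by
        gcongr ENNReal.ofReal c * ?_
        exact h1
    _ = ENNReal.ofReal ε := by
        rw [← ENNReal.ofReal_mul hc.le]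
        congr 1
        field_simp

/-- The sufficiency of the two conditions for total boundedness. -/
theorem totallyBounded_of_deformations (hX : IsHermitianMetric n X) (hφ : Continuous φ)
    {A : Set (L2 n X φ p q)} (hA : Bornology.IsBounded A)
    (h1 : ∀ ε : ℝ, 0 < ε → ∀ Ω : Set X, IsOpen Ω → IsCompact (closure Ω) →
      ∃ δ : ℝ, 0 < δ ∧ ∀ Φ ∈ Def (n := n) δ Ω,
        ∀ f : squareIntegrable n X φ p q, SeparationQuotient.mk f ∈ A →
          l2Norm φ univ (f.1.pullback Φ - f.1) < ENNReal.ofReal ε)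
    (h2 : ∀ ε : ℝ, 0 < ε → ∃ Ω : Set X, IsOpen Ω ∧ IsCompact (closure Ω) ∧
      ∀ f : squareIntegrable n X φ p q, SeparationQuotient.mk f ∈ A →
        l2Norm φ Ωᶜ f.1 < ENNReal.ofReal ε) : TotallyBounded A := by
  refine Metric.totallyBounded_of_finite_discretization fun ε hε => ?_
  obtain ⟨M, hM0, hM⟩ := hA.exists_pos_norm_le
  obtain ⟨Ω, hΩo, hΩc, hΩ⟩ := h2 (ε / 8) (by positivity)
  obtain ⟨t, R, C, hgood, hcov⟩ := exists_finset_goodChart hX hφ hΩc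
  let B : Set (Form n X (p + q)) := {f | ∃ g : squareIntegrable n X φ p q,
    SeparationQuotient.mk g ∈ A ∧ g.1 = f}
  have hBdef : ∀ ε : ℝ, 0 < ε → ∀ Ω : Set X, IsOpen Ω → IsCompact (closure Ω) →
      ∃ δ : ℝ, 0 < δ ∧ ∀ Φ ∈ Def (n := n) δ Ω, ∀ f ∈ B,
        l2Norm φ univ (f.pullback Φ - f) < ENNReal.ofReal ε := fun ε hε Ω ho hcl => by
    obtain ⟨δ, hδ, H⟩ := h1 ε hε Ω ho hcl
    refine ⟨δ, hδ, ?_⟩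
    rintro Φ hΦ _ ⟨g, hg, rfl⟩
    exact H Φ hΦ g hg
  have hBm : ∀ f ∈ B, IsMeasurableForm f := by
    rintro _ ⟨g, -, rfl⟩
    exact g.2.1
  have hBM : ∀ f ∈ B, l2Norm φ univ f ≤ ENNReal.ofReal M := by
    rintro _ ⟨g, hg, rfl⟩
    rw [← norm_mk]
    exact ENNReal.ofReal_le_ofReal (hM _ hg)
  choose N D hD using fun x => (hgood x).exists_discretization hX hBdef hBm hM0.le hBM
    (ε := ε / (4 * (t.card + 1))) (by positivity)
  -- a representative of each class
  have hout (a : A) : SeparationQuotient.mk (Quotient.out a.1) = a.1 := Quotient.out_eq a.1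
  have houtA (a : A) : SeparationQuotient.mk (Quotient.out a.1) ∈ A := by
    rw [hout a]
    exact a.2
  let r : A → B := fun a => ⟨(Quotient.out a.1).1, Quotient.out a.1, houtA a, rfl⟩
  refine ⟨∀ x : t, Fin (N x), Fintype.ofFinite _, fun a x => D x (r a), fun a b hab => ?_⟩
  set f : squareIntegrable n X φ p q := Quotient.out a.1 with hf
  set g : squareIntegrable n X φ p q := Quotient.out b.1 with hg
  have hin : l2Norm φ Ω (f.1 - g.1) ≤ ENNReal.ofReal (ε / 4) := by
    calc l2Norm φ Ω (f.1 - g.1)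
        ≤ ∑ x ∈ t, l2Norm φ ((chartAt (Fin n → ℂ) x).symm ''
          Metric.closedBall (chartAt (Fin n → ℂ) x x) (R x)) (f.1 - g.1) :=
          (l2Norm_mono_set (subset_closure.trans hcov) _).trans (l2Norm_biUnion_le _ _ _)
      _ ≤ ∑ _x ∈ t, ENNReal.ofReal (ε / (4 * (t.card + 1))) :=
          Finset.sum_le_sum fun x hx => hD x (r a) (r b) (congrFun hab ⟨x, hx⟩)
      _ = ENNReal.ofReal (t.card * (ε / (4 * (t.card + 1)))) := by
          rw [Finset.sum_const, nsmul_eq_mul, ENNReal.ofReal_mul (by positivity),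
            ENNReal.ofReal_natCast]
      _ ≤ ENNReal.ofReal (ε / 4) := by
          refine ENNReal.ofReal_le_ofReal ?_
          rw [mul_div_assoc', div_le_div_iff₀ (by positivity) (by norm_num)]
          nlinarith
  have hout' : l2Norm φ Ωᶜ (f.1 - g.1) ≤ ENNReal.ofReal (ε / 4) := by
    calc _ ≤ ENNReal.ofReal (ε / 8) + ENNReal.ofReal (ε / 8) :=
          (l2Norm_sub_le f.2.1 g.2.1 _).trans
            (add_le_add (hΩ f (houtA a)).le (hΩ g (houtA b)).le)
      _ = ENNReal.ofReal (ε / 4) := by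
          rw [← ENNReal.ofReal_add (by positivity) (by positivity)]
          congr 1
          ring
  rw [← ENNReal.ofReal_lt_ofReal_iff hε, ← hout a, ← hout b, dist_mk, ← union_compl_self Ω]
  calc _ ≤ ENNReal.ofReal (ε / 4) + ENNReal.ofReal (ε / 4) :=
        (l2Norm_union_le _ _ _).trans (add_le_add hin hout')
    _ = ENNReal.ofReal (ε / 2) := by
        rw [← ENNReal.ofReal_add (by positivity) (by positivity)]
        congr 1
        ring
    _ < ENNReal.ofReal ε := (ENNReal.ofReal_lt_ofReal_iff hε).2 (half_lt_self hε)

end Converse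
end HermitianManifold


end

theorem mainTheorem4 {n : ℕ} {X : Type*} [TopologicalSpace X] [T2Space X]
    [SecondCountableTopology X] [ConnectedSpace X] [MeasurableSpace X] [BorelSpace X]
    [ChartedSpace (Fin n → ℂ) X] [IsManifold 𝓘(ℂ, Fin n → ℂ) ω X]
    [RiemannianBundle (fun x : X => TangentSpace 𝓘(ℝ, Fin n → ℂ) x)]
    [IsContMDiffRiemannianBundle 𝓘(ℝ, Fin n → ℂ) ∞ (Fin n → ℂ)
      (fun x : X => TangentSpace 𝓘(ℝ, Fin n → ℂ) x)]
    (hX : HermitianManifold.IsHermitianMetric n X)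
    (φ : X → ℝ) (hφ : Continuous φ) (p q : ℕ)
    (A : Set (HermitianManifold.L2 n X φ p q)) (hA : Bornology.IsBounded A) :
    TotallyBounded A ↔
      (∀ ε : ℝ, 0 < ε → ∀ Ω : Set X, IsOpen Ω → IsCompact (closure Ω) →
        ∃ δ : ℝ, 0 < δ ∧ ∀ Φ ∈ HermitianManifold.Def (n := n) δ Ω,
          ∀ f : HermitianManifold.squareIntegrable n X φ p q, SeparationQuotient.mk f ∈ A →
            HermitianManifold.l2Norm φ univ (f.1.pullback Φ - f.1) < ENNReal.ofReal ε) ∧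
      (∀ ε : ℝ, 0 < ε → ∃ Ω : Set X, IsOpen Ω ∧ IsCompact (closure Ω) ∧
        ∀ f : HermitianManifold.squareIntegrable n X φ p q, SeparationQuotient.mk f ∈ A →
          HermitianManifold.l2Norm φ Ωᶜ f.1 < ENNReal.ofReal ε) := by
  constructor
  · intro hT
    refine ⟨fun ε hε Ω _ hΩ => ?_, fun ε hε =>
      HermitianManifold.TotallyBounded.exists_l2Norm_compl_lt hT hε⟩
    obtain ⟨δ, hδ, H⟩ :=
      HermitianManifold.TotallyBounded.exists_l2Norm_pullback_sub_lt hX hφ hT hε hΩ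
    exact ⟨δ, hδ, fun Φ hΦ f hf => H Φ (HermitianManifold.Def_subset_Var δ Ω hΦ) f hf⟩
  · rintro ⟨h1, h2⟩
    exact HermitianManifold.totallyBounded_of_deformations hX hφ hA h1 h2
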